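/- **Setting.** Let $n,p\in\mathbb N$, let $f_1,\dots,f_n:\mathbb R^p\to\mathbb R$ be differentiable with $\nabla f_i$ being $L_i$-Lipschitz, $L=\max_i L_i$, $f=\frac1n\sum_i f_i$. Let $x^*$ be a minimizer of $f$, and assume the Polyak–Łojasiewicz condition $\|\nabla f(x)\|^2\ge 2\mu(f(x)-f(x^*))$ for all $x$, with $\mu>0$. Let $R,C\in\mathbb R^{n\times n}$ be nonnegative, $R$ row stochastic, $C$ column stochastic, both supported by a strongly connected digraph $\mathcal G$ (i.e. $R_{ij}>0$ or $C_{ij}>0$ implies that $(j,i)$ is an edge of $\mathcal G$), such that some node is the root of a spanning tree both of the digraph of $R$ and of the digraph of $C^{\mathsf T}$ (where the digraph of $W$ has an edge from $i$ to $j$ iff $W_{ji}>0$). Let $u_R,u_C\ge 0$ with $u_R^{\mathsf T}R=u_R^{\mathsf T}$, $Cu_C=u_C$, $\mathbf 1^{\mathsf T}u_R=\mathbf 1^{\mathsf T}u_C=n$; $\Pi_R=I-\frac1n\mathbf 1u_R^{\mathsf T}$, $\Pi_C=I-\frac1n u_C\mathbf 1^{\mathsf T}$, $R_\gamma=I-\gamma_x(I-R)$,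 $C_\gamma=I-\gamma_y(I-C)$. Let $\tilde R,\tilde C$ be invertible matrices, $\|v\|_R=\|\tilde Rv\|$, $\|v\|_C=\|\tilde Cv\|$ (for $n\times p$ matrices $\|X\|_R=\|\tilde RX\|_F$; for $n\times n$ matrices the induced operator norms), and $\delta_{R,2},\delta_{C,2}$, $\theta_R,\theta_C\in(0,1]$ constants such that $\|v\|\le\|v\|_R\le\delta_{R,2}\|v\|$, $\|v\|\le\|v\|_C\le\delta_{C,2}\|v\|$ for all $v$, $\|\Pi_RR_\gamma\|_R\le1-\theta_R\gamma_x$, $\|\Pi_CC_\gamma\|_C\le1-\theta_C\gamma_y$, $\|\Pi_R\|_R\le1$, $\|\Pi_C\|_C\le 1$, $\|R\|_R,\|R_\gamma\|_R,\|C\|_C,\|C_\gamma\|_C\le2$, $\|I-R\|_R,\|I-C\|_C\le3$. Let $\mathcal C$ be a (measurable) random compression operator on $\mathbb R^p$ with $\mathbb E\|\mathcal C(x)-x\|^2\le C_q\|x\|^2+\sigma^2$ and $\mathbb E\|\mathcal C(x)/r-x\|^2\le(1-\delta)\|x\|^2+\sigma_r^2$ for all $x$, where $C_q\ge0$, $r>0$,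 $\delta\in(0,1]$. **Algorithm.** Let $\Lambda=\mathrm{diag}(\lambda_1,\dots,\lambda_n)$ with $\lambda_i\ge0$. From a deterministic $X^0\in\mathbb R^{n\times p}$, $Y^0=\nabla F(X^0)$ (row $i$ of $\nabla F(X)$ is $\nabla f_i$ at row $i$ of $X$) and $H_x^0=H_y^0=H_R^0=H_C^0=0$, for $k=0,1,\dots$ do $$\tilde X^k=X^k-\Lambda Y^k,\quad Q_x^k=s_k\,\mathcal C\big((\tilde X^k-H_x^k)/s_k\big),\quad \hat X^k=H_x^k+Q_x^k,\quad \hat X_R^k=H_R^k+RQ_x^k,$$ $$H_x^{k+1}=(1-\alpha_x)H_x^k+\alpha_x\hat X^k,\quad H_R^{k+1}=(1-\alpha_x)H_R^k+\alpha_x\hat X_R^k,\quad X^{k+1}=\tilde X^k-\gamma_x(\hat X^k-\hat X_R^k),$$ $$\tilde Y^k=Y^k+\nabla F(X^{k+1})-\nabla F(X^k),\quad Q_y^k=s_k\,\mathcal C\big((\tilde Y^k-H_y^k)/s_k\big),\quad \hat Y^k=H_y^k+Q_y^k,\quad \hat Y_C^k=H_C^k+CQ_y^k,$$ $$H_y^{k+1}=(1-\alpha_y)H_y^k+\alpha_y\hat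 Y^k,\quad H_C^{k+1}=(1-\alpha_y)H_C^k+\alpha_y\hat Y_C^k,\quad Y^{k+1}=\tilde Y^k-\gamma_y(\hat Y^k-\hat Y_C^k),$$ where $\mathcal C$ acts on each row and the randomness of different compression rounds (two per iteration) is independent. **Parameters.** Let $\hat\lambda=\max_i\lambda_i$, $\bar\lambda=\frac1n u_R^{\mathsf T}\Lambda u_C$, and suppose $\bar\lambda\ge M\hat\lambda$ for some $M>0$, $\alpha_x,\alpha_y\in(0,\frac1r]$, $\gamma_x,\gamma_y>0$, and $$\hat\lambda\le\frac1L\min\Big\{\tfrac16,\tfrac1{6\sqrt{C_q}},\tfrac1M,\tfrac{\theta_C}{\sqrt{54e_1}},\tfrac{e_3\gamma_x}{\sqrt{96E}\,\|u_C\|},\tfrac{e_4\theta_C\gamma_y}{\sqrt{48e_1}}\Big\},$$ $$\gamma_x\le\min\Big\{1,\tfrac{e_5\alpha_xr\delta}{\sqrt{C_q}},\tfrac{\sqrt{M\|u_C\|}}{\sqrt{108\|u_R\|e_1}}\theta_C\gamma_y\Big\},\qquad \gamma_y\le\min\Big\{1,\tfrac{\theta_Ce_2}{432e_1},\tfrac{\theta_C(\alpha_yr\delta)^2}{432e_2C_q},\tfrac{\alpha_yr\delta}{\sqrt{1728C_q}}\Big\}$$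 (bounds with $L=0$ or $C_q=0$ in the denominator are void), where $E=\frac{\|u_R\|\|u_C\|}{n^2M}$, $e_1=2\delta_{C,2}^2(1+18C_q)$, $e_2=108C_q+112$, $e_3=\min\{\frac{1}{2\delta_{R,2}}\frac{\theta_R}{1-\theta_R\gamma_x},1\}$, $e_4=\min\{\frac{\theta_R}{36(1-\theta_R\gamma_x)},\frac1{3\sqrt3}\}$, $e_5=\min\{\frac{\theta_R}{432\sqrt2\,\delta_{R,2}},\frac1{72}\}$. Put $$\tilde\rho=\max\Big\{1-\tfrac12M\hat\lambda\mu,\;1-\tfrac{\theta_R\gamma_x}{16},\;1-\tfrac{\theta_C\gamma_y}{8},\;1-\tfrac{\alpha_xr\delta}{4},\;1-\tfrac{\alpha_yr\delta}{16}\Big\}$$ and let $c\in(\tilde\rho,1)$, $c_0>0$, $s_k^2=c_0c^k$. **Theorem 2.** (i) For all $R,C$ as above there are $u_R,u_C,\tilde R,\tilde C,\delta_{R,2},\delta_{C,2},\theta_R,\theta_C$ that have the listed properties simultaneously for all $\gamma_x,\gamma_y\in(0,\frac12]$. (ii) For every choice of data as above, with $\bar x^k=\frac1n (X^k)^{\mathsf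 T}u_R$, the optimization error $\mathbb E[f(\bar x^k)-f(x^*)]$ and the consensus error $\mathbb E\|\Pi_RX^k\|_R^2$ are finite and both converge to $0$ at the linear rate $O(c^k)$. -/

import Mathlib

open MeasureTheory ProbabilityTheory Filter Asymptotics
open scoped Topology NNReal

noncomputable section

namespace RCPP

/-! ### Graphs and mixing matrices -/

/-- Every node can be reached from every node along directed edges. -/
def StronglyConnected {n : ℕ} (G : Digraph (Fin n)) : Prop :=
  ∀ i j, Relation.ReflTransGen G.Adj i j

/-- The digraph induced by a nonnegative matrix `W`: there is an edge from `i` to `j` if and only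
if `W j i > 0`. -/
def inducedGraph {n : ℕ} (W : Matrix (Fin n) (Fin n) ℝ) : Digraph (Fin n) where
  Adj i j := 0 < W j i

/-- `T` is a (directed) spanning tree of `G` with root `r`: a subgraph of `G` in which the root has
no parent, every other node has exactly one parent, and every node is reached from the root. -/
structure IsSpanningTree {n : ℕ} (T G : Digraph (Fin n)) (r : Fin n) : Prop where
  sub : ∀ i j, T.Adj i j → G.Adj i j
  root_no_parent : ∀ i, ¬ T.Adj i r
  unique_parent : ∀ j, j ≠ r → ∃! i, T.Adj i j
  reach : ∀ j, Relation.ReflTransGen T.Adj r j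

/-- The set of roots of all possible spanning trees of the graph induced by `W`. -/
def roots {n : ℕ} (W : Matrix (Fin n) (Fin n) ℝ) : Set (Fin n) :=
  {r | ∃ T, IsSpanningTree T (inducedGraph W) r}

/-- Assumption on the network: `R` is row stochastic, `C` is column stochastic (both nonnegative),
both are supported by a strongly connected digraph, and some node is the root of spanning trees of
both the graph of `R` and the graph of `Cᵀ`. -/
structure NetworkAssumption {n : ℕ} (R C : Matrix (Fin n) (Fin n) ℝ) : Prop where
  row_stochastic : R ∈ Matrix.rowStochastic ℝ (Fin n)
  col_stochastic : C ∈ Matrix.colStochastic ℝ (Fin n)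
  supported : ∃ G : Digraph (Fin n), StronglyConnected G ∧
    (∀ i j, 0 < R i j → G.Adj j i) ∧ (∀ i j, 0 < C i j → G.Adj j i)
  common_root : (roots R ∩ roots C.transpose).Nonempty

/-- `u` is a nonnegative left eigenvector of `R` for the eigenvalue `1` with entries summing to
`n`. -/
structure IsLeftPerron {n : ℕ} (R : Matrix (Fin n) (Fin n) ℝ)
    (u : EuclideanSpace ℝ (Fin n)) : Prop where
  nonneg : ∀ i, 0 ≤ u i
  eigen : ∀ j, ∑ i, u i * R i j = u j
  sum_eq : ∑ i, u i = n

/-- `u` is a nonnegative right eigenvector of `C` for the eigenvalue `1` with entries summing to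
`n`. -/
structure IsRightPerron {n : ℕ} (C : Matrix (Fin n) (Fin n) ℝ)
    (u : EuclideanSpace ℝ (Fin n)) : Prop where
  nonneg : ∀ i, 0 ≤ u i
  eigen : ∀ i, ∑ j, C i j * u j = u i
  sum_eq : ∑ i, u i = n

/-- `Π_R = I - 𝟙 u_Rᵀ / n`. -/
def projR {n : ℕ} (uR : EuclideanSpace ℝ (Fin n)) : Matrix (Fin n) (Fin n) ℝ :=
  1 - Matrix.of fun _ j => uR j / n

/-- `Π_C = I - u_C 𝟙ᵀ / n`. -/
def projC {n : ℕ} (uC : EuclideanSpace ℝ (Fin n)) : Matrix (Fin n) (Fin n) ℝ :=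
  1 - Matrix.of fun i _ => uC i / n

/-- `W_γ = I - γ (I - W)`. -/
def damped {n : ℕ} (W : Matrix (Fin n) (Fin n) ℝ) (γ : ℝ) : Matrix (Fin n) (Fin n) ℝ :=
  1 - γ • (1 - W)

/-! ### The weighted Euclidean norms -/

/-- The vector norm `‖v‖_T = ‖T v‖` (Euclidean norm on the right). -/
def wnorm {n : ℕ} (T : Matrix (Fin n) (Fin n) ℝ) (v : Fin n → ℝ) : ℝ :=
  ‖WithLp.toLp 2 (T.mulVec v)‖

/-- The operator norm of `A` induced by the vector norm `‖·‖_T` is at most `b`. -/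
def InducedNormLE {n : ℕ} (T A : Matrix (Fin n) (Fin n) ℝ) (b : ℝ) : Prop :=
  ∀ v : Fin n → ℝ, wnorm T (A.mulVec v) ≤ b * wnorm T v

/-- The norm `‖v‖_T = ‖T v‖` is adapted to the mixing matrix `W` with projection `P`
(`P = Π_R` for `W = R`, `P = Π_C` for `W = C`), with equivalence constant `δ₂`, contraction
constant `θ`, at the consensus step-size `γ`. For `n ≥ 2` the projection `P` is nonzero and
`‖P‖_T ≤ 1` means `‖P‖_T = 1`; for `n = 1` it is zero. -/
structure IsAdaptedNorm {n : ℕ} (W P T : Matrix (Fin n) (Fin n) ℝ) (δ₂ θ γ : ℝ) : Prop where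
  invertible : IsUnit T
  lower : ∀ v : Fin n → ℝ, ‖WithLp.toLp 2 v‖ ≤ wnorm T v
  upper : ∀ v : Fin n → ℝ, wnorm T v ≤ δ₂ * ‖WithLp.toLp 2 v‖
  theta_pos : 0 < θ
  theta_le_one : θ ≤ 1
  contraction : InducedNormLE T (P * damped W γ) (1 - θ * γ)
  norm_proj : InducedNormLE T P 1
  norm_mix : InducedNormLE T W 2
  norm_damped : InducedNormLE T (damped W γ) 2
  norm_one_sub : InducedNormLE T (1 - W) 3

/-! ### Objective functions -/

/-- The decision space `ℝ^p`. -/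
abbrev Vec (p : ℕ) := EuclideanSpace ℝ (Fin p)

/-- The aggregated variables: `n × p` matrices, given by their rows. -/
abbrev Stack (n p : ℕ) := Fin n → Vec p

/-- The global objective `f = (1/n) ∑ f_i`. -/
def avgObj {n p : ℕ} (f : Fin n → Vec p → ℝ) (x : Vec p) : ℝ :=
  (1 / (n : ℝ)) * ∑ i, f i x

/-- Every local objective `f_i` is differentiable with an `L_i`-Lipschitz gradient. -/
def SmoothAssumption {n p : ℕ} (f : Fin n → Vec p → ℝ) (Lip : Fin n → ℝ≥0) : Prop :=
  ∀ i, Differentiable ℝ (f i) ∧ LipschitzWith (Lip i) (gradient (f i))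

/-- The Polyak–Łojasiewicz condition with constant `μ`, relative to the minimizer `xs`. -/
def PLCondition {p : ℕ} (g : Vec p → ℝ) (xs : Vec p) (μ : ℝ) : Prop :=
  0 < μ ∧ ∀ x, 2 * μ * (g x - g xs) ≤ ‖gradient g x‖ ^ 2

/-! ### Compression operators -/

/-- The random compression operator `comp ξ : ℝ^d → ℝ^d`, where the seed `ξ` has law `ν`, satisfies
`𝔼 ‖comp(x) - x‖² ≤ Cq ‖x‖² + σ²` and `𝔼 ‖comp(x)/r - x‖² ≤ (1-δ) ‖x‖² + σr²`. (Integrability of the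
second integrand follows from that of the first.) -/
structure CompressionAssumption {d : ℕ} {Ξ : Type*} [MeasurableSpace Ξ] (ν : Measure Ξ)
    (comp : Ξ → Vec d → Vec d) (Cq σ r δ σr : ℝ) : Prop where
  measurable : Measurable (Function.uncurry comp)
  C_nonneg : 0 ≤ Cq
  r_pos : 0 < r
  delta_pos : 0 < δ
  delta_le_one : δ ≤ 1
  integrable : ∀ x, Integrable (fun ξ => ‖comp ξ x - x‖ ^ 2) ν
  error : ∀ x, ∫ ξ, ‖comp ξ x - x‖ ^ 2 ∂ν ≤ Cq * ‖x‖ ^ 2 + σ ^ 2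
  scaled_error : ∀ x, ∫ ξ, ‖(1 / r) • comp ξ x - x‖ ^ 2 ∂ν ≤ (1 - δ) * ‖x‖ ^ 2 + σr ^ 2

/-- The seeds used by the agents: `seed k b i` is the seed with which agent `i` compresses at
iteration `k`, for the decision variable if `b = false` and for the gradient tracker if `b = true`.
Every seed has law `ν`, and the seeds of different compression rounds `(k, b)` are independent
(within one round the agents may or may not share randomness). -/
structure FreshSeeds {n : ℕ} {Ξ Ω : Type*} [MeasurableSpace Ξ] [MeasurableSpace Ω]
    (ν : Measure Ξ) (P : Measure Ω) (seed : ℕ → Bool → Fin n → Ω → Ξ) : Prop where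
  measurable : ∀ k b i, Measurable (seed k b i)
  law : ∀ k b i, P.map (seed k b i) = ν
  indep : iIndepFun (fun (kb : ℕ × Bool) (ω : Ω) (i : Fin n) => seed kb.1 kb.2 i ω) P

/-! ### The algorithm -/

/-- The matrix product `W X`, for `X` given by its rows. -/
def mix {n p : ℕ} (W : Matrix (Fin n) (Fin n) ℝ) (X : Stack n p) : Stack n p :=
  fun i => ∑ j, W i j • X j

/-- The variables kept by the algorithm between iterations. -/
structure State (n p : ℕ) where
  X : Stack n p
  Y : Stack n p
  Hx : Stack n p
  Hy : Stack n p
  HR : Stack n p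
  HC : Stack n p

/-- The parameters: mixing matrices, agents' step-sizes `Λ = diag(lam)`, `α_x, α_y`, consensus
step-sizes `γ_x, γ_y`, and the dynamic scaling parameters `s_k`. -/
structure Params (n : ℕ) where
  R : Matrix (Fin n) (Fin n) ℝ
  C : Matrix (Fin n) (Fin n) ℝ
  lam : Fin n → ℝ
  αx : ℝ
  αy : ℝ
  γx : ℝ
  γy : ℝ
  s : ℕ → ℝ

/-- The aggregated gradient `∇F(X)`, with rows `∇f_i(x_i)`. -/
def gradF {n p : ℕ} (f : Fin n → Vec p → ℝ) (X : Stack n p) : Stack n p :=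
  fun i => gradient (f i) (X i)

/-- Dynamic scaling compression `Q(z) = s q(z / s)`, row by row; row `i` uses the map `q i`. -/
def scaledCompress {n p : ℕ} (s : ℝ) (q : Fin n → Vec p → Vec p) (Z : Stack n p) : Stack n p :=
  fun i => s • q i ((1 / s) • Z i)

/-- One iteration, where `qx i` and `qy i` are the (sampled) compression maps that agent `i` applies
in this iteration. -/
def step {n p : ℕ} (A : Params n) (f : Fin n → Vec p → ℝ) (k : ℕ)
    (qx qy : Fin n → Vec p → Vec p) (S : State n p) : State n p :=
  let Xt : Stack n p := fun i => S.X i - A.lam i • S.Y i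
  let Qx := scaledCompress (A.s k) qx (Xt - S.Hx)
  let Xh := S.Hx + Qx
  let XhR := S.HR + mix A.R Qx
  let Xnew := Xt - A.γx • (Xh - XhR)
  let Yt := S.Y + gradF f Xnew - gradF f S.X
  let Qy := scaledCompress (A.s k) qy (Yt - S.Hy)
  let Yh := S.Hy + Qy
  let YhC := S.HC + mix A.C Qy
  { X := Xnew
    Y := Yt - A.γy • (Yh - YhC)
    Hx := (1 - A.αx) • S.Hx + A.αx • Xh
    Hy := (1 - A.αy) • S.Hy + A.αy • Yh
    HR := (1 - A.αx) • S.HR + A.αx • XhR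
    HC := (1 - A.αy) • S.HC + A.αy • YhC }

/-- The state after `k` iterations, from the initial value `X0`; `q j b i` is the compression map
used by agent `i` at iteration `j` (`b = false`: decision variable, `b = true`: tracker). -/
def run {n p : ℕ} (A : Params n) (f : Fin n → Vec p → ℝ) (X0 : Stack n p)
    (q : ℕ → Bool → Fin n → Vec p → Vec p) : ℕ → State n p
  | 0 => { X := X0, Y := gradF f X0, Hx := 0, Hy := 0, HR := 0, HC := 0 }
  | k + 1 => step A f k (q k false) (q k true) (run A f X0 q k)

/-- The random iterate `X^k`. -/
def iterX {n p : ℕ} {Ξ Ω : Type*} (A : Params n) (f : Fin n → Vec p → ℝ) (X0 : Stack n p)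
    (comp : Ξ → Vec p → Vec p) (seed : ℕ → Bool → Fin n → Ω → Ξ) (k : ℕ) (ω : Ω) : Stack n p :=
  (run A f X0 (fun j b i => comp (seed j b i ω)) k).X

/-- The weighted average `(1/n) u_Rᵀ X`. -/
def wavg {n p : ℕ} (uR : EuclideanSpace ℝ (Fin n)) (X : Stack n p) : Vec p :=
  (1 / (n : ℝ)) • ∑ i, uR i • X i

/-- `‖X‖_T² = ‖T X‖_F²`, for an `n × p` matrix `X` given by its rows. -/
def wsq {n p : ℕ} (T : Matrix (Fin n) (Fin n) ℝ) (X : Stack n p) : ℝ :=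
  ∑ i, ‖mix T X i‖ ^ 2

/-! ### Constants and step-size conditions -/

/-- `L = max_i L_i`. -/
def maxLip {n : ℕ} (Lip : Fin n → ℝ≥0) : ℝ := ⨆ i, (Lip i : ℝ)

/-- `λ̂ = max_i λ_i`. -/
def maxStep {n : ℕ} (lam : Fin n → ℝ) : ℝ := ⨆ i, lam i

/-- `λ̄ = (1/n) u_Rᵀ Λ u_C`. -/
def avgStep {n : ℕ} (uR uC : EuclideanSpace ℝ (Fin n)) (lam : Fin n → ℝ) : ℝ :=
  (1 / (n : ℝ)) * ∑ i, uR i * lam i * uC i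

def cE {n : ℕ} (uR uC : EuclideanSpace ℝ (Fin n)) (M : ℝ) : ℝ :=
  ‖uR‖ * ‖uC‖ / ((n : ℝ) ^ 2 * M)

def e₁ (δC Cq : ℝ) : ℝ := 2 * δC ^ 2 * (1 + 18 * Cq)

def e₂ (Cq : ℝ) : ℝ := 108 * Cq + 112

/-- The denominator `1 - θ_R γ_x` here and in `e₄` is positive (indeed `γ_x < 1/2`) whenever the
conditions on `γ_x, γ_y` below hold and `0 < M λ̂ ≤ λ̄`. -/
def e₃ (δR θR γx : ℝ) : ℝ := min (1 / (2 * δR) * (θR / (1 - θR * γx))) 1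

def e₄ (θR γx : ℝ) : ℝ := min (θR / (36 * (1 - θR * γx))) (1 / (3 * √3))

def e₅ (δR θR : ℝ) : ℝ := min (θR / (432 * √2 * δR)) (1 / 72)

/-- The upper bounds on the maximum step-size `lamMax = λ̂` and on the consensus step-sizes. Bounds
with a denominator that may vanish (`L`, or the relative error constant `Cq`) are multiplied out;
they are void if it does. -/
structure StepSizeConditions {n : ℕ} (uR uC : EuclideanSpace ℝ (Fin n))
    (δR δC θR θC L Cq r δ M lamMax αx αy γx γy : ℝ) : Prop where
  lam₁ : lamMax * L ≤ 1 / 6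
  lam₂ : 6 * √Cq * (lamMax * L) ≤ 1
  lam₃ : lamMax * L ≤ 1 / M
  lam₄ : lamMax * L ≤ θC / √(54 * e₁ δC Cq)
  lam₅ : lamMax * L ≤ e₃ δR θR γx * γx / (√(96 * cE uR uC M) * ‖uC‖)
  lam₆ : lamMax * L ≤ e₄ θR γx * θC * γy / √(48 * e₁ δC Cq)
  γx_pos : 0 < γx
  γx₁ : γx ≤ 1
  γx₂ : √Cq * γx ≤ e₅ δR θR * αx * r * δ
  γx₃ : γx ≤ √(M * ‖uC‖) / √(108 * ‖uR‖ * e₁ δC Cq) * θC * γy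
  γy_pos : 0 < γy
  γy₁ : γy ≤ 1
  γy₂ : γy ≤ θC * e₂ Cq / (432 * e₁ δC Cq)
  γy₃ : 432 * e₂ Cq * Cq * γy ≤ θC * (αy * r * δ) ^ 2
  γy₄ : √(1728 * Cq) * γy ≤ αy * r * δ

/-- `ρ̃`, the maximum of the five contraction factors. -/
def rhoTilde (M lamMax μ θR θC r δ αx αy γx γy : ℝ) : ℝ :=
  max (1 - 1 / 2 * M * lamMax * μ)
    (max (1 - θR * γx / 16)
      (max (1 - θC * γy / 8)
        (max (1 - αx * r * δ / 4) (1 - αy * r * δ / 16))))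

end RCPP

end

namespace RCPP

/-! ### Existence of adapted norms -/

section AdaptedNorm

variable {n : ℕ}

/-! Existence of the norms. A Euclidean norm `‖T v‖` in which a matrix contracts is obtained from
powers: if `M ^ N` contracts by `ρ ^ N`, then `∑_{k<N} ρ^{-2k} ‖M^k v‖²` is a squared norm in which
`M` contracts by `ρ`, and matrices commuting with `M` keep their norm bounds
(`exists_iterated_wnorm`). It is applied first to the power bounded matrix `R` or `C` itself, to get
norm at most `2`, and then to its lazy version `S = (1 + W) / 2` on the range of the projection.
There `S ^ k` tends to zero: a root reaches every node, so some power of `S` has a positive column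
(for `C`, of the transposed matrix), and such a row stochastic matrix shrinks the oscillation of
vectors. Since `W_γ = (1 - 2γ) + 2γ S`, contraction of `S` alone serves all `γ ≤ 1/2` with one norm
and one `θ`.

Convergence. Because `HR = R Hx` and `HC = C Hy` along the run, both halves of an iteration are
instances of one map, `gossip W γ (U + D) E = (U + D) - γ (1 - W) (U + D + E)`: `U` is `X` or `Y`,
`D` is the local change (`-Λ Y`, or the change of the gradients), and `E` is the error made in
compressing `Z = U + D - H`. Gossip leaves two averages alone. From `u_Rᵀ (1 - R) = 0` the weighted
average of `X` makes an inexact gradient step, and from `𝟙ᵀ (1 - C) = 0` the trackers always sum to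
the sum of the local gradients.

Five expectations are followed: the optimization error `o`, the consensus errors `a = ‖Π_R X‖²` and
`g = ‖Π_C Y‖²`, and the compression errors `h = ‖X - Hx‖²` and `m = ‖Y - Hy‖²`. Each contracts up to
terms in the others: `o` by the Polyak–Łojasiewicz inequality (`objective_descent`), the rest by
`gossip_bounds`. The latter needs the seeds of a round to be independent of what is compressed in
it, so that the moment assumptions can be integrated over the input (`integral_comp_indep_le`);
dynamic scaling turns the absolute errors `σ, σr` into terms proportional to `s_k² = c₀ c^k`.

The couplings form loops, closed by a Lyapunov function `V`, the sum of `o` and weighted `a, h, g,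
m`. The weights of `a` and `g` exceed what `o` needs from them, those of `h` and `m` are tied to
them through the relative compression error, and the step-size conditions make the remaining gains
small (`coefficient_bounds`). This gives `V (k+1) ≤ ρ̃ V k + K c^k` (`lyapunov_step`), and since `c
> ρ̃` the perturbation sets the rate: `V k = O(c^k)`. -/

lemma wnorm_nonneg (T : Matrix (Fin n) (Fin n) ℝ) (v : Fin n → ℝ) : 0 ≤ wnorm T v :=
  norm_nonneg _

lemma wnorm_one (v : Fin n → ℝ) : wnorm 1 v = ‖WithLp.toLp 2 v‖ := by
  simp [wnorm]

lemma wnorm_mulVec (T A : Matrix (Fin n) (Fin n) ℝ) (v : Fin n → ℝ) :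
    wnorm T (A.mulVec v) = wnorm (T * A) v := by
  simp [wnorm, Matrix.mulVec_mulVec]

lemma wnorm_smul_left (a : ℝ) (T : Matrix (Fin n) (Fin n) ℝ) (v : Fin n → ℝ) :
    wnorm (a • T) v = |a| * wnorm T v := by
  simp [wnorm, Matrix.smul_mulVec, norm_smul]

lemma wnorm_add_le (T : Matrix (Fin n) (Fin n) ℝ) (v w : Fin n → ℝ) :
    wnorm T (v + w) ≤ wnorm T v + wnorm T w := by
  simp only [wnorm, Matrix.mulVec_add, WithLp.toLp_add]
  exact norm_add_le _ _

lemma wnorm_smul (a : ℝ) (T : Matrix (Fin n) (Fin n) ℝ) (v : Fin n → ℝ) :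
    wnorm T (a • v) = |a| * wnorm T v := by
  simp [wnorm, Matrix.mulVec_smul, norm_smul]

lemma wnorm_sq (T : Matrix (Fin n) (Fin n) ℝ) (v : Fin n → ℝ) :
    wnorm T v ^ 2 = v ⬝ᵥ (T.transpose * T).mulVec v := by
  rw [wnorm, EuclideanSpace.norm_sq_eq, ← Matrix.mulVec_mulVec, Matrix.dotProduct_mulVec,
    Matrix.vecMul_transpose]
  simp [dotProduct, sq]

lemma wnorm_le_sum (B : Matrix (Fin n) (Fin n) ℝ) (v : Fin n → ℝ) :
    wnorm B v ≤ (∑ i, ∑ j, |B i j|) * ‖WithLp.toLp 2 v‖ := by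
  have h1 : wnorm B v ≤ ∑ i, |B.mulVec v i| := by
    rw [wnorm, EuclideanSpace.norm_eq]
    apply Real.sqrt_le_iff.2
    refine ⟨Finset.sum_nonneg fun _ _ => abs_nonneg _, ?_⟩
    simp only [Real.norm_eq_abs]
    exact Finset.sum_sq_le_sq_sum_of_nonneg fun _ _ => abs_nonneg _
  refine h1.trans ?_
  rw [Finset.sum_mul]
  refine Finset.sum_le_sum fun i _ => ?_
  rw [Finset.sum_mul]
  have h2 : |∑ j, B i j * v j| ≤ ∑ j, |B i j * v j| := Finset.abs_sum_le_sum_abs _ _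
  refine h2.trans (Finset.sum_le_sum fun j _ => ?_)
  rw [abs_mul]
  exact mul_le_mul_of_nonneg_left (by simpa using PiLp.norm_apply_le (WithLp.toLp 2 v) j)
    (abs_nonneg _)

/-- A finite sum of squared weighted norms is a squared weighted norm. -/
lemma exists_wnorm_sq_eq_sum {ι : Type*} (s : Finset ι) (B : ι → Matrix (Fin n) (Fin n) ℝ) :
    ∃ T : Matrix (Fin n) (Fin n) ℝ, ∀ v, wnorm T v ^ 2 = ∑ l ∈ s, wnorm (B l) v ^ 2 := by
  have hpsd : (∑ l ∈ s, (B l).transpose * B l).PosSemidef := by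
    refine Matrix.posSemidef_sum s fun l _ => ?_
    simpa using Matrix.posSemidef_conjTranspose_mul_self (B l)
  open scoped MatrixOrder in
  obtain ⟨T, hT⟩ := CStarAlgebra.nonneg_iff_eq_star_mul_self.1 hpsd.nonneg
  refine ⟨T, fun v => ?_⟩
  have hT' : T.transpose * T = ∑ l ∈ s, (B l).transpose * B l := by
    rw [hT]; simp [Matrix.star_eq_conjTranspose]
  simp only [wnorm_sq]
  rw [hT', Matrix.sum_mulVec, dotProduct_sum]

/-- The norm `∑_{k < N} ρ^{-2k} ‖M^k v‖²` makes `M` a `ρ`-Lipschitz map on the vectors on which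
`M ^ N` is `ρ ^ N`-Lipschitz, without increasing the norms of matrices commuting with `M`. -/
lemma exists_iterated_wnorm (T₀ M : Matrix (Fin n) (Fin n) ℝ) {ρ : ℝ} (hρ : 0 < ρ) {N : ℕ}
    (hN : 0 < N) : ∃ T : Matrix (Fin n) (Fin n) ℝ,
      (∀ v, wnorm T₀ v ≤ wnorm T v) ∧
      (∀ v, wnorm T₀ ((M ^ N).mulVec v) ≤ ρ ^ N * wnorm T₀ v →
        wnorm T (M.mulVec v) ≤ ρ * wnorm T v) ∧
      (∀ A b, Commute A M → 0 ≤ b → (∀ v, wnorm T₀ (A.mulVec v) ≤ b * wnorm T₀ v) →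
        ∀ v, wnorm T (A.mulVec v) ≤ b * wnorm T v) := by
  obtain ⟨T, hT⟩ := exists_wnorm_sq_eq_sum (Finset.range N) fun k => (ρ⁻¹) ^ k • (T₀ * M ^ k)
  have hT' : ∀ v, wnorm T v ^ 2
      = ∑ k ∈ Finset.range N, ((ρ⁻¹) ^ k * wnorm T₀ ((M ^ k).mulVec v)) ^ 2 := by
    intro v
    rw [hT]
    refine Finset.sum_congr rfl fun k _ => ?_
    rw [wnorm_smul_left, wnorm_mulVec, abs_of_pos (by positivity)]
  refine ⟨T, fun v => ?_, fun v hv => ?_, fun A b hA hb h v => ?_⟩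
  · refine le_of_sq_le_sq ?_ (wnorm_nonneg _ _)
    rw [hT']
    have := Finset.single_le_sum (f := fun k => ((ρ⁻¹) ^ k * wnorm T₀ ((M ^ k).mulVec v)) ^ 2)
      (fun k _ => sq_nonneg _) (Finset.mem_range.2 hN)
    simpa using this
  · refine le_of_sq_le_sq ?_ (mul_nonneg hρ.le (wnorm_nonneg _ _))
    rw [mul_pow, hT', hT']
    have e1 : ∑ k ∈ Finset.range N, ((ρ⁻¹) ^ k * wnorm T₀ ((M ^ k).mulVec (M.mulVec v))) ^ 2
        = ρ ^ 2 * ∑ k ∈ Finset.range N,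
          ((ρ⁻¹) ^ (k + 1) * wnorm T₀ ((M ^ (k + 1)).mulVec v)) ^ 2 := by
      rw [Finset.mul_sum]
      refine Finset.sum_congr rfl fun k _ => ?_
      rw [Matrix.mulVec_mulVec, ← pow_succ, pow_succ ρ⁻¹ k]
      field_simp
    rw [e1]
    refine mul_le_mul_of_nonneg_left ?_ (sq_nonneg _)
    -- Applying `M` shifts the index, trading the term `k = 0` for the term `k = N`; the hypothesis
    -- on `v` says that the new term is at most the lost one.
    have e2 := Finset.sum_range_succ
      (fun k => ((ρ⁻¹) ^ k * wnorm T₀ ((M ^ k).mulVec v)) ^ 2) N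
    have e3 := Finset.sum_range_succ'
      (fun k => ((ρ⁻¹) ^ k * wnorm T₀ ((M ^ k).mulVec v)) ^ 2) N
    have e4 : ((ρ⁻¹) ^ N * wnorm T₀ ((M ^ N).mulVec v)) ^ 2 ≤ (wnorm T₀ v) ^ 2 := by
      refine pow_le_pow_left₀ (mul_nonneg (by positivity) (wnorm_nonneg _ _)) ?_ 2
      calc (ρ⁻¹) ^ N * wnorm T₀ ((M ^ N).mulVec v) ≤ (ρ⁻¹) ^ N * (ρ ^ N * wnorm T₀ v) := by gcongr
        _ = wnorm T₀ v := by rw [← mul_assoc, ← mul_pow, inv_mul_cancel₀ hρ.ne']; simp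
    simp only [pow_zero, one_mul, Matrix.one_mulVec] at e3
    linarith
  · refine le_of_sq_le_sq ?_ (mul_nonneg hb (wnorm_nonneg _ _))
    rw [mul_pow, hT', hT', Finset.mul_sum]
    refine Finset.sum_le_sum fun k _ => ?_
    rw [← mul_pow]
    refine pow_le_pow_left₀ (mul_nonneg (by positivity) (wnorm_nonneg _ _)) ?_ 2
    have : (M ^ k).mulVec (A.mulVec v) = A.mulVec ((M ^ k).mulVec v) := by
      rw [Matrix.mulVec_mulVec, Matrix.mulVec_mulVec, (hA.pow_right k).eq]
    rw [this, mul_left_comm]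
    exact mul_le_mul_of_nonneg_left (h _) (by positivity)

/-- A power bounded matrix `A` whose lazy version `(1 + A) / 2` contracts the range of a commuting
projection has an adapted norm that works for all small step-sizes. -/
lemma exists_adaptedNorm (A P : Matrix (Fin n) (Fin n) ℝ) (K : ℝ) (hP : P * P = P)
    (hAP : A * P = P * A) (hA1 : A * (1 - P) = 1 - P) (hK : ∀ k i j, |(A ^ k) i j| ≤ K)
    (hlim : Tendsto (fun k : ℕ => ((1 / 2 : ℝ) • (1 + A)) ^ k * P) atTop (𝓝 0)) :
    ∃ (T : Matrix (Fin n) (Fin n) ℝ) (δ θ : ℝ),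
      ∀ γ : ℝ, 0 < γ → γ ≤ 1 / 2 → IsAdaptedNorm A P T δ θ γ := by
  set S : Matrix (Fin n) (Fin n) ℝ := (1 / 2 : ℝ) • (1 + A) with hS
  have hcomm : Commute A S := by
    rw [hS]
    exact ((Commute.one_right A).add_right (Commute.refl A)).smul_right _
  -- a norm with `‖A‖ ≤ 2`
  obtain ⟨J, hJpos, hJ⟩ : ∃ J : ℕ, 0 < J ∧ ∀ v, wnorm 1 ((A ^ J).mulVec v) ≤ 2 ^ J * wnorm 1 v := by
    have : Tendsto (fun k : ℕ => (2 : ℝ) ^ k) atTop atTop :=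
      tendsto_pow_atTop_atTop_of_one_lt (by norm_num)
    obtain ⟨J, hJ, hJ1⟩ := ((this.eventually_ge_atTop (∑ _i : Fin n, ∑ _j : Fin n, K)).and
      (eventually_gt_atTop 0)).exists
    refine ⟨J, hJ1, fun v => ?_⟩
    rw [wnorm_mulVec, one_mul, wnorm_one]
    refine (wnorm_le_sum _ _).trans (mul_le_mul_of_nonneg_right ?_ (norm_nonneg _))
    exact (Finset.sum_le_sum fun i _ => Finset.sum_le_sum fun j _ => hK J i j).trans hJ
  obtain ⟨T₀, hT₀, hT₀A, -⟩ := exists_iterated_wnorm 1 A (two_pos) hJpos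
  replace hT₀A := fun v => hT₀A v (hJ v)
  -- a norm in which in addition `S` contracts the range of `P`
  obtain ⟨N, hNpos, hN⟩ : ∃ N : ℕ, 0 < N ∧ ∀ v,
      wnorm T₀ ((S ^ N).mulVec (P.mulVec v)) ≤ 1 / 2 * wnorm T₀ (P.mulVec v) := by
    have h0 : Tendsto (fun k : ℕ => T₀ * (S ^ k * P)) atTop (𝓝 (T₀ * 0)) :=
      tendsto_const_nhds.mul hlim
    have h1 : Tendsto (fun k : ℕ => ∑ i, ∑ j, |(T₀ * (S ^ k * P)) i j|) atTop (𝓝 0) := by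
      have : (0 : ℝ) = ∑ i, ∑ j, |(T₀ * (0 : Matrix (Fin n) (Fin n) ℝ)) i j| := by simp
      rw [this]
      refine tendsto_finsetSum _ fun i _ => tendsto_finsetSum _ fun j _ => ?_
      exact (((continuous_apply_apply i j).tendsto _).comp h0).abs
    obtain ⟨N, hN, hN1⟩ := ((h1.eventually_le_const (show (0 : ℝ) < 1 / 2 by norm_num)).and
      (eventually_gt_atTop 0)).exists
    refine ⟨N, hN1, fun v => ?_⟩
    -- Inserting a second `P` makes the small matrix `T₀ S^N P` appear, while the vector `P v` stays
    -- on the right.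
    have e : (S ^ N).mulVec (P.mulVec v) = (S ^ N * P).mulVec (P.mulVec v) := by
      simp only [Matrix.mulVec_mulVec, Matrix.mul_assoc, hP]
    rw [e, wnorm_mulVec]
    refine (wnorm_le_sum _ _).trans ?_
    have := hT₀ (P.mulVec v)
    rw [wnorm_one] at this
    exact mul_le_mul hN this (norm_nonneg _) (by norm_num)
  -- By Bernoulli `ρ ^ N ≥ 1 - N / (2 N) = 1 / 2`, so halving by `S ^ N` is enough for a contraction
  -- by `ρ` in each step.
  set ρ : ℝ := 1 - 1 / (2 * N) with hρdef
  have hN1 : (1 : ℝ) ≤ N := by exact_mod_cast hNpos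
  have hinv : 1 / (2 * (N : ℝ)) ≤ 1 / 2 := by
    apply one_div_le_one_div_of_le <;> linarith
  have hρ1 : ρ < 1 := by rw [hρdef]; linarith [show 0 < 1 / (2 * (N : ℝ)) by positivity]
  have hρ0 : 1 / 2 ≤ ρ := by rw [hρdef]; linarith
  have hρN : 1 / 2 ≤ ρ ^ N := by
    have := one_add_mul_le_pow (a := -(1 / (2 * (N : ℝ)))) (by linarith) N
    rw [hρdef, sub_eq_add_neg]
    refine le_trans (le_of_eq ?_) this
    field_simp; norm_num
  obtain ⟨T₁, hT₁, hT₁S, hT₁A⟩ := exists_iterated_wnorm T₀ S (show 0 < ρ by linarith) hNpos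
  replace hT₁A := hT₁A A 2 hcomm two_pos.le hT₀A
  replace hT₁S : ∀ v, wnorm T₁ (S.mulVec (P.mulVec v)) ≤ ρ * wnorm T₁ (P.mulVec v) := fun v =>
    hT₁S _ ((hN v).trans (mul_le_mul_of_nonneg_right hρN (wnorm_nonneg _ _)))
  -- Making the kernel and the range of `P` orthogonal gives `P` norm at most one. The factor `√2`
  -- pays for `(a + b)² ≤ 2 (a² + b²)` in the lower bound by the Euclidean norm.
  obtain ⟨T, hT⟩ := exists_wnorm_sq_eq_sum (Finset.univ : Finset Bool)
    fun b => √2 • (if b then 1 - P else T₁ * P)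
  replace hT : ∀ v, wnorm T v ^ 2
      = 2 * (wnorm 1 ((1 - P).mulVec v) ^ 2 + wnorm T₁ (P.mulVec v) ^ 2) := by
    intro v
    rw [hT]
    simp [wnorm_smul_left, wnorm_mulVec, mul_pow]
    ring
  have hPP : ∀ v, P.mulVec (P.mulVec v) = P.mulVec v := fun v => by
    rw [Matrix.mulVec_mulVec, hP]
  have hPker : ∀ v, (1 - P).mulVec (P.mulVec v) = 0 := fun v => by
    rw [Matrix.mulVec_mulVec, Matrix.sub_mul, one_mul, hP, sub_self, Matrix.zero_mulVec]
  have hlower : ∀ v, ‖WithLp.toLp 2 v‖ ≤ wnorm T v := by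
    intro v
    refine le_of_sq_le_sq ?_ (wnorm_nonneg _ _)
    rw [hT, ← wnorm_one]
    have h1 : wnorm 1 v ≤ wnorm 1 ((1 - P).mulVec v) + wnorm 1 (P.mulVec v) := by
      refine le_trans (le_of_eq ?_) (wnorm_add_le _ _ _)
      rw [← Matrix.add_mulVec]; simp
    have h2 := (hT₀ (P.mulVec v)).trans (hT₁ _)
    have h3 := wnorm_nonneg 1 v
    nlinarith [sq_nonneg (wnorm 1 ((1 - P).mulVec v) - wnorm T₁ (P.mulVec v)),
      wnorm_nonneg 1 ((1 - P).mulVec v), wnorm_nonneg 1 (P.mulVec v)]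
  have hproj : InducedNormLE T P 1 := by
    intro v
    rw [one_mul]
    refine le_of_sq_le_sq ?_ (wnorm_nonneg _ _)
    rw [hT, hT, hPP, hPker]
    have : wnorm 1 (0 : Fin n → ℝ) = 0 := by simp [wnorm]
    rw [this]
    nlinarith [sq_nonneg (wnorm 1 ((1 - P).mulVec v))]
  have hmix : InducedNormLE T A 2 := by
    intro v
    refine le_of_sq_le_sq ?_ (mul_nonneg two_pos.le (wnorm_nonneg _ _))
    rw [mul_pow, hT, hT]
    have h1 : (1 - P).mulVec (A.mulVec v) = (1 - P).mulVec v := by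
      rw [Matrix.mulVec_mulVec, Matrix.sub_mul, one_mul, ← hAP, ← hA1, Matrix.mul_sub, mul_one]
    have h2 : P.mulVec (A.mulVec v) = A.mulVec (P.mulVec v) := by
      rw [Matrix.mulVec_mulVec, ← hAP, Matrix.mulVec_mulVec]
    rw [h1, h2]
    have h3 := hT₁A (P.mulVec v)
    have h4 := pow_le_pow_left₀ (wnorm_nonneg _ _) h3 2
    nlinarith [sq_nonneg (wnorm 1 ((1 - P).mulVec v))]
  have hSP : ∀ v, wnorm T (S.mulVec (P.mulVec v)) ≤ ρ * wnorm T (P.mulVec v) := by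
    intro v
    refine le_of_sq_le_sq ?_ (mul_nonneg (by linarith) (wnorm_nonneg _ _))
    have hSPc : S * P = P * S := by
      rw [hS, Matrix.smul_mul, Matrix.mul_smul, Matrix.add_mul, Matrix.mul_add, hAP]; simp
    have h0 : S.mulVec (P.mulVec v) = P.mulVec (S.mulVec v) := by
      rw [Matrix.mulVec_mulVec, hSPc, Matrix.mulVec_mulVec]
    have h1 : (1 - P).mulVec (S.mulVec (P.mulVec v)) = 0 := by rw [h0, hPker]
    have h2 : P.mulVec (S.mulVec (P.mulVec v)) = S.mulVec (P.mulVec v) := by rw [h0, hPP]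
    have h5 : wnorm 1 (0 : Fin n → ℝ) = 0 := by simp [wnorm]
    rw [mul_pow, hT, hT, h1, h2, hPP, hPker, h5]
    have h4 := pow_le_pow_left₀ (wnorm_nonneg _ _) (hT₁S v) 2
    rw [mul_pow] at h4
    linarith
  have hinj : IsUnit T := by
    rw [← Matrix.mulVec_injective_iff_isUnit]
    refine (injective_iff_map_eq_zero T.mulVecLin).2 fun v hv => ?_
    have h1 := hlower v
    have h2 : wnorm T v = 0 := by
      have : T.mulVec v = 0 := hv
      simp [wnorm, this]
    rw [h2] at h1
    have := norm_le_zero_iff.1 h1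
    simpa using this
  -- Here `θ = 2 (1 - ρ) = 1 / N`: on the range of `P`, `W_γ` is the convex combination of the
  -- identity and `S` with weights `1 - 2γ` and `2γ`, hence contracts by `1 - 2γ (1 - ρ)`.
  refine ⟨T, ∑ i, ∑ j, |T i j|, 2 * (1 - ρ), fun γ hγ hγ2 => ⟨hinj, hlower, wnorm_le_sum T,
    by linarith, by linarith, ?_, hproj, hmix, ?_, ?_⟩⟩
  · intro v
    have e : (P * damped A γ).mulVec v
        = (1 - 2 * γ) • P.mulVec v + (2 * γ) • S.mulVec (P.mulVec v) := by
      rw [Matrix.mulVec_mulVec, ← Matrix.smul_mulVec, ← Matrix.smul_mulVec, ← Matrix.add_mulVec]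
      congr 1
      rw [hS, damped, Matrix.smul_mul, Matrix.add_mul, hAP, Matrix.mul_sub, Matrix.mul_smul,
        Matrix.mul_sub]
      simp only [mul_one, one_mul]
      module
    rw [e]
    refine (wnorm_add_le _ _ _).trans ?_
    rw [wnorm_smul, wnorm_smul, abs_of_nonneg (by linarith), abs_of_pos (by linarith)]
    have h1 := hSP v
    have h2 := hproj v
    have h3 := mul_le_mul_of_nonneg_left h1 (show 0 ≤ 2 * γ by linarith)
    have h4 : 0 ≤ 1 - 2 * (1 - ρ) * γ := by nlinarith
    nlinarith [mul_le_mul_of_nonneg_left h2 h4]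
  · intro v
    have e : (damped A γ).mulVec v = (1 - γ) • v + γ • A.mulVec v := by
      rw [damped, Matrix.sub_mulVec, Matrix.smul_mulVec, Matrix.sub_mulVec, Matrix.one_mulVec]
      module
    rw [e]
    refine (wnorm_add_le _ _ _).trans ?_
    rw [wnorm_smul, wnorm_smul, abs_of_nonneg (by linarith), abs_of_pos hγ]
    nlinarith [hmix v, wnorm_nonneg T v]
  · intro v
    have e : (1 - A).mulVec v = v + (-1 : ℝ) • A.mulVec v := by
      rw [Matrix.sub_mulVec, Matrix.one_mulVec]; module
    rw [e]
    refine (wnorm_add_le _ _ _).trans ?_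
    rw [wnorm_smul]
    simp only [abs_neg, abs_one, one_mul]
    linarith [hmix v]

end AdaptedNorm

/-! ### Stationary vectors of stochastic matrices and mixing of their lazy powers -/

section Stochastic

variable {n : ℕ}

/-- A row stochastic matrix has a stationary vector. -/
lemma exists_isLeftPerron (hn : 0 < n) {A : Matrix (Fin n) (Fin n) ℝ}
    (hA : A ∈ Matrix.rowStochastic ℝ (Fin n)) :
    ∃ u : EuclideanSpace ℝ (Fin n), IsLeftPerron A u := by
  have : Nonempty (Fin n) := ⟨⟨0, hn⟩⟩
  obtain ⟨h0, h1⟩ := Matrix.mem_rowStochastic_iff_sum.1 hA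
  have hdet : (A - 1).det = 0 := by
    rw [← Matrix.exists_mulVec_eq_zero_iff]
    refine ⟨1, one_ne_zero, ?_⟩
    rw [Matrix.sub_mulVec, Matrix.one_mulVec, hA.2, sub_self]
  obtain ⟨w, hw, hwA⟩ := Matrix.exists_vecMul_eq_zero_iff.2 hdet
  rw [Matrix.vecMul_sub, Matrix.vecMul_one, sub_eq_zero] at hwA
  have hle : ∀ j ∈ Finset.univ, |w j| ≤ ∑ i, |w i| * A i j := by
    intro j _
    have e : w j = ∑ i, w i * A i j := (congrFun hwA j).symm
    rw [e]
    refine (Finset.abs_sum_le_sum_abs (fun i => w i * A i j) Finset.univ).trans (le_of_eq ?_)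
    refine Finset.sum_congr rfl fun i _ => ?_
    rw [abs_mul, abs_of_nonneg (h0 i j)]
  have hsum : ∑ j, |w j| = ∑ j, ∑ i, |w i| * A i j := by
    rw [Finset.sum_comm]
    refine Finset.sum_congr rfl fun i _ => ?_
    rw [← Finset.mul_sum, h1, mul_one]
  -- `|w| ≤ |w| A` holds entrywise and both sides have the same total because rows sum to one, so
  -- equality holds and `|w|` is itself stationary.
  have heq := (Finset.sum_eq_sum_iff_of_le hle).1 hsum
  obtain ⟨i₀, hi₀⟩ : ∃ i, w i ≠ 0 := by
    by_contra! h
    exact hw (funext h)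
  have hpos : 0 < ∑ i, |w i| :=
    Finset.sum_pos' (fun i _ => abs_nonneg _) ⟨i₀, Finset.mem_univ _, abs_pos.2 hi₀⟩
  refine ⟨WithLp.toLp 2 fun i => n / (∑ i, |w i|) * |w i|, fun i => ?_, fun j => ?_, ?_⟩
  · simp only
    positivity
  · simp only
    rw [heq j (Finset.mem_univ j), Finset.mul_sum]
    exact Finset.sum_congr rfl fun i _ => by ring
  · simp only
    rw [← Finset.mul_sum, div_mul_cancel₀ _ hpos.ne']

lemma exists_isRightPerron (hn : 0 < n) {A : Matrix (Fin n) (Fin n) ℝ}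
    (hA : A ∈ Matrix.colStochastic ℝ (Fin n)) :
    ∃ u : EuclideanSpace ℝ (Fin n), IsRightPerron A u := by
  obtain ⟨u, hu⟩ := exists_isLeftPerron hn
    (Matrix.transpose_mem_rowStochastic_iff_mem_colStochastic.2 hA)
  refine ⟨u, hu.nonneg, fun i => ?_, hu.sum_eq⟩
  rw [← hu.eigen i]
  exact Finset.sum_congr rfl fun j _ => by rw [Matrix.transpose_apply, mul_comm]

/-- The oscillation of a vector contracts under a row stochastic matrix with a column bounded
from below. -/
lemma osc_mulVec_le {B : Matrix (Fin n) (Fin n) ℝ} (hB : B ∈ Matrix.rowStochastic ℝ (Fin n))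
    {r : Fin n} {η : ℝ} (hη : ∀ i, η ≤ B i r) {v : Fin n → ℝ} {d : ℝ}
    (hv : ∀ i j, v i - v j ≤ d) (i j : Fin n) :
    B.mulVec v i - B.mulVec v j ≤ (1 - η) * d := by
  obtain ⟨h0, h1⟩ := Matrix.mem_rowStochastic_iff_sum.1 hB
  have hne : (Finset.univ : Finset (Fin n)).Nonempty := ⟨i, Finset.mem_univ _⟩
  obtain ⟨a, -, ha⟩ := Finset.exists_max_image Finset.univ v hne
  obtain ⟨b, -, hb⟩ := Finset.exists_min_image Finset.univ v hne
  -- Row `i` gives weight at least `η` to the entry `r`, which pulls its average away from the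
  -- maximum; `hj` is the mirror image at the minimum, and `v r` cancels in the difference.
  have hi : B.mulVec v i ≤ v a - η * (v a - v r) := by
    have e : v a - B.mulVec v i = ∑ k, B i k * (v a - v k) := by
      simp only [mul_sub, Finset.sum_sub_distrib, ← Finset.sum_mul, h1, one_mul]; rfl
    have := Finset.single_le_sum (f := fun k => B i k * (v a - v k))
      (fun k _ => mul_nonneg (h0 i k) (sub_nonneg.2 (ha k (Finset.mem_univ k))))
      (Finset.mem_univ r)
    have h2 := mul_le_mul_of_nonneg_right (hη i) (sub_nonneg.2 (ha r (Finset.mem_univ r)))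
    linarith
  have hj : v b + η * (v r - v b) ≤ B.mulVec v j := by
    have e : B.mulVec v j - v b = ∑ k, B j k * (v k - v b) := by
      simp only [mul_sub, Finset.sum_sub_distrib, ← Finset.sum_mul, h1, one_mul]; rfl
    have := Finset.single_le_sum (f := fun k => B j k * (v k - v b))
      (fun k _ => mul_nonneg (h0 j k) (sub_nonneg.2 (hb k (Finset.mem_univ k))))
      (Finset.mem_univ r)
    have h2 := mul_le_mul_of_nonneg_right (hη j) (sub_nonneg.2 (hb r (Finset.mem_univ r)))
    linarith
  have hη1 : η ≤ 1 := (hη i).trans (Matrix.le_one_of_mem_rowStochastic hB)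
  have := mul_le_mul_of_nonneg_left (hv a b) (sub_nonneg.2 hη1)
  linarith

/-- The lazy version `(1 + A) / 2` of `A`. -/
noncomputable def lazy (A : Matrix (Fin n) (Fin n) ℝ) : Matrix (Fin n) (Fin n) ℝ :=
  (1 / 2 : ℝ) • (1 + A)

lemma lazy_mem {A : Matrix (Fin n) (Fin n) ℝ} (hA : A ∈ Matrix.rowStochastic ℝ (Fin n)) :
    lazy A ∈ Matrix.rowStochastic ℝ (Fin n) := by
  have := Matrix.convex_rowStochastic (one_mem (Matrix.rowStochastic ℝ (Fin n))) hA
    (show (0 : ℝ) ≤ 1 / 2 by norm_num) (show (0 : ℝ) ≤ 1 / 2 by norm_num) (by norm_num)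
  rwa [← smul_add] at this

/-- If every node is reached from `r`, some power of the lazy matrix has a positive column. -/
lemma exists_lazy_pow_pos {A : Matrix (Fin n) (Fin n) ℝ}
    (hA : A ∈ Matrix.rowStochastic ℝ (Fin n)) {r : Fin n}
    (hr : ∀ j, Relation.ReflTransGen (inducedGraph A).Adj r j) :
    ∃ N : ℕ, ∀ j, 0 < (lazy A ^ N) j r := by
  have hS := lazy_mem hA
  have hpow : ∀ k i j, 0 ≤ (lazy A ^ k) i j := fun k i j =>
    Matrix.nonneg_of_mem_rowStochastic (pow_mem hS k)
  have hstep : ∀ k i j l, 0 < lazy A i j → 0 < (lazy A ^ k) j l → 0 < (lazy A ^ (k + 1)) i l := by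
    intro k i j l h1 h2
    rw [pow_succ', Matrix.mul_apply]
    exact Finset.sum_pos' (fun m _ => mul_nonneg (Matrix.nonneg_of_mem_rowStochastic hS)
      (hpow k m l)) ⟨j, Finset.mem_univ _, mul_pos h1 h2⟩
  -- Laziness puts mass on the diagonal, so a positive entry stays positive in all later powers; the
  -- exponents found for different nodes can then be raised to a common one.
  have hdiag : ∀ i, 0 < lazy A i i := by
    intro i
    have := hA.1 i i
    simp only [lazy, Matrix.smul_apply, Matrix.add_apply, Matrix.one_apply_eq, smul_eq_mul]
    linarith
  have hmono : ∀ j k m, k ≤ m → 0 < (lazy A ^ k) j r → 0 < (lazy A ^ m) j r := by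
    intro j k m hkm hk
    induction m, hkm using Nat.le_induction with
    | base => exact hk
    | succ m _ ih => exact hstep m j j r (hdiag j) ih
  have hex : ∀ j, ∃ k, 0 < (lazy A ^ k) j r := by
    intro j
    induction hr j with
    | refl => exact ⟨0, by simp⟩
    | @tail b c _ hbc ih =>
      obtain ⟨k, hk⟩ := ih
      refine ⟨k + 1, hstep k c b r ?_ hk⟩
      have h1 : 0 < A c b := hbc
      have h2 : (0 : ℝ) ≤ (1 : Matrix (Fin n) (Fin n) ℝ) c b := by
        rw [Matrix.one_apply]; split_ifs <;> norm_num
      simp only [lazy, Matrix.smul_apply, Matrix.add_apply, smul_eq_mul]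
      linarith
  choose k hk using hex
  exact ⟨Finset.univ.sup k, fun j => hmono j (k j) _ (Finset.le_sup (Finset.mem_univ j)) (hk j)⟩

lemma projR_mul_self (hn : 0 < n) {u : EuclideanSpace ℝ (Fin n)} (hu : ∑ i, u i = n) :
    projR u * projR u = projR u := by
  have hn' : (n : ℝ) ≠ 0 := by exact_mod_cast hn.ne'
  have : (Matrix.of fun (_ : Fin n) j => u j / (n : ℝ)) * (Matrix.of fun _ j => u j / (n : ℝ))
      = Matrix.of fun _ j => u j / (n : ℝ) := by
    ext i j
    simp only [Matrix.mul_apply, Matrix.of_apply]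
    rw [← Finset.sum_mul, ← Finset.sum_div, hu, div_self hn', one_mul]
  rw [projR, Matrix.mul_sub, Matrix.sub_mul, Matrix.sub_mul, this]
  simp

/-- The columns of `1 - Π_R` are multiples of `𝟙`, which `A` fixes. Together with the left
eigenvector this makes `Π_R` commute with `A`. -/
lemma mul_one_sub_projR {A : Matrix (Fin n) (Fin n) ℝ}
    (hA : A ∈ Matrix.rowStochastic ℝ (Fin n)) (u : EuclideanSpace ℝ (Fin n)) :
    A * (1 - projR u) = 1 - projR u := by
  ext i j
  simp only [projR, sub_sub_cancel, Matrix.mul_apply, Matrix.of_apply]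
  rw [← Finset.sum_mul, Matrix.sum_row_of_mem_rowStochastic hA, one_mul]

lemma one_sub_projR_mul {A : Matrix (Fin n) (Fin n) ℝ} {u : EuclideanSpace ℝ (Fin n)}
    (hu : IsLeftPerron A u) : (1 - projR u) * A = 1 - projR u := by
  ext i j
  simp only [projR, sub_sub_cancel, Matrix.mul_apply, Matrix.of_apply]
  rw [← hu.eigen j, Finset.sum_div]
  exact Finset.sum_congr rfl fun k _ => by ring

lemma transpose_projR (u : EuclideanSpace ℝ (Fin n)) : (projR u).transpose = projC u := by
  ext i j
  simp [projR, projC, Matrix.one_apply, eq_comm]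

/-- The lazy matrix contracts the range of `Π_R`. -/
lemma tendsto_lazy_pow_mul_projR (hn : 0 < n) {A : Matrix (Fin n) (Fin n) ℝ}
    (hA : A ∈ Matrix.rowStochastic ℝ (Fin n)) {r : Fin n}
    (hr : ∀ j, Relation.ReflTransGen (inducedGraph A).Adj r j)
    {u : EuclideanSpace ℝ (Fin n)} (hu : IsLeftPerron A u) :
    Tendsto (fun k : ℕ => lazy A ^ k * projR u) atTop (𝓝 0) := by
  have hS := lazy_mem hA
  obtain ⟨N, hN⟩ := exists_lazy_pow_pos hA hr
  have hne : (Finset.univ : Finset (Fin n)).Nonempty := ⟨r, Finset.mem_univ _⟩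
  obtain ⟨a, -, ha⟩ := Finset.exists_min_image Finset.univ (fun j => (lazy A ^ N) j r) hne
  set η := (lazy A ^ N) a r with hη
  have hηpos : 0 < η := hN a
  have hη1 : η ≤ 1 := Matrix.le_one_of_mem_rowStochastic (pow_mem hS N)
  -- the weighted mean of `S ^ k Π v` vanishes, so its entries are bounded by its oscillation
  have hproj : projR u * projR u = projR u := projR_mul_self hn hu.sum_eq
  have hcommA : A * projR u = projR u * A := by
    have h1 := mul_one_sub_projR hA u
    have h2 := one_sub_projR_mul hu
    rw [Matrix.mul_sub, mul_one] at h1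
    rw [Matrix.sub_mul, one_mul] at h2
    have : A - A * projR u = A - projR u * A := h1.trans h2.symm
    exact sub_right_injective this
  have hcomm : Commute (lazy A) (projR u) := by
    rw [lazy]
    exact ((Commute.one_left _).add_left hcommA).smul_left _
  have hmean : ∀ k j, ∑ i, u i * (lazy A ^ k * projR u) i j = 0 := by
    intro k j
    have e : (1 - projR u) * (lazy A ^ k * projR u) = 0 := by
      rw [(hcomm.pow_left k).eq, ← Matrix.mul_assoc, Matrix.sub_mul, one_mul, hproj, sub_self,
        Matrix.zero_mul]
    have := congrFun (congrFun e r) j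
    simp only [projR, sub_sub_cancel, Matrix.mul_apply (M := Matrix.of _), Matrix.of_apply,
      Matrix.zero_apply] at this
    have hn' : (n : ℝ) ≠ 0 := by exact_mod_cast hn.ne'
    have h2 : (∑ i, u i * (lazy A ^ k * projR u) i j) / n = 0 := by
      rw [← this, Finset.sum_div]
      exact Finset.sum_congr rfl fun i _ => by rw [projR]; ring
    simpa [hn'] using h2
  have hosc : ∀ k j i l, (lazy A ^ (N * k) * projR u) i j - (lazy A ^ (N * k) * projR u) l j
      ≤ (1 - η) ^ k * (2 * ∑ i, |projR u i j|) := by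
    intro k j
    induction k with
    | zero =>
      intro i l
      simp only [mul_zero, pow_zero, one_mul]
      have h1 := Finset.single_le_sum (f := fun i => |projR u i j|) (fun i _ => abs_nonneg _)
        (Finset.mem_univ i)
      have h2 := Finset.single_le_sum (f := fun i => |projR u i j|) (fun i _ => abs_nonneg _)
        (Finset.mem_univ l)
      have h3 := le_abs_self (projR u i j)
      have h4 := neg_abs_le (projR u l j)
      linarith
    | succ k ih =>
      intro i l
      have e : ∀ i, (lazy A ^ (N * (k + 1)) * projR u) i j
          = (lazy A ^ N).mulVec (fun m => (lazy A ^ (N * k) * projR u) m j) i := by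
        intro i
        rw [mul_add, mul_one, add_comm, pow_add, Matrix.mul_assoc, Matrix.mul_apply]
        rfl
      rw [e, e, pow_succ', mul_assoc]
      exact osc_mulVec_le (pow_mem hS N) (fun i => ha i (Finset.mem_univ i)) ih i l
  have hentry : ∀ k j i, |(lazy A ^ (N * k) * projR u) i j|
      ≤ (1 - η) ^ k * (2 * ∑ i, |projR u i j|) := by
    intro k j i
    set Z := lazy A ^ (N * k) * projR u
    have hn' : (0 : ℝ) < n := by exact_mod_cast hn
    have e : (n : ℝ) * Z i j = ∑ l, u l * (Z i j - Z l j) := by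
      simp only [mul_sub, Finset.sum_sub_distrib, ← Finset.sum_mul, hu.sum_eq]
      rw [hmean, sub_zero]
    have b1 : ∑ l, u l * (Z i j - Z l j) ≤ n * ((1 - η) ^ k * (2 * ∑ i, |projR u i j|)) := by
      rw [← hu.sum_eq, Finset.sum_mul]
      exact Finset.sum_le_sum fun l _ => mul_le_mul_of_nonneg_left (hosc k j i l) (hu.nonneg l)
    have b2 : -(n * ((1 - η) ^ k * (2 * ∑ i, |projR u i j|))) ≤ ∑ l, u l * (Z i j - Z l j) := by
      rw [← hu.sum_eq, Finset.sum_mul, ← Finset.sum_neg_distrib]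
      refine Finset.sum_le_sum fun l _ => ?_
      rw [← mul_neg]
      exact mul_le_mul_of_nonneg_left (by linarith [hosc k j l i]) (hu.nonneg l)
    rw [abs_le]
    constructor
    · refine le_of_mul_le_mul_left ?_ hn'
      rw [mul_neg]; linarith
    · refine le_of_mul_le_mul_left ?_ hn'
      linarith
  -- powers between multiples of `N`
  have hsub : Tendsto (fun k : ℕ => lazy A ^ (N * k) * projR u) atTop (𝓝 0) := by
    refine tendsto_pi_nhds.2 fun i => tendsto_pi_nhds.2 fun j => ?_
    have hz : Tendsto (fun k : ℕ => (1 - η) ^ k * (2 * ∑ i, |projR u i j|)) atTop (𝓝 0) := by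
      have := (tendsto_pow_atTop_nhds_zero_of_lt_one (sub_nonneg.2 hη1)
        (by linarith : 1 - η < 1)).mul_const (2 * ∑ i, |projR u i j|)
      simpa using this
    exact squeeze_zero_norm (fun k => hentry k j i) hz
  -- Left multiplication by a row stochastic matrix averages within each column, so the largest
  -- absolute value in a column cannot grow between multiples of `N`.
  have hmaxle : ∀ k m i j b, k ≤ m → (∀ i, |(lazy A ^ k * projR u) i j| ≤ b) →
      |(lazy A ^ m * projR u) i j| ≤ b := by
    intro k m i j b hkm hb
    obtain ⟨l, rfl⟩ := Nat.exists_eq_add_of_le' hkm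
    rw [pow_add, Matrix.mul_assoc, Matrix.mul_apply]
    refine (Finset.abs_sum_le_sum_abs (fun x => (lazy A ^ l) i x * (lazy A ^ k * projR u) x j)
      Finset.univ).trans ?_
    calc _ ≤ ∑ x, (lazy A ^ l) i x * b := by
          refine Finset.sum_le_sum fun x _ => ?_
          have h0 : 0 ≤ (lazy A ^ l) i x := Matrix.nonneg_of_mem_rowStochastic (pow_mem hS l)
          rw [abs_mul, abs_of_nonneg h0]
          exact mul_le_mul_of_nonneg_left (hb x) h0
      _ = b := by
          rw [← Finset.sum_mul, Matrix.sum_row_of_mem_rowStochastic (pow_mem hS l), one_mul]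
  refine tendsto_pi_nhds.2 fun i => tendsto_pi_nhds.2 fun j => ?_
  rw [Metric.tendsto_atTop]
  intro ε hε
  have hev : ∀ᶠ k in atTop, ∀ i, |(lazy A ^ (N * k) * projR u) i j| < ε := by
    rw [eventually_all]
    intro i
    have h1 := (tendsto_pi_nhds.1 ((tendsto_pi_nhds.1 hsub) i)) j
    have h2 := h1.abs
    simp only [Matrix.zero_apply, abs_zero] at h2
    exact h2.eventually_lt_const hε
  obtain ⟨k, hk⟩ := hev.exists
  obtain ⟨a', -, ha'⟩ := Finset.exists_max_image Finset.univ
    (fun i => |(lazy A ^ (N * k) * projR u) i j|) hne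
  refine ⟨N * k, fun m hm => ?_⟩
  have := hmaxle (N * k) m i j _ hm (fun i => ha' i (Finset.mem_univ i))
  rw [Real.dist_eq, Matrix.zero_apply, sub_zero]
  exact this.trans_lt (hk a')

lemma reach_of_mem_roots {W : Matrix (Fin n) (Fin n) ℝ} {r : Fin n} (hr : r ∈ roots W) (j : Fin n) :
    Relation.ReflTransGen (inducedGraph W).Adj r j := by
  obtain ⟨T, hT⟩ := hr
  exact Relation.ReflTransGen.mono hT.sub _ _ (hT.reach j)

/-- Powers of a stochastic matrix are stochastic, hence have entries bounded by `1`; this is the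
power boundedness that `exists_adaptedNorm` asks for. -/
theorem exists_adaptedNorm_projR (hn : 0 < n) {A : Matrix (Fin n) (Fin n) ℝ}
    (hA : A ∈ Matrix.rowStochastic ℝ (Fin n)) {r : Fin n} (hr : r ∈ roots A)
    {u : EuclideanSpace ℝ (Fin n)} (hu : IsLeftPerron A u) :
    ∃ (T : Matrix (Fin n) (Fin n) ℝ) (δ θ : ℝ),
      ∀ γ : ℝ, 0 < γ → γ ≤ 1 / 2 → IsAdaptedNorm A (projR u) T δ θ γ := by
  refine exists_adaptedNorm A (projR u) 1 (projR_mul_self hn hu.sum_eq) ?_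
    (mul_one_sub_projR hA u) (fun k i j => ?_)
    (tendsto_lazy_pow_mul_projR hn hA (reach_of_mem_roots hr) hu)
  · have h := (mul_one_sub_projR hA u).trans (one_sub_projR_mul hu).symm
    rw [Matrix.mul_sub, Matrix.sub_mul, mul_one, one_mul] at h
    exact sub_right_injective h
  · have hk := pow_mem hA k
    rw [abs_of_nonneg (Matrix.nonneg_of_mem_rowStochastic hk)]
    exact Matrix.le_one_of_mem_rowStochastic hk

/-- `Aᵀ` is row stochastic and `Π_C` is the transpose of its `Π_R`. Transposing the mixing limit
puts `Π_C` on the left of the powers, and commutation moves it back to the right. -/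
theorem exists_adaptedNorm_projC (hn : 0 < n) {A : Matrix (Fin n) (Fin n) ℝ}
    (hA : A ∈ Matrix.colStochastic ℝ (Fin n)) {r : Fin n} (hr : r ∈ roots A.transpose)
    {u : EuclideanSpace ℝ (Fin n)} (hu : IsRightPerron A u) :
    ∃ (T : Matrix (Fin n) (Fin n) ℝ) (δ θ : ℝ),
      ∀ γ : ℝ, 0 < γ → γ ≤ 1 / 2 → IsAdaptedNorm A (projC u) T δ θ γ := by
  have hA' := Matrix.transpose_mem_rowStochastic_iff_mem_colStochastic.2 hA
  have hu' : IsLeftPerron A.transpose u := ⟨hu.nonneg, fun j => by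
    rw [← hu.eigen j]
    exact Finset.sum_congr rfl fun i _ => by rw [Matrix.transpose_apply, mul_comm], hu.sum_eq⟩
  have hcomm : A * projC u = projC u * A := by
    have h := (mul_one_sub_projR hA' u).trans (one_sub_projR_mul hu').symm
    rw [Matrix.mul_sub, Matrix.sub_mul, mul_one, one_mul] at h
    have h1 := congrArg Matrix.transpose (sub_right_injective h)
    rw [Matrix.transpose_mul, Matrix.transpose_mul, Matrix.transpose_transpose,
      transpose_projR] at h1
    exact h1.symm
  have hlazyT : lazy A = (lazy A.transpose).transpose := by
    simp [lazy]
  have hlazy : Commute (lazy A) (projC u) := by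
    rw [lazy]
    exact ((Commute.one_left _).add_left hcomm).smul_left _
  refine exists_adaptedNorm A (projC u) 1 ?_ hcomm ?_ (fun k i j => ?_) ?_
  · rw [← transpose_projR, ← Matrix.transpose_mul, projR_mul_self hn hu.sum_eq]
  · have := congrArg Matrix.transpose (one_sub_projR_mul hu')
    rw [Matrix.transpose_mul, Matrix.transpose_transpose, Matrix.transpose_sub,
      transpose_projR, Matrix.transpose_one] at this
    exact this
  · have hk := pow_mem hA k
    rw [abs_of_nonneg (Matrix.nonneg_of_mem_colStochastic hk)]
    exact Matrix.le_one_of_mem_colStochastic hk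
  · have h := tendsto_lazy_pow_mul_projR hn hA' (reach_of_mem_roots hr) hu'
    have h2 := (Continuous.matrix_transpose continuous_id).tendsto
      (0 : Matrix (Fin n) (Fin n) ℝ) |>.comp h
    simp only [id, Matrix.transpose_zero] at h2
    refine h2.congr fun k => ?_
    change ((lazy A.transpose) ^ k * projR u).transpose = (lazy A) ^ k * projC u
    rw [Matrix.transpose_mul, Matrix.transpose_pow, transpose_projR, ← hlazyT,
      (hlazy.pow_left k).eq]

end Stochastic

/-! ### Weighted Frobenius norms and one compressed gossip step -/

section Gossip

variable {n p : ℕ}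

lemma mix_add (W : Matrix (Fin n) (Fin n) ℝ) (X Y : Stack n p) :
    mix W (X + Y) = mix W X + mix W Y := by
  funext i; simp [mix, smul_add, Finset.sum_add_distrib]

lemma mix_sub (W : Matrix (Fin n) (Fin n) ℝ) (X Y : Stack n p) :
    mix W (X - Y) = mix W X - mix W Y := by
  funext i; simp [mix, smul_sub, Finset.sum_sub_distrib]

lemma mix_smul (W : Matrix (Fin n) (Fin n) ℝ) (a : ℝ) (X : Stack n p) :
    mix W (a • X) = a • mix W X := by
  funext i; simp [mix, Finset.smul_sum, smul_comm a]

lemma mix_one (X : Stack n p) : mix 1 X = X := by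
  funext i; simp [mix, Matrix.one_apply]

lemma sub_mix (V W : Matrix (Fin n) (Fin n) ℝ) (X : Stack n p) :
    mix (V - W) X = mix V X - mix W X := by
  funext i; simp [mix, sub_smul, Finset.sum_sub_distrib]

lemma smul_mix (a : ℝ) (W : Matrix (Fin n) (Fin n) ℝ) (X : Stack n p) :
    mix (a • W) X = a • mix W X := by
  funext i; simp [mix, Finset.smul_sum, mul_smul]

lemma mix_mix (V W : Matrix (Fin n) (Fin n) ℝ) (X : Stack n p) :
    mix V (mix W X) = mix (V * W) X := by
  funext i
  simp only [mix, Matrix.mul_apply, Finset.smul_sum, Finset.sum_smul, mul_smul]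
  exact Finset.sum_comm

/-- The weighted Frobenius norm `‖T X‖_F`. -/
noncomputable def nrm (T : Matrix (Fin n) (Fin n) ℝ) (X : Stack n p) : ℝ :=
  ‖(WithLp.toLp 2 (mix T X) : PiLp 2 fun _ : Fin n => Vec p)‖

lemma nrm_nonneg (T : Matrix (Fin n) (Fin n) ℝ) (X : Stack n p) : 0 ≤ nrm T X := norm_nonneg _

lemma nrm_sq (T : Matrix (Fin n) (Fin n) ℝ) (X : Stack n p) : nrm T X ^ 2 = wsq T X := by
  rw [nrm, PiLp.norm_sq_eq_of_L2]; rfl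

lemma nrm_one_sq (X : Stack n p) : nrm 1 X ^ 2 = ∑ i, ‖X i‖ ^ 2 := by
  rw [nrm_sq, wsq, mix_one]

lemma nrm_add_le (T : Matrix (Fin n) (Fin n) ℝ) (X Y : Stack n p) :
    nrm T (X + Y) ≤ nrm T X + nrm T Y := by
  simp only [nrm, mix_add, WithLp.toLp_add]
  exact norm_add_le _ _

lemma nrm_sub_le (T : Matrix (Fin n) (Fin n) ℝ) (X Y : Stack n p) :
    nrm T (X - Y) ≤ nrm T X + nrm T Y := by
  simp only [nrm, mix_sub, WithLp.toLp_sub]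
  exact norm_sub_le _ _

lemma nrm_smul (T : Matrix (Fin n) (Fin n) ℝ) (a : ℝ) (X : Stack n p) :
    nrm T (a • X) = |a| * nrm T X := by
  simp only [nrm, mix_smul, WithLp.toLp_smul, norm_smul, Real.norm_eq_abs]

lemma wsq_eq_sum_wnorm (T : Matrix (Fin n) (Fin n) ℝ) (X : Stack n p) :
    wsq T X = ∑ l, wnorm T (fun i => X i l) ^ 2 := by
  simp only [wsq, wnorm, EuclideanSpace.norm_sq_eq]
  rw [Finset.sum_comm]
  refine Finset.sum_congr rfl fun l _ => Finset.sum_congr rfl fun i _ => ?_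
  simp [mix, Matrix.mulVec, dotProduct]

/-- The squared weighted Frobenius norm is the sum of the squared weighted norms of the columns, so
every vector norm estimate passes to matrices with the same constant. -/
lemma nrm_le_of_wnorm_le {S T : Matrix (Fin n) (Fin n) ℝ} {X Y : Stack n p} {b : ℝ} (hb : 0 ≤ b)
    (h : ∀ l, wnorm S (fun i => X i l) ≤ b * wnorm T (fun i => Y i l)) :
    nrm S X ≤ b * nrm T Y := by
  refine le_of_sq_le_sq ?_ (mul_nonneg hb (nrm_nonneg _ _))
  rw [mul_pow, nrm_sq, nrm_sq, wsq_eq_sum_wnorm, wsq_eq_sum_wnorm, Finset.mul_sum]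
  refine Finset.sum_le_sum fun l _ => ?_
  rw [← mul_pow]
  exact pow_le_pow_left₀ (wnorm_nonneg _ _) (h l) 2

lemma InducedNormLE.nrm_mix_le {T A : Matrix (Fin n) (Fin n) ℝ} {b : ℝ}
    (h : InducedNormLE T A b) (hb : 0 ≤ b) (X : Stack n p) :
    nrm T (mix A X) ≤ b * nrm T X := by
  refine nrm_le_of_wnorm_le hb fun l => ?_
  have e : (fun i => mix A X i l) = A.mulVec (fun i => X i l) := by
    funext i; simp [mix, Matrix.mulVec, dotProduct]
  rw [e]
  exact h _

lemma IsAdaptedNorm.nrm_one_le {W Pm T : Matrix (Fin n) (Fin n) ℝ} {δ θ γ : ℝ}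
    (hT : IsAdaptedNorm W Pm T δ θ γ) (X : Stack n p) : nrm 1 X ≤ nrm T X := by
  have := nrm_le_of_wnorm_le (S := 1) (T := T) (X := X) (Y := X) zero_le_one fun l => by
    rw [wnorm_one, one_mul]; exact hT.lower _
  simpa using this

/-- Evaluated at the nonzero vector `𝟙`, the two norm comparisons leave no room for `δ < 1`. -/
lemma IsAdaptedNorm.one_le_upper [NeZero n] {W Pm T : Matrix (Fin n) (Fin n) ℝ} {δ θ γ : ℝ}
    (hT : IsAdaptedNorm W Pm T δ θ γ) : 1 ≤ δ := by
  have h := (hT.lower 1).trans (hT.upper 1)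
  have h0 : 0 < ‖(WithLp.toLp 2 (1 : Fin n → ℝ))‖ := by
    rw [norm_pos_iff]
    intro h
    have := congrArg (fun x : EuclideanSpace ℝ (Fin n) => x 0) h
    simp at this
  by_contra hlt
  push Not at hlt
  nlinarith

lemma IsAdaptedNorm.nrm_le {W Pm T : Matrix (Fin n) (Fin n) ℝ} {δ θ γ : ℝ}
    (hT : IsAdaptedNorm W Pm T δ θ γ) (hδ : 0 ≤ δ) (X : Stack n p) : nrm T X ≤ δ * nrm 1 X := by
  refine nrm_le_of_wnorm_le hδ fun l => ?_
  rw [wnorm_one]; exact hT.upper _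

/-- A negative contraction factor would make the norm of an image negative, since `𝟙` has positive
norm. -/
lemma IsAdaptedNorm.theta_mul_le_one [NeZero n] {W Pm T : Matrix (Fin n) (Fin n) ℝ} {δ θ γ : ℝ}
    (hT : IsAdaptedNorm W Pm T δ θ γ) : θ * γ ≤ 1 := by
  have h := (wnorm_nonneg _ _).trans (hT.contraction 1)
  have h1 := hT.lower 1
  have h0 : 0 < ‖(WithLp.toLp 2 (1 : Fin n → ℝ))‖ := by
    rw [norm_pos_iff]
    intro h
    have := congrArg (fun x : EuclideanSpace ℝ (Fin n) => x 0) h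
    simp at this
  by_contra hlt
  push Not at hlt
  nlinarith

/-- One gossip step from `U` with noise `E`. -/
noncomputable def gossip (W : Matrix (Fin n) (Fin n) ℝ) (γ : ℝ) (U E : Stack n p) : Stack n p :=
  U - γ • mix (1 - W) (U + E)

/-- Convexity of the square at the point `q a + t ((b + c) / t)`: the contracting term keeps the
factor `q` and the perturbation pays `1 / t`. -/
lemma sq_convex_le {q t a b c : ℝ} (hq : q = 1 - t) (hq0 : 0 ≤ q) (ht : 0 < t) :
    (q * a + (b + c)) ^ 2 ≤ q * a ^ 2 + 2 / t * (b ^ 2 + c ^ 2) := by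
  have h1 : q * a ^ 2 + (b + c) ^ 2 / t - (q * a + (b + c)) ^ 2
      = q / t * (t * a - (b + c)) ^ 2 := by
    rw [hq]; field_simp; ring
  have h2 : 0 ≤ q / t * (t * a - (b + c)) ^ 2 := by positivity
  have h3 : (b + c) ^ 2 / t ≤ 2 / t * (b ^ 2 + c ^ 2) := by
    rw [div_mul_eq_mul_div]
    gcongr
    nlinarith [sq_nonneg (b - c)]
  linarith

/-- Young's inequality with parameter `t / 4`, small enough that using it twice spoils only half of
a contraction by `1 - t`. -/
lemma sq_add_le_of_le {x y z t : ℝ} (ht : 0 < t) (ht1 : t ≤ 1) (hx : 0 ≤ x) (h : x ≤ y + z) :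
    x ^ 2 ≤ (1 + t / 4) * y ^ 2 + 5 / t * z ^ 2 := by
  have h1 : x ^ 2 ≤ (y + z) ^ 2 := pow_le_pow_left₀ hx h 2
  have h2 : (1 + t / 4) * y ^ 2 + (1 + 4 / t) * z ^ 2 - (y + z) ^ 2
      = (t * y - 4 * z) ^ 2 / (4 * t) := by
    field_simp; ring
  have h3 : 0 ≤ (t * y - 4 * z) ^ 2 / (4 * t) := by positivity
  have h4 : 1 + 4 / t ≤ 5 / t := by
    rw [← sub_nonneg]
    have : 5 / t - (1 + 4 / t) = (1 - t) / t := by field_simp; ring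
    rw [this]
    exact div_nonneg (by linarith) ht.le
  nlinarith [mul_le_mul_of_nonneg_right h4 (sq_nonneg z)]

lemma sq_le_three_of_le {x a b c : ℝ} (hx : 0 ≤ x) (h : x ≤ a + b + c) :
    x ^ 2 ≤ 3 * (a ^ 2 + b ^ 2 + c ^ 2) := by
  have h1 : x ^ 2 ≤ (a + b + c) ^ 2 := pow_le_pow_left₀ hx h 2
  nlinarith [sq_nonneg (a - b), sq_nonneg (a - c), sq_nonneg (b - c)]

section

variable {W Pm T : Matrix (Fin n) (Fin n) ℝ} {δ θ γ : ℝ} [NeZero n]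

/-- Contraction of the consensus error in a gossip step. -/
lemma IsAdaptedNorm.gossip_consensus (hT : IsAdaptedNorm W Pm T δ θ γ) (hP : Pm * Pm = Pm)
    (hWP : (1 - W) * Pm = 1 - W) (hγ : 0 < γ) (U D E : Stack n p) :
    nrm T (mix Pm (gossip W γ (U + D) E)) ^ 2 ≤ (1 - θ * γ) * nrm T (mix Pm U) ^ 2
      + 2 / (θ * γ) * ((1 - θ * γ) ^ 2 * δ ^ 2 * nrm 1 D ^ 2 + 9 * γ ^ 2 * δ ^ 2 * nrm 1 E ^ 2) := by
  have hq : 0 ≤ 1 - θ * γ := sub_nonneg.2 hT.theta_mul_le_one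
  have hδ : 0 ≤ δ := zero_le_one.trans hT.one_le_upper
  -- `(1 - W) Pm = 1 - W` gives `Pm W_γ = Pm W_γ Pm`, so the contraction sees `U` only through its
  -- consensus error `Pm U`.
  have e : mix Pm (gossip W γ (U + D) E)
      = mix (Pm * damped W γ) (mix Pm U)
        + (mix (Pm * damped W γ) D - γ • mix Pm (mix (1 - W) E)) := by
    have h1 : Pm * damped W γ * Pm = Pm - γ • (Pm * (1 - W)) := by
      rw [damped, Matrix.mul_assoc, Matrix.sub_mul, one_mul, Matrix.smul_mul, hWP, Matrix.mul_sub,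
        hP, Matrix.mul_smul]
    have h2 : Pm * damped W γ = Pm - γ • (Pm * (1 - W)) := by
      rw [damped, Matrix.mul_sub, mul_one, Matrix.mul_smul]
    rw [mix_mix, h1, h2, gossip]
    simp only [mix_add, mix_sub, mix_smul, sub_mix, smul_mix, mix_mix, Matrix.mul_sub, mul_one]
    module
  have h1 := hT.contraction.nrm_mix_le hq (mix Pm U)
  have h2 := (hT.contraction.nrm_mix_le hq D).trans
    (mul_le_mul_of_nonneg_left (hT.nrm_le hδ D) hq)
  have h3 := (hT.norm_proj.nrm_mix_le zero_le_one (mix (1 - W) E))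
  have h4 := (hT.norm_one_sub.nrm_mix_le (by norm_num) E)
  have h5 := hT.nrm_le hδ E
  have h6 : nrm T (mix Pm (gossip W γ (U + D) E)) ≤ (1 - θ * γ) * nrm T (mix Pm U)
      + ((1 - θ * γ) * (δ * nrm 1 D) + γ * (3 * (δ * nrm 1 E))) := by
    rw [e]
    refine (nrm_add_le _ _ _).trans (add_le_add h1 ((nrm_sub_le _ _ _).trans (add_le_add h2 ?_)))
    rw [nrm_smul, abs_of_pos hγ]
    exact mul_le_mul_of_nonneg_left (by linarith) hγ.le
  refine (pow_le_pow_left₀ (nrm_nonneg _ _) h6 2).trans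
    ((sq_convex_le rfl hq (mul_pos hT.theta_pos hγ)).trans (le_of_eq ?_))
  ring

/-- The gossip correction alone, `-γ (1 - W) (U + D + E)`, where `1 - W` annihilates the consensus
part of `U`. It is the drift of the compression target after compression; its full factor `γ²` is
what lets the consensus error absorb it. -/
lemma IsAdaptedNorm.gossip_sub_pre (hT : IsAdaptedNorm W Pm T δ θ γ)
    (hWP : (1 - W) * Pm = 1 - W) (hγ : 0 < γ) (U D E : Stack n p) :
    nrm 1 (gossip W γ (U + D) E - (U + D)) ^ 2 ≤ 27 * γ ^ 2 *
      (nrm T (mix Pm U) ^ 2 + δ ^ 2 * nrm 1 D ^ 2 + δ ^ 2 * nrm 1 E ^ 2) := by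
  have hδ : 0 ≤ δ := zero_le_one.trans hT.one_le_upper
  have e : gossip W γ (U + D) E - (U + D)
      = (-γ) • mix (1 - W) (mix Pm U + D + E) := by
    have h1 : mix (1 - W) (mix Pm U) = mix (1 - W) U := by rw [mix_mix, hWP]
    rw [gossip]
    simp only [mix_add, h1]
    module
  have h1 : nrm 1 (gossip W γ (U + D) E - (U + D)) ≤ 3 * γ * nrm T (mix Pm U)
      + 3 * γ * (δ * nrm 1 D) + 3 * γ * (δ * nrm 1 E) := by
    rw [e, nrm_smul, abs_neg, abs_of_pos hγ]
    have h2 := (hT.nrm_one_le _).trans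
      (hT.norm_one_sub.nrm_mix_le (by norm_num) (mix Pm U + D + E))
    have h3 := (nrm_add_le T (mix Pm U + D) E).trans
      (add_le_add (nrm_add_le T (mix Pm U) D) le_rfl)
    have h4 := hT.nrm_le hδ D
    have h5 := hT.nrm_le hδ E
    have := mul_le_mul_of_nonneg_left (h2.trans (mul_le_mul_of_nonneg_left
      (h3.trans (add_le_add (add_le_add le_rfl h4) h5)) (by norm_num))) hγ.le
    linarith
  refine (sq_le_three_of_le (nrm_nonneg _ _) h1).trans (le_of_eq ?_)
  ring

/-- The total move, including `D`; for the decision variables it controls the change of the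
gradients, which is the perturbation of the trackers. Here `D` enters through `W_γ D` and carries no
factor `γ`. -/
lemma IsAdaptedNorm.gossip_sub (hT : IsAdaptedNorm W Pm T δ θ γ)
    (hWP : (1 - W) * Pm = 1 - W) (hγ : 0 < γ) (U D E : Stack n p) :
    nrm 1 (gossip W γ (U + D) E - U) ^ 2 ≤ 27 * γ ^ 2 * nrm T (mix Pm U) ^ 2
      + 12 * δ ^ 2 * nrm 1 D ^ 2 + 27 * γ ^ 2 * δ ^ 2 * nrm 1 E ^ 2 := by
  have hδ : 0 ≤ δ := zero_le_one.trans hT.one_le_upper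
  have e : gossip W γ (U + D) E - U
      = (-γ) • mix (1 - W) (mix Pm U) + mix (damped W γ) D + (-γ) • mix (1 - W) E := by
    have h1 : mix (1 - W) (mix Pm U) = mix (1 - W) U := by rw [mix_mix, hWP]
    rw [gossip, h1, damped]
    simp only [mix_add, sub_mix, smul_mix, mix_one]
    module
  have h1 : nrm 1 (gossip W γ (U + D) E - U) ≤ 3 * γ * nrm T (mix Pm U)
      + 2 * (δ * nrm 1 D) + 3 * γ * (δ * nrm 1 E) := by
    rw [e]
    refine (hT.nrm_one_le _).trans ((nrm_add_le _ _ _).trans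
      (add_le_add ((nrm_add_le _ _ _).trans (add_le_add ?_ ?_)) ?_))
    · rw [nrm_smul, abs_neg, abs_of_pos hγ]
      have := mul_le_mul_of_nonneg_left
        (hT.norm_one_sub.nrm_mix_le (by norm_num) (mix Pm U)) hγ.le
      linarith
    · refine (hT.norm_damped.nrm_mix_le (by norm_num) D).trans ?_
      linarith [hT.nrm_le hδ D]
    · rw [nrm_smul, abs_neg, abs_of_pos hγ]
      have := mul_le_mul_of_nonneg_left ((hT.norm_one_sub.nrm_mix_le (by norm_num) E).trans
        (mul_le_mul_of_nonneg_left (hT.nrm_le hδ E) (by norm_num))) hγ.le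
      linarith
  refine (sq_le_three_of_le (nrm_nonneg _ _) h1).trans (le_of_eq ?_)
  ring

end

lemma nrm_sub_sq_le {t : ℝ} (ht : 0 < t) (ht1 : t ≤ 1) (X Y Z : Stack n p) :
    nrm 1 (X - Z) ^ 2 ≤ (1 + t / 4) * nrm 1 (Y - Z) ^ 2 + 5 / t * nrm 1 (X - Y) ^ 2 := by
  refine sq_add_le_of_le ht ht1 (nrm_nonneg _ _) ?_
  rw [← sub_add_sub_cancel' Y Z X]
  exact nrm_add_le _ _ _

lemma nrm_sub_sq_le_two (X Y Z : Stack n p) :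
    nrm 1 (X - Z) ^ 2 ≤ 2 * nrm 1 (Y - Z) ^ 2 + 2 * nrm 1 (X - Y) ^ 2 := by
  have h : nrm 1 (X - Z) ≤ nrm 1 (Y - Z) + nrm 1 (X - Y) := by
    rw [← sub_add_sub_cancel' Y Z X]
    exact nrm_add_le _ _ _
  nlinarith [pow_le_pow_left₀ (nrm_nonneg _ _) h 2, sq_nonneg (nrm 1 (Y - Z) - nrm 1 (X - Y))]

end Gossip

/-! ### Smoothness and the descent of the objective -/

section Objective

variable {n p : ℕ}

open scoped InnerProductSpace

/-- The descent lemma for functions with Lipschitz gradient. -/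
lemma le_quadratic_of_lipschitz_gradient {g : Vec p → ℝ} {L : ℝ} (hg : Differentiable ℝ g)
    (hL : ∀ x y, ‖gradient g x - gradient g y‖ ≤ L * ‖x - y‖) (x d : Vec p) :
    g (x + d) ≤ g x + ⟪gradient g x, d⟫_ℝ + L / 2 * ‖d‖ ^ 2 := by
  have hline : ∀ t : ℝ, HasDerivAt (fun t : ℝ => x + t • d) d t := fun t => by
    simpa using ((hasDerivAt_id t).smul_const d).const_add x
  have hderiv : ∀ t : ℝ, HasDerivAt (fun t : ℝ => g (x + t • d)
      - t * ⟪gradient g x, d⟫_ℝ - L / 2 * ‖d‖ ^ 2 * t ^ 2)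
      (⟪gradient g (x + t • d), d⟫_ℝ - ⟪gradient g x, d⟫_ℝ - L * ‖d‖ ^ 2 * t) t := by
    intro t
    have h1 : HasDerivAt (fun t : ℝ => g (x + t • d)) ⟪gradient g (x + t • d), d⟫_ℝ t := by
      have := ((hg (x + t • d)).hasFDerivAt).comp_hasDerivAt t (hline t)
      rwa [← toDual_gradient, InnerProductSpace.toDual_apply_apply] at this
    have h2 := (h1.sub ((hasDerivAt_id t).mul_const ⟪gradient g x, d⟫_ℝ)).sub
      ((hasDerivAt_pow 2 t).const_mul (L / 2 * ‖d‖ ^ 2))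
    refine h2.congr_deriv ?_
    push_cast
    ring
  -- Along the segment, `g` minus its quadratic model has derivative at most zero by the Lipschitz
  -- bound; the claim compares the values at `0` and `1`.
  have hanti : AntitoneOn (fun t : ℝ => g (x + t • d)
      - t * ⟪gradient g x, d⟫_ℝ - L / 2 * ‖d‖ ^ 2 * t ^ 2) (Set.Icc 0 1) := by
    refine antitoneOn_of_hasDerivWithinAt_nonpos (convex_Icc 0 1)
      (fun t _ => (hderiv t).continuousAt.continuousWithinAt)
      (fun t _ => (hderiv t).hasDerivWithinAt) fun t ht => ?_
    rw [interior_Icc] at ht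
    rw [← inner_sub_left]
    have h1 := real_inner_le_norm (gradient g (x + t • d) - gradient g x) d
    have h2 := hL (x + t • d) x
    rw [add_sub_cancel_left, norm_smul, Real.norm_eq_abs, abs_of_pos ht.1] at h2
    nlinarith [mul_le_mul_of_nonneg_right h2 (norm_nonneg d)]
  have := hanti (Set.left_mem_Icc.2 zero_le_one) (Set.right_mem_Icc.2 zero_le_one) zero_le_one
  simp only [one_smul, zero_smul, add_zero, one_mul, zero_mul, one_pow, mul_one, sub_zero,
    ne_eq, OfNat.ofNat_ne_zero, not_false_eq_true, zero_pow, mul_zero] at this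
  linarith

lemma hasGradientAt_avgObj {f : Fin n → Vec p → ℝ} (hf : ∀ i, Differentiable ℝ (f i)) (x : Vec p) :
    HasGradientAt (avgObj f) ((1 / (n : ℝ)) • ∑ i, gradient (f i) x) x := by
  rw [hasGradientAt_iff_hasFDerivAt]
  have h : HasFDerivAt (fun x => ∑ i, f i x) (∑ i, fderiv ℝ (f i) x) x :=
    HasFDerivAt.fun_sum fun i _ => (hf i x).hasFDerivAt
  have h2 := h.const_mul (1 / (n : ℝ))
  have e : (InnerProductSpace.toDual ℝ (Vec p)) ((1 / (n : ℝ)) • ∑ i, gradient (f i) x)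
      = (1 / (n : ℝ)) • ∑ i, fderiv ℝ (f i) x := by
    rw [map_smul, map_sum]
    simp [toDual_gradient]
  rw [e]
  exact h2

lemma gradient_avgObj {f : Fin n → Vec p → ℝ} (hf : ∀ i, Differentiable ℝ (f i)) (x : Vec p) :
    gradient (avgObj f) x = (1 / (n : ℝ)) • ∑ i, gradient (f i) x :=
  (hasGradientAt_avgObj hf x).gradient

lemma differentiable_avgObj {f : Fin n → Vec p → ℝ} (hf : ∀ i, Differentiable ℝ (f i)) :
    Differentiable ℝ (avgObj f) :=
  fun x => (hasGradientAt_avgObj hf x).differentiableAt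

lemma norm_gradient_avgObj_sub_le [NeZero n] {f : Fin n → Vec p → ℝ}
    (hf : ∀ i, Differentiable ℝ (f i)) {L : ℝ}
    (hL : ∀ i x y, ‖gradient (f i) x - gradient (f i) y‖ ≤ L * ‖x - y‖) (x y : Vec p) :
    ‖gradient (avgObj f) x - gradient (avgObj f) y‖ ≤ L * ‖x - y‖ := by
  have hn : (0 : ℝ) < n := by exact_mod_cast Nat.pos_of_neZero n
  rw [gradient_avgObj hf, gradient_avgObj hf, ← smul_sub, ← Finset.sum_sub_distrib, norm_smul,
    Real.norm_of_nonneg (by positivity)]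
  have h : ‖∑ i, (gradient (f i) x - gradient (f i) y)‖ ≤ ∑ _i : Fin n, L * ‖x - y‖ :=
    norm_sum_le_of_le _ fun i _ => hL i x y
  rw [Finset.sum_const, Finset.card_univ, Fintype.card_fin, nsmul_eq_mul] at h
  calc 1 / (n : ℝ) * _ ≤ 1 / (n : ℝ) * (n * (L * ‖x - y‖)) := by gcongr
    _ = _ := by field_simp

/-- The suboptimality is at most quadratic in the distance to the minimizer. -/
lemma avgObj_sub_min_le [NeZero n] {f : Fin n → Vec p → ℝ}
    (hf : ∀ i, Differentiable ℝ (f i)) {L : ℝ}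
    (hL : ∀ i x y, ‖gradient (f i) x - gradient (f i) y‖ ≤ L * ‖x - y‖) {xs : Vec p}
    (hmin : ∀ x, avgObj f xs ≤ avgObj f x) (x : Vec p) :
    avgObj f x - avgObj f xs ≤ L / 2 * ‖x - xs‖ ^ 2 := by
  have h0 : gradient (avgObj f) xs = 0 := by
    have : IsLocalMin (avgObj f) xs := Filter.Eventually.of_forall hmin
    rw [gradient, this.fderiv_eq_zero, map_zero]
  have := le_quadratic_of_lipschitz_gradient (differentiable_avgObj hf)
    (norm_gradient_avgObj_sub_le hf hL) xs (x - xs)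
  rw [add_sub_cancel, h0, inner_zero_left] at this
  linarith

lemma mix_projR_apply (u : EuclideanSpace ℝ (Fin n)) (X : Stack n p) (i : Fin n) :
    mix (projR u) X i = X i - wavg u X := by
  have h : mix (1 : Matrix (Fin n) (Fin n) ℝ) X i = X i := by rw [mix_one]
  rw [projR, sub_mix, Pi.sub_apply, h, wavg, Finset.smul_sum]
  simp only [mix, Matrix.of_apply, smul_smul]
  congr 1
  exact Finset.sum_congr rfl fun j _ => by congr 1; ring

lemma mix_projC_apply (u : EuclideanSpace ℝ (Fin n)) (Y : Stack n p) (i : Fin n) :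
    mix (projC u) Y i = Y i - u i • ((1 / (n : ℝ)) • ∑ j, Y j) := by
  have h : mix (1 : Matrix (Fin n) (Fin n) ℝ) Y i = Y i := by rw [mix_one]
  rw [projC, sub_mix, Pi.sub_apply, h]
  simp only [mix, Matrix.of_apply, smul_smul, Finset.smul_sum]
  congr 1
  exact Finset.sum_congr rfl fun j _ => by congr 1; ring

lemma norm_mean_sq_le [NeZero n] (Z : Stack n p) :
    ‖(1 / (n : ℝ)) • ∑ i, Z i‖ ^ 2 ≤ 1 / (n : ℝ) * ∑ i, ‖Z i‖ ^ 2 := by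
  have hn : (0 : ℝ) < n := by exact_mod_cast Nat.pos_of_neZero n
  rw [norm_smul, Real.norm_of_nonneg (by positivity), mul_pow]
  have h1 : ‖∑ i, Z i‖ ^ 2 ≤ (∑ i, ‖Z i‖) ^ 2 :=
    pow_le_pow_left₀ (norm_nonneg _) (norm_sum_le _ _) 2
  have h2 := sq_sum_le_card_mul_sum_sq (s := (Finset.univ : Finset (Fin n))) (f := fun i => ‖Z i‖)
  rw [Finset.card_univ, Fintype.card_fin] at h2
  calc (1 / (n : ℝ)) ^ 2 * _ ≤ (1 / (n : ℝ)) ^ 2 * (n * ∑ i, ‖Z i‖ ^ 2) := by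
        gcongr; exact h1.trans h2
    _ = _ := by field_simp

/-- The averaged local gradient is close to the gradient at the weighted average. -/
lemma norm_gradient_sub_mean_sq_le [NeZero n] {f : Fin n → Vec p → ℝ}
    (hf : ∀ i, Differentiable ℝ (f i)) {L : ℝ}
    (hL : ∀ i x y, ‖gradient (f i) x - gradient (f i) y‖ ≤ L * ‖x - y‖)
    (u : EuclideanSpace ℝ (Fin n)) (X : Stack n p) :
    ‖gradient (avgObj f) (wavg u X) - (1 / (n : ℝ)) • ∑ i, gradF f X i‖ ^ 2
      ≤ L ^ 2 / n * nrm 1 (mix (projR u) X) ^ 2 := by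
  rw [gradient_avgObj hf, ← smul_sub, ← Finset.sum_sub_distrib]
  refine (norm_mean_sq_le fun i => gradient (f i) (wavg u X) - gradF f X i).trans ?_
  rw [nrm_one_sq]
  calc _ ≤ 1 / (n : ℝ) * ∑ i, L ^ 2 * ‖mix (projR u) X i‖ ^ 2 := by
        gcongr with i _
        rw [mix_projR_apply, ← mul_pow, norm_sub_rev (X i)]
        exact pow_le_pow_left₀ (norm_nonneg _) (hL i _ _) 2
    _ = _ := by rw [← Finset.mul_sum]; ring

lemma norm_sum_smul_sq_le (u : EuclideanSpace ℝ (Fin n)) (lam : Fin n → ℝ) {l : ℝ}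
    (h0 : ∀ i, 0 ≤ lam i) (hl : ∀ i, lam i ≤ l) (Z : Stack n p) :
    ‖∑ i, (u i * lam i) • Z i‖ ^ 2 ≤ l ^ 2 * ‖u‖ ^ 2 * nrm 1 Z ^ 2 := by
  have h1 : ‖∑ i, (u i * lam i) • Z i‖ ≤ ∑ i, |u i * lam i| * ‖Z i‖ := by
    refine (norm_sum_le _ _).trans (le_of_eq (Finset.sum_congr rfl fun i _ => ?_))
    rw [norm_smul, Real.norm_eq_abs]
  have h2 := Finset.sum_mul_sq_le_sq_mul_sq Finset.univ (fun i => |u i * lam i|) fun i => ‖Z i‖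
  refine (pow_le_pow_left₀ (norm_nonneg _) h1 2).trans (h2.trans ?_)
  rw [nrm_one_sq]
  refine mul_le_mul_of_nonneg_right ?_ (Finset.sum_nonneg fun _ _ => sq_nonneg _)
  rw [EuclideanSpace.norm_sq_eq, Finset.mul_sum]
  refine Finset.sum_le_sum fun i _ => ?_
  have : lam i ^ 2 ≤ l ^ 2 := pow_le_pow_left₀ (h0 i) (hl i) 2
  rw [sq_abs, mul_pow, Real.norm_eq_abs, sq_abs, mul_comm]
  exact mul_le_mul_of_nonneg_right this (sq_nonneg _)

/-- The averaged update direction consists of the mean gradient and the tracking error. -/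
lemma mean_step_eq (uR uC : EuclideanSpace ℝ (Fin n)) (lam : Fin n → ℝ) (Y : Stack n p) :
    (1 / (n : ℝ)) • ∑ i, (uR i * lam i) • Y i
      = avgStep uR uC lam • ((1 / (n : ℝ)) • ∑ j, Y j)
        + (1 / (n : ℝ)) • ∑ i, (uR i * lam i) • mix (projC uC) Y i := by
  set m := (1 / (n : ℝ)) • ∑ j, Y j with hm
  have h : ∀ i, (uR i * lam i) • mix (projC uC) Y i
      = (uR i * lam i) • Y i - (uR i * lam i * uC i) • m := fun i => by
    rw [mix_projC_apply, smul_sub, smul_smul]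
  simp only [h, Finset.sum_sub_distrib, ← Finset.sum_smul, avgStep]
  module

/-- Descent of the objective at the weighted average under the Polyak–Łojasiewicz condition. -/
lemma objective_descent [NeZero n] {f : Fin n → Vec p → ℝ} (hf : ∀ i, Differentiable ℝ (f i))
    {L : ℝ} (hL : ∀ i x y, ‖gradient (f i) x - gradient (f i) y‖ ≤ L * ‖x - y‖)
    {xs : Vec p} {μ : ℝ} (hPL : PLCondition (avgObj f) xs μ)
    (hmin : ∀ x, avgObj f xs ≤ avgObj f x)
    (uR uC : EuclideanSpace ℝ (Fin n)) {lam : Fin n → ℝ} {l M : ℝ} (h0 : ∀ i, 0 ≤ lam i)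
    (hl : ∀ i, lam i ≤ l) (hlpos : 0 < l) (hM : 0 < M) (hMl : M * l ≤ avgStep uR uC lam)
    (hstep : avgStep uR uC lam * L ≤ 1) {X Y : Stack n p} (hY : ∑ i, Y i = ∑ i, gradF f X i) :
    avgObj f (wavg uR X - (1 / (n : ℝ)) • ∑ i, (uR i * lam i) • Y i) - avgObj f xs
      ≤ (1 - 1 / 2 * M * l * μ) * (avgObj f (wavg uR X) - avgObj f xs)
        - M * l / 4 * ‖gradient (avgObj f) (wavg uR X)‖ ^ 2
        + avgStep uR uC lam * (L ^ 2 / n) * nrm 1 (mix (projR uR) X) ^ 2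
        + l * (‖uR‖ ^ 2 / (n ^ 2 * M)) * nrm 1 (mix (projC uC) Y) ^ 2 := by
  have hn : (0 : ℝ) < n := by exact_mod_cast Nat.pos_of_neZero n
  set b := avgStep uR uC lam with hb
  have hbpos : 0 < b := lt_of_lt_of_le (mul_pos hM hlpos) hMl
  set x := wavg uR X
  set G := gradient (avgObj f) x
  set m := (1 / (n : ℝ)) • ∑ i, gradF f X i with hm
  set e := (1 / (n : ℝ)) • ∑ i, (uR i * lam i) • mix (projC uC) Y i with he
  have hs : (1 / (n : ℝ)) • ∑ i, (uR i * lam i) • Y i = b • m + e := by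
    rw [mean_step_eq uR uC, hY]
  rw [hs]
  have h1 := le_quadratic_of_lipschitz_gradient (differentiable_avgObj hf)
    (norm_gradient_avgObj_sub_le hf hL) x (-(b • m + e))
  rw [norm_neg, inner_neg_right, ← sub_eq_add_neg] at h1
  change _ ≤ _ + -⟪G, b • m + e⟫_ℝ + _ at h1
  have h2 : ‖b • (G - m) - e‖ ^ 2
      = b ^ 2 * ‖G‖ ^ 2 - 2 * b * ⟪G, b • m + e⟫_ℝ + ‖b • m + e‖ ^ 2 := by
    have : b • (G - m) - e = b • G - (b • m + e) := by module
    rw [this, norm_sub_sq_real, norm_smul, mul_pow, Real.norm_eq_abs, sq_abs, real_inner_smul_left]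
    ring
  have h3 : ‖b • (G - m) - e‖ ^ 2 ≤ 2 * (b ^ 2 * ‖G - m‖ ^ 2) + 2 * ‖e‖ ^ 2 := by
    have := pow_le_pow_left₀ (norm_nonneg _) (norm_sub_le (b • (G - m)) e) 2
    rw [norm_smul, Real.norm_eq_abs, abs_of_pos hbpos] at this
    nlinarith [sq_nonneg (b * ‖G - m‖ - ‖e‖)]
  have h4 : ‖G - m‖ ^ 2 ≤ L ^ 2 / n * nrm 1 (mix (projR uR) X) ^ 2 :=
    norm_gradient_sub_mean_sq_le hf hL uR X
  have h5 : ‖e‖ ^ 2 ≤ l ^ 2 * ‖uR‖ ^ 2 / n ^ 2 * nrm 1 (mix (projC uC) Y) ^ 2 := by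
    rw [he, norm_smul, Real.norm_of_nonneg (by positivity), mul_pow]
    have := norm_sum_smul_sq_le uR lam h0 hl (mix (projC uC) Y)
    refine (mul_le_mul_of_nonneg_left this (sq_nonneg (1 / (n : ℝ)))).trans (le_of_eq ?_)
    ring
  -- the inner product through the polarization identity
  have h6 : -⟪G, b • m + e⟫_ℝ + L / 2 * ‖b • m + e‖ ^ 2
      ≤ -(b / 2) * ‖G‖ ^ 2 + b * ‖G - m‖ ^ 2 + ‖e‖ ^ 2 / b := by
    have e1 : ⟪G, b • m + e⟫_ℝ
        = (b ^ 2 * ‖G‖ ^ 2 + ‖b • m + e‖ ^ 2 - ‖b • (G - m) - e‖ ^ 2) / (2 * b) := by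
      rw [h2]; field_simp; ring
    -- This is where `b L ≤ 1` enters: the second-order term is cancelled by the square of the step
    -- in the polarization identity.
    have e2 : L / 2 * ‖b • m + e‖ ^ 2 ≤ ‖b • m + e‖ ^ 2 / (2 * b) := by
      rw [le_div_iff₀ (by positivity)]
      nlinarith [sq_nonneg ‖b • m + e‖]
    have e3 : ‖b • (G - m) - e‖ ^ 2 / (2 * b) ≤ b * ‖G - m‖ ^ 2 + ‖e‖ ^ 2 / b := by
      rw [div_le_iff₀ (by positivity)]
      refine h3.trans (le_of_eq ?_)
      field_simp
    have e4 : -((b ^ 2 * ‖G‖ ^ 2 + ‖b • m + e‖ ^ 2 - ‖b • (G - m) - e‖ ^ 2) / (2 * b))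
        = -(b / 2) * ‖G‖ ^ 2 - ‖b • m + e‖ ^ 2 / (2 * b) + ‖b • (G - m) - e‖ ^ 2 / (2 * b) := by
      field_simp; ring
    rw [e1, e4]
    linarith
  have h7 : ‖e‖ ^ 2 / b ≤ l * (‖uR‖ ^ 2 / (n ^ 2 * M)) * nrm 1 (mix (projC uC) Y) ^ 2 := by
    calc ‖e‖ ^ 2 / b ≤ (l ^ 2 * ‖uR‖ ^ 2 / n ^ 2 * nrm 1 (mix (projC uC) Y) ^ 2) / (M * l) := by
          gcongr
      _ = _ := by field_simp
  have h8 := hPL.2 x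
  have h9 : 0 ≤ avgObj f x - avgObj f xs := sub_nonneg.2 (hmin x)
  have h10 := mul_le_mul_of_nonneg_left h4 hbpos.le
  -- Half of the gradient term yields the linear contraction through Polyak–Łojasiewicz. The other
  -- half is kept to absorb the gradient contained in the size of the local updates.
  have h11 : -(b / 2) * ‖G‖ ^ 2
      ≤ -(1 / 2 * M * l * μ) * (avgObj f x - avgObj f xs) - M * l / 4 * ‖G‖ ^ 2 := by
    have e1 : -(b / 2) * ‖G‖ ^ 2 ≤ -(M * l / 2) * ‖G‖ ^ 2 := by
      apply mul_le_mul_of_nonneg_right _ (sq_nonneg _); linarith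
    have e2 := mul_le_mul_of_nonneg_left h8 (show 0 ≤ M * l / 4 by positivity)
    linarith
  linarith

/-- The size of the update in terms of tracking error, gradient and consensus error. -/
lemma nrm_update_sq_le [NeZero n] {f : Fin n → Vec p → ℝ} (hf : ∀ i, Differentiable ℝ (f i))
    {L : ℝ} (hL : ∀ i x y, ‖gradient (f i) x - gradient (f i) y‖ ≤ L * ‖x - y‖)
    (uR uC : EuclideanSpace ℝ (Fin n)) {lam : Fin n → ℝ} {l : ℝ} (h0 : ∀ i, 0 ≤ lam i)
    (hl : ∀ i, lam i ≤ l) {X Y : Stack n p} (hY : ∑ i, Y i = ∑ i, gradF f X i) :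
    nrm 1 (fun i => lam i • Y i) ^ 2 ≤ l ^ 2 * (2 * nrm 1 (mix (projC uC) Y) ^ 2
      + 4 * ‖uC‖ ^ 2 * ‖gradient (avgObj f) (wavg uR X)‖ ^ 2
      + 4 * ‖uC‖ ^ 2 * (L ^ 2 / n) * nrm 1 (mix (projR uR) X) ^ 2) := by
  set m := (1 / (n : ℝ)) • ∑ i, gradF f X i with hm
  set G := gradient (avgObj f) (wavg uR X)
  have h4 : ‖G - m‖ ^ 2 ≤ L ^ 2 / n * nrm 1 (mix (projR uR) X) ^ 2 :=
    norm_gradient_sub_mean_sq_le hf hL uR X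
  have h5 : ‖m‖ ^ 2 ≤ 2 * ‖G‖ ^ 2 + 2 * ‖G - m‖ ^ 2 := by
    have : ‖m‖ ≤ ‖G‖ + ‖G - m‖ := by
      calc ‖m‖ = ‖G - (G - m)‖ := by rw [sub_sub_cancel]
        _ ≤ _ := norm_sub_le _ _
    nlinarith [pow_le_pow_left₀ (norm_nonneg _) this 2, sq_nonneg (‖G‖ - ‖G - m‖)]
  have h6 : ∀ i, ‖lam i • Y i‖ ^ 2
      ≤ l ^ 2 * (2 * ‖mix (projC uC) Y i‖ ^ 2 + 2 * (‖uC i‖ ^ 2 * ‖m‖ ^ 2)) := by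
    intro i
    have e1 : Y i = mix (projC uC) Y i + uC i • m := by
      rw [mix_projC_apply, hY, ← hm, sub_add_cancel]
    have e2 : ‖Y i‖ ≤ ‖mix (projC uC) Y i‖ + ‖uC i‖ * ‖m‖ := by
      rw [← norm_smul]
      calc ‖Y i‖ = ‖mix (projC uC) Y i + uC i • m‖ := by rw [← e1]
        _ ≤ _ := norm_add_le _ _
    have e3 := pow_le_pow_left₀ (norm_nonneg _) e2 2
    rw [norm_smul, mul_pow, Real.norm_eq_abs, abs_of_nonneg (h0 i)]
    refine mul_le_mul (pow_le_pow_left₀ (h0 i) (hl i) 2) ?_ (sq_nonneg _) (sq_nonneg _)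
    nlinarith [sq_nonneg (‖mix (projC uC) Y i‖ - ‖uC i‖ * ‖m‖)]
  have h7 : nrm 1 (fun i => lam i • Y i) ^ 2
      ≤ l ^ 2 * (2 * nrm 1 (mix (projC uC) Y) ^ 2 + 2 * (‖uC‖ ^ 2 * ‖m‖ ^ 2)) := by
    rw [nrm_one_sq, nrm_one_sq, EuclideanSpace.norm_sq_eq]
    refine (Finset.sum_le_sum fun i _ => h6 i).trans (le_of_eq ?_)
    rw [← Finset.mul_sum, Finset.sum_add_distrib, ← Finset.mul_sum, ← Finset.mul_sum,
      Finset.sum_mul]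
  refine h7.trans (mul_le_mul_of_nonneg_left ?_ (sq_nonneg _))
  nlinarith [mul_le_mul_of_nonneg_left (h5.trans (add_le_add le_rfl
    (mul_le_mul_of_nonneg_left h4 two_pos.le))) (sq_nonneg ‖uC‖)]

lemma nrm_gradF_sub_sq_le {f : Fin n → Vec p → ℝ} {L : ℝ}
    (hL : ∀ i x y, ‖gradient (f i) x - gradient (f i) y‖ ≤ L * ‖x - y‖) (X X' : Stack n p) :
    nrm 1 (gradF f X' - gradF f X) ^ 2 ≤ L ^ 2 * nrm 1 (X' - X) ^ 2 := by
  rw [nrm_one_sq, nrm_one_sq, Finset.mul_sum]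
  refine Finset.sum_le_sum fun i _ => ?_
  rw [← mul_pow]
  exact pow_le_pow_left₀ (norm_nonneg _) (hL i _ _) 2

end Objective

/-! ### Compression of random stacks -/

section Probability

variable {n p : ℕ} {Ξ Ω : Type*} [MeasurableSpace Ξ]

/-- Square integrability of a random stack. -/
def SqInt [MeasurableSpace Ω] (P : Measure Ω) (F : Ω → Stack n p) : Prop :=
  ∀ i, MemLp (fun ω => F ω i) 2 P

lemma measurable_mix {m : MeasurableSpace Ω} (W : Matrix (Fin n) (Fin n) ℝ) {F : Ω → Stack n p}
    (hF : Measurable F) : Measurable fun ω => mix W (F ω) := by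
  rw [measurable_pi_iff] at hF ⊢
  intro i
  exact Finset.measurable_fun_sum _ fun j _ => (hF j).const_smul (W i j)

lemma measurable_gossip {m : MeasurableSpace Ω} (W : Matrix (Fin n) (Fin n) ℝ) (γ : ℝ)
    {F G : Ω → Stack n p} (hF : Measurable F) (hG : Measurable G) :
    Measurable fun ω => gossip W γ (F ω) (G ω) :=
  hF.sub ((measurable_mix (1 - W) (hF.add hG)).const_smul γ)

lemma measurable_scaledCompress {m : MeasurableSpace Ω} {comp : Ξ → Vec p → Vec p}
    (hcomp : Measurable (Function.uncurry comp)) (s : ℝ) {ζ : Fin n → Ω → Ξ}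
    (hζ : ∀ i, Measurable (ζ i)) {Z : Ω → Stack n p} (hZ : Measurable Z) :
    Measurable fun ω => scaledCompress s (fun i => comp (ζ i ω)) (Z ω) := by
  rw [measurable_pi_iff] at hZ ⊢
  intro i
  exact (hcomp.comp ((hζ i).prodMk ((hZ i).const_smul (1 / s)))).const_smul s

section SqInt

variable [MeasurableSpace Ω] {P : Measure Ω}

lemma SqInt.add {F G : Ω → Stack n p} (hF : SqInt P F) (hG : SqInt P G) :
    SqInt P fun ω => F ω + G ω := fun i => (hF i).add (hG i)

lemma SqInt.sub {F G : Ω → Stack n p} (hF : SqInt P F) (hG : SqInt P G) :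
    SqInt P fun ω => F ω - G ω := fun i => (hF i).sub (hG i)

lemma SqInt.const_smul {F : Ω → Stack n p} (hF : SqInt P F) (a : ℝ) :
    SqInt P fun ω => a • F ω := fun i => (hF i).const_smul a

lemma SqInt.mix {F : Ω → Stack n p} (hF : SqInt P F) (W : Matrix (Fin n) (Fin n) ℝ) :
    SqInt P fun ω => mix W (F ω) := fun i =>
  memLp_finsetSum _ fun j _ => (hF j).const_smul (W i j)

lemma SqInt.gossip {F G : Ω → Stack n p} (hF : SqInt P F) (hG : SqInt P G)
    (W : Matrix (Fin n) (Fin n) ℝ) (γ : ℝ) : SqInt P fun ω => gossip W γ (F ω) (G ω) :=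
  hF.sub (((hF.add hG).mix (1 - W)).const_smul γ)

lemma SqInt.integrable_nrm_sq {F : Ω → Stack n p} (hF : SqInt P F)
    (T : Matrix (Fin n) (Fin n) ℝ) : Integrable (fun ω => nrm T (F ω) ^ 2) P := by
  simp only [nrm_sq, wsq]
  exact integrable_finsetSum _ fun i _ => (hF.mix T i).integrable_norm_pow two_ne_zero

lemma SqInt.wavg [IsFiniteMeasure P] {F : Ω → Stack n p} (hF : SqInt P F)
    (u : EuclideanSpace ℝ (Fin n)) : MemLp (fun ω => wavg u (F ω)) 2 P :=
  (memLp_finsetSum _ fun i _ => (hF i).const_smul (u i)).const_smul (1 / (n : ℝ))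

/-- A Lipschitz gradient grows at most linearly, so it preserves square integrability on a finite
measure space. -/
lemma memLp_gradient [IsFiniteMeasure P] {g : Vec p → ℝ} {L : ℝ}
    (hL : ∀ x y, ‖gradient g x - gradient g y‖ ≤ L * ‖x - y‖) {F : Ω → Vec p}
    (hF : MemLp F 2 P) : MemLp (fun ω => gradient g (F ω)) 2 P := by
  have hc : Continuous (gradient g) := by
    refine (LipschitzWith.of_dist_le_mul (K := Real.toNNReal L) fun x y => ?_).continuous
    rw [dist_eq_norm, dist_eq_norm]
    exact (hL x y).trans (mul_le_mul_of_nonneg_right (Real.le_coe_toNNReal L) (norm_nonneg _))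
  have h0 : MemLp (fun ω => L * ‖F ω‖ + ‖gradient g 0‖) 2 P :=
    (hF.norm.const_mul L).add (memLp_const _)
  refine h0.mono' (hc.comp_aestronglyMeasurable hF.1) (Eventually.of_forall fun ω => ?_)
  have h1 := hL (F ω) 0
  rw [sub_zero] at h1
  linarith [norm_le_norm_sub_add (gradient g (F ω)) (gradient g 0)]

lemma SqInt.gradF [IsFiniteMeasure P] {f : Fin n → Vec p → ℝ} {L : ℝ}
    (hL : ∀ i x y, ‖gradient (f i) x - gradient (f i) y‖ ≤ L * ‖x - y‖) {F : Ω → Stack n p}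
    (hF : SqInt P F) : SqInt P fun ω => gradF f (F ω) :=
  fun i => memLp_gradient (hL i) (hF i)

end SqInt

variable {ν : Measure Ξ} [MeasurableSpace Ω] {P : Measure Ω}

lemma integral_le_two {f f₁ f₂ : Ω → ℝ} (h : Integrable f P) (h₁ : Integrable f₁ P)
    (h₂ : Integrable f₂ P) {a b : ℝ} (hle : ∀ ω, f ω ≤ a * f₁ ω + b * f₂ ω) :
    ∫ ω, f ω ∂P ≤ a * ∫ ω, f₁ ω ∂P + b * ∫ ω, f₂ ω ∂P := by
  refine (integral_mono h ((h₁.const_mul a).add (h₂.const_mul b)) hle).trans (le_of_eq ?_)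
  rw [← integral_const_mul, ← integral_const_mul]
  exact integral_add (h₁.const_mul a) (h₂.const_mul b)

lemma integral_le_three {f f₁ f₂ f₃ : Ω → ℝ} (h : Integrable f P) (h₁ : Integrable f₁ P)
    (h₂ : Integrable f₂ P) (h₃ : Integrable f₃ P) {a b c : ℝ}
    (hle : ∀ ω, f ω ≤ a * f₁ ω + b * f₂ ω + c * f₃ ω) :
    ∫ ω, f ω ∂P ≤ a * ∫ ω, f₁ ω ∂P + b * ∫ ω, f₂ ω ∂P + c * ∫ ω, f₃ ω ∂P := by
  have h12 := (h₁.const_mul a).add (h₂.const_mul b)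
  have := integral_le_two h h12 h₃ (a := 1) (b := c) fun ω => by
    simpa only [one_mul, Pi.add_apply] using hle ω
  rw [one_mul] at this
  refine this.trans (le_of_eq ?_)
  rw [← integral_const_mul a, ← integral_const_mul b, ← integral_add (h₁.const_mul a)
    (h₂.const_mul b)]
  rfl

/-- A bound on the conditional expectation given an independent square integrable vector. -/
lemma integral_comp_indep_le [IsProbabilityMeasure ν] [IsProbabilityMeasure P] {ζ : Ω → Ξ}
    (hζ : Measurable ζ) (hlaw : P.map ζ = ν) {Z : Ω → Vec p} (hZ : Measurable Z) (hZ2 : MemLp Z 2 P) (hind : IndepFun Z ζ P)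
    {g : Vec p → Ξ → ℝ} (hg : Measurable (Function.uncurry g)) (hg0 : ∀ z ξ, 0 ≤ g z ξ)
    (hgi : ∀ z, Integrable (g z) ν) {a b : ℝ} (hgb : ∀ z, ∫ ξ, g z ξ ∂ν ≤ a * ‖z‖ ^ 2 + b) :
    Integrable (fun ω => g (Z ω) (ζ ω)) P ∧
      ∫ ω, g (Z ω) (ζ ω) ∂P ≤ a * ∫ ω, ‖Z ω‖ ^ 2 ∂P + b := by
  -- Independence makes the joint law a product; integrating over the seed first allows the
  -- pointwise moment bound to be used at the random input.
  have hprod : P.map (fun ω => (Z ω, ζ ω)) = (P.map Z).prod ν := by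
    rw [← hlaw]
    exact (indepFun_iff_map_prod_eq_prod_map_map hZ.aemeasurable hζ.aemeasurable).1 hind
  have : IsProbabilityMeasure (P.map Z) := Measure.isProbabilityMeasure_map hZ.aemeasurable
  have hZi : Integrable (fun z : Vec p => a * ‖z‖ ^ 2 + b) (P.map Z) := by
    rw [integrable_map_measure (by fun_prop) hZ.aemeasurable]
    exact ((hZ2.integrable_norm_pow two_ne_zero).const_mul a).add (integrable_const b)
  have hnorm : ∀ z ξ, ‖g z ξ‖ = g z ξ := fun z ξ => Real.norm_of_nonneg (hg0 z ξ)
  have hin : Integrable (fun z => ∫ ξ, g z ξ ∂ν) (P.map Z) := by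
    refine hZi.mono' (hg.stronglyMeasurable.integral_prod_right).aestronglyMeasurable
      (Eventually.of_forall fun z => ?_)
    rw [Real.norm_of_nonneg (integral_nonneg (hg0 z))]
    exact hgb z
  have hInt : Integrable (Function.uncurry g) ((P.map Z).prod ν) := by
    rw [integrable_prod_iff hg.aestronglyMeasurable]
    refine ⟨Eventually.of_forall fun z => hgi z, ?_⟩
    simpa only [Function.uncurry_apply_pair, hnorm] using hin
  have hmeas : AEMeasurable (fun ω => (Z ω, ζ ω)) P := (hZ.prodMk hζ).aemeasurable
  constructor
  · have h1 := hInt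
    rw [← hprod, integrable_map_measure hg.aestronglyMeasurable hmeas] at h1
    exact h1
  · calc ∫ ω, g (Z ω) (ζ ω) ∂P = ∫ x, Function.uncurry g x ∂(P.map fun ω => (Z ω, ζ ω)) :=
          (integral_map hmeas hg.aestronglyMeasurable).symm
      _ = ∫ z, ∫ ξ, g z ξ ∂ν ∂(P.map Z) := by rw [hprod, integral_prod _ hInt]; rfl
      _ ≤ ∫ z, (a * ‖z‖ ^ 2 + b) ∂(P.map Z) := integral_mono hin hZi hgb
      _ = ∫ ω, (a * ‖Z ω‖ ^ 2 + b) ∂P :=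
          integral_map hZ.aemeasurable hZi.aestronglyMeasurable
      _ = a * ∫ ω, ‖Z ω‖ ^ 2 ∂P + b := by
          rw [integral_add ((hZ2.integrable_norm_pow two_ne_zero).const_mul a)
            (integrable_const b), integral_const_mul]
          simp

/-! ### Moments of the dynamically scaled compression -/

section Compression

variable {comp : Ξ → Vec p → Vec p} {Cq σ r δ σr : ℝ}

lemma CompressionAssumption.memLp [IsProbabilityMeasure ν]
    (hC : CompressionAssumption ν comp Cq σ r δ σr) (x : Vec p) :
    MemLp (fun ξ => comp ξ x) 2 ν := by
  have hm : Measurable fun ξ => comp ξ x := hC.measurable.comp (measurable_id.prodMk measurable_const)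
  have h1 : MemLp (fun ξ => comp ξ x - x) 2 ν :=
    (memLp_two_iff_integrable_sq_norm (hm.sub_const x).aestronglyMeasurable).2 (hC.integrable x)
  have h2 := h1.add (memLp_const x)
  refine h2.congr_norm hm.aestronglyMeasurable (Eventually.of_forall fun ξ => ?_)
  simp

lemma CompressionAssumption.measurable_smul_comp (hC : CompressionAssumption ν comp Cq σ r δ σr)
    (s : ℝ) : Measurable fun x : Vec p × Ξ => s • comp x.2 ((1 / s) • x.1) :=
  (hC.measurable.comp (measurable_snd.prodMk (measurable_fst.const_smul (1 / s)))).const_smul s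

/-- The error of dynamic scaling compression. -/
lemma CompressionAssumption.scaled_error_le (hC : CompressionAssumption ν comp Cq σ r δ σr)
    {s : ℝ} (hs : s ≠ 0) (z : Vec p) :
    ∫ ξ, ‖s • comp ξ ((1 / s) • z) - z‖ ^ 2 ∂ν ≤ Cq * ‖z‖ ^ 2 + s ^ 2 * σ ^ 2 := by
  set y := (1 / s) • z with hy
  have hz : z = s • y := by rw [hy, smul_smul, mul_one_div_cancel hs, one_smul]
  clear_value y
  have e : ∀ ξ, ‖s • comp ξ y - z‖ ^ 2 = s ^ 2 * ‖comp ξ y - y‖ ^ 2 := fun ξ => by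
    rw [hz, ← smul_sub, norm_smul, mul_pow, Real.norm_eq_abs, sq_abs]
  simp only [e]
  rw [integral_const_mul]
  have h1 := mul_le_mul_of_nonneg_left (hC.error y) (sq_nonneg s)
  have h2 : ‖z‖ ^ 2 = s ^ 2 * ‖y‖ ^ 2 := by
    rw [hz, norm_smul, mul_pow, Real.norm_eq_abs, sq_abs]
  rw [h2]
  linarith

/-- The contraction of the difference compressed with dynamic scaling. -/
lemma CompressionAssumption.scaled_contraction [IsProbabilityMeasure ν]
    (hC : CompressionAssumption ν comp Cq σ r δ σr)
    {s : ℝ} (hs : s ≠ 0) {α : ℝ} (hα : 0 ≤ α) (hαr : α ≤ 1 / r) (z : Vec p) :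
    ∫ ξ, ‖z - α • (s • comp ξ ((1 / s) • z))‖ ^ 2 ∂ν
      ≤ (1 - α * r * δ) * ‖z‖ ^ 2 + α * r * (s ^ 2 * σr ^ 2) := by
  have hr := hC.r_pos
  have hαr1 : α * r ≤ 1 := by rwa [le_div_iff₀ hr] at hαr
  set y := (1 / s) • z with hy
  have hz : z = s • y := by rw [hy, smul_smul, mul_one_div_cancel hs, one_smul]
  clear_value y
  have hInt : Integrable (fun ξ => ‖(1 / r) • comp ξ y - y‖ ^ 2) ν :=
    (((hC.memLp y).const_smul (1 / r)).sub (memLp_const y)).integrable_norm_pow two_ne_zero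
  have hle : ∀ ξ, ‖z - α • (s • comp ξ y)‖ ^ 2
      ≤ s ^ 2 * ((1 - α * r) * ‖y‖ ^ 2 + α * r * ‖(1 / r) • comp ξ y - y‖ ^ 2) := by
    intro ξ
    -- A step `α ≤ 1 / r` is a convex combination, with weights `1 - α r` and `α r`, of not moving
    -- and of moving by `comp / r`; convexity of the squared norm yields the factor `(1 - α r) + α r
    -- (1 - δ) = 1 - α r δ`.
    have e1 : z - α • (s • comp ξ y)
        = s • ((1 - α * r) • y - (α * r) • ((1 / r) • comp ξ y - y)) := by
      rw [hz, smul_sub (α * r), smul_smul (α * r), mul_assoc α, mul_one_div_cancel hr.ne']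
      module
    rw [e1, norm_smul, mul_pow, Real.norm_eq_abs, sq_abs]
    refine mul_le_mul_of_nonneg_left ?_ (sq_nonneg s)
    have h1 := norm_sub_le ((1 - α * r) • y) ((α * r) • ((1 / r) • comp ξ y - y))
    rw [norm_smul, norm_smul, Real.norm_of_nonneg (by linarith),
      Real.norm_of_nonneg (by positivity)] at h1
    have h2 := pow_le_pow_left₀ (norm_nonneg _) h1 2
    have h3 : 0 ≤ (1 - α * r) * (α * r) * (‖y‖ - ‖(1 / r) • comp ξ y - y‖) ^ 2 :=
      mul_nonneg (mul_nonneg (by linarith) (by positivity)) (sq_nonneg _)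
    nlinarith
  have h1 : ∫ ξ, ‖z - α • (s • comp ξ y)‖ ^ 2 ∂ν
      ≤ ∫ ξ, s ^ 2 * ((1 - α * r) * ‖y‖ ^ 2 + α * r * ‖(1 / r) • comp ξ y - y‖ ^ 2) ∂ν := by
    refine integral_mono ?_ ?_ hle
    · exact ((memLp_const z).sub (((hC.memLp y).const_smul s).const_smul α)).integrable_norm_pow
        two_ne_zero
    · exact ((integrable_const _).add (hInt.const_mul _)).const_mul _
  rw [integral_const_mul, integral_add (integrable_const _) (hInt.const_mul _),
    integral_const_mul (α * r), integral_const, probReal_univ, one_smul] at h1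
  have h2 := mul_le_mul_of_nonneg_left (hC.scaled_error y) (mul_nonneg hα hr.le)
  have h3 : ‖z‖ ^ 2 = s ^ 2 * ‖y‖ ^ 2 := by
    rw [hz, norm_smul, mul_pow, Real.norm_eq_abs, sq_abs]
  rw [h3]
  nlinarith [mul_le_mul_of_nonneg_left h2 (sq_nonneg s)]

variable [IsProbabilityMeasure ν] [IsProbabilityMeasure P] {ζ : Fin n → Ω → Ξ}
  {Z : Ω → Stack n p}

/-- Rows are treated one at a time and summed. Only the seed of each row has to be independent of
the input, so agents may share randomness within a round. -/
lemma CompressionAssumption.stack_error (hC : CompressionAssumption ν comp Cq σ r δ σr)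
    {s : ℝ} (hs : s ≠ 0) (hζ : ∀ i, Measurable (ζ i)) (hlaw : ∀ i, P.map (ζ i) = ν)
    (hZ : Measurable Z) (hZ2 : SqInt P Z) (hind : IndepFun Z (fun ω i => ζ i ω) P) :
    SqInt P (fun ω => scaledCompress s (fun i => comp (ζ i ω)) (Z ω) - Z ω) ∧
    ∫ ω, nrm 1 (scaledCompress s (fun i => comp (ζ i ω)) (Z ω) - Z ω) ^ 2 ∂P
      ≤ Cq * ∫ ω, nrm 1 (Z ω) ^ 2 ∂P + n * (s ^ 2 * σ ^ 2) := by
  have hZi : ∀ i, Measurable fun ω => Z ω i := measurable_pi_iff.1 hZ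
  have key := fun i => integral_comp_indep_le (hζ i) (hlaw i) (hZi i) (hZ2 i)
    (hind.comp (measurable_pi_apply i) (measurable_pi_apply i))
    (g := fun z ξ => ‖s • comp ξ ((1 / s) • z) - z‖ ^ 2)
    (((hC.measurable_smul_comp s).sub measurable_fst).norm.pow_const 2)
    (fun _ _ => sq_nonneg _)
    (fun z => (((hC.memLp ((1 / s) • z)).const_smul s).sub (memLp_const z)).integrable_norm_pow
      two_ne_zero) (fun z => hC.scaled_error_le hs z)
  have hm := (measurable_scaledCompress hC.measurable s hζ hZ).sub hZ
  refine ⟨fun i => (memLp_two_iff_integrable_sq_norm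
    (measurable_pi_iff.1 hm i).aestronglyMeasurable).2 (key i).1, ?_⟩
  simp only [nrm_one_sq]
  have e : ∀ i, Integrable (fun ω => ‖(scaledCompress s (fun i => comp (ζ i ω)) (Z ω) - Z ω) i‖
      ^ 2) P := fun i => (key i).1
  rw [integral_finsetSum _ fun i _ => e i,
    integral_finsetSum _ fun i _ => (hZ2 i).integrable_norm_pow two_ne_zero, Finset.mul_sum]
  refine (Finset.sum_le_sum fun i _ => (key i).2).trans (le_of_eq ?_)
  rw [Finset.sum_add_distrib]
  simp

lemma CompressionAssumption.stack_contraction (hC : CompressionAssumption ν comp Cq σ r δ σr)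
    {s : ℝ} (hs : s ≠ 0) (hζ : ∀ i, Measurable (ζ i)) (hlaw : ∀ i, P.map (ζ i) = ν)
    (hZ : Measurable Z) (hZ2 : SqInt P Z) (hind : IndepFun Z (fun ω i => ζ i ω) P) {α : ℝ}
    (hα : 0 ≤ α) (hαr : α ≤ 1 / r) :
    ∫ ω, nrm 1 (Z ω - α • scaledCompress s (fun i => comp (ζ i ω)) (Z ω)) ^ 2 ∂P
      ≤ (1 - α * r * δ) * ∫ ω, nrm 1 (Z ω) ^ 2 ∂P + n * (α * r * (s ^ 2 * σr ^ 2)) := by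
  have hZi : ∀ i, Measurable fun ω => Z ω i := measurable_pi_iff.1 hZ
  have key := fun i => integral_comp_indep_le (hζ i) (hlaw i) (hZi i) (hZ2 i)
    (hind.comp (measurable_pi_apply i) (measurable_pi_apply i))
    (g := fun z ξ => ‖z - α • (s • comp ξ ((1 / s) • z))‖ ^ 2)
    ((measurable_fst.sub ((hC.measurable_smul_comp s).const_smul α)).norm.pow_const 2)
    (fun _ _ => sq_nonneg _)
    (fun z => ((memLp_const z).sub (((hC.memLp ((1 / s) • z)).const_smul s).const_smul
      α)).integrable_norm_pow two_ne_zero) (fun z => hC.scaled_contraction hs hα hαr z)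
  simp only [nrm_one_sq]
  have e : ∀ i, Integrable (fun ω => ‖(Z ω - α • scaledCompress s (fun i => comp (ζ i ω)) (Z ω)) i‖
      ^ 2) P := fun i => (key i).1
  rw [integral_finsetSum _ fun i _ => e i,
    integral_finsetSum _ fun i _ => (hZ2 i).integrable_norm_pow two_ne_zero, Finset.mul_sum]
  refine (Finset.sum_le_sum fun i _ => (key i).2).trans (le_of_eq ?_)
  rw [Finset.sum_add_distrib]
  simp

/-- The estimates on one compressed gossip step, in expectation. -/
structure GossipBounds (a h d x a' h' w Cq θ γ δT t n₁ n₂ : ℝ) : Prop where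
  consensus : a' ≤ (1 - θ * γ) * a
    + 2 / (θ * γ) * ((1 - θ * γ) ^ 2 * δT ^ 2 * d + 9 * γ ^ 2 * δT ^ 2 * x)
  compression : h' ≤ (1 - t / 2) * h + 5 / t * d
    + 5 / t * (27 * γ ^ 2 * (a + δT ^ 2 * d + δT ^ 2 * x)) + 2 * n₂
  move : w ≤ 27 * γ ^ 2 * a + 12 * δT ^ 2 * d + 27 * γ ^ 2 * δT ^ 2 * x
  error : x ≤ Cq * (2 * h + 2 * d) + n₁

/-- Pathwise gossip estimates integrated against the two moment bounds of the compressor. Stated for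
abstract `U, D, H`, so that it covers both the decision variables and the gradient trackers. -/
theorem gossip_bounds [NeZero n] (hC : CompressionAssumption ν comp Cq σ r δ σr)
    {W Pm T : Matrix (Fin n) (Fin n) ℝ} {δT θ γ : ℝ} (hT : IsAdaptedNorm W Pm T δT θ γ)
    (hP : Pm * Pm = Pm) (hWP : (1 - W) * Pm = 1 - W) (hγ : 0 < γ)
    {s : ℝ} (hs : s ≠ 0) (hζ : ∀ i, Measurable (ζ i)) (hlaw : ∀ i, P.map (ζ i) = ν) {α : ℝ}
    (hα : 0 < α) (hαr : α ≤ 1 / r) {U D H E U' H' : Ω → Stack n p}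
    (hU : SqInt P U) (hD : SqInt P D) (hH : SqInt P H)
    (hZm : Measurable Z) (hZ : ∀ ω, Z ω = U ω + D ω - H ω)
    (hind : IndepFun Z (fun ω i => ζ i ω) P)
    (hE : ∀ ω, E ω = scaledCompress s (fun i => comp (ζ i ω)) (Z ω) - Z ω)
    (hU' : ∀ ω, U' ω = gossip W γ (U ω + D ω) (E ω))
    (hH' : ∀ ω, H' ω = H ω + α • scaledCompress s (fun i => comp (ζ i ω)) (Z ω)) :
    (SqInt P U' ∧ SqInt P H') ∧
    GossipBounds (∫ ω, nrm T (mix Pm (U ω)) ^ 2 ∂P) (∫ ω, nrm 1 (U ω - H ω) ^ 2 ∂P)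
      (∫ ω, nrm 1 (D ω) ^ 2 ∂P) (∫ ω, nrm 1 (E ω) ^ 2 ∂P) (∫ ω, nrm T (mix Pm (U' ω)) ^ 2 ∂P)
      (∫ ω, nrm 1 (U' ω - H' ω) ^ 2 ∂P) (∫ ω, nrm 1 (U' ω - U ω) ^ 2 ∂P) Cq θ γ δT (α * r * δ)
      (n * (s ^ 2 * σ ^ 2)) (n * (α * r * (s ^ 2 * σr ^ 2))) := by
  have hr := hC.r_pos
  have hαr1 : α * r ≤ 1 := by rwa [le_div_iff₀ hr] at hαr
  set t := α * r * δ with ht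
  have ht0 : 0 < t := mul_pos (mul_pos hα hr) hC.delta_pos
  have ht1 : t ≤ 1 := by
    have := mul_le_mul hαr1 hC.delta_le_one hC.delta_pos.le zero_le_one
    linarith
  have hZ2 : SqInt P Z := by
    rw [show Z = fun ω => U ω + D ω - H ω from funext hZ]
    exact (hU.add hD).sub hH
  obtain ⟨hE2, herr⟩ := hC.stack_error hs hζ hlaw hZm hZ2 hind
  have hcon := hC.stack_contraction hs hζ hlaw hZm hZ2 hind hα.le hαr
  simp only [← hE] at hE2 herr
  have hQ : ∀ ω, scaledCompress s (fun i => comp (ζ i ω)) (Z ω) = Z ω + E ω := fun ω => by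
    rw [hE, add_sub_cancel]
  -- The reference point moves by `α` times the compressed difference, so the distance of `U + D`
  -- from the new reference is exactly the quantity that the compressor contracts.
  have hZE : ∀ ω, Z ω - α • (Z ω + E ω) = U ω + D ω - H' ω := fun ω => by
    rw [hH', hQ, hZ]; module
  simp only [hQ, hZE] at hcon
  have hU'2 : SqInt P U' := by
    rw [show U' = fun ω => gossip W γ (U ω + D ω) (E ω) from funext hU']
    exact (hU.add hD).gossip hE2 W γ
  have hH'2 : SqInt P H' := by
    rw [show H' = fun ω => H ω + α • (Z ω + E ω) from funext fun ω => by rw [hH', hQ]]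
    exact hH.add ((hZ2.add hE2).const_smul α)
  refine ⟨⟨hU'2, hH'2⟩, ?_⟩
  have ia := (hU.mix Pm).integrable_nrm_sq T
  have ih := (hU.sub hH).integrable_nrm_sq 1
  have id := hD.integrable_nrm_sq 1
  have ix := hE2.integrable_nrm_sq 1
  have ia' := (hU'2.mix Pm).integrable_nrm_sq T
  have ih' := (hU'2.sub hH'2).integrable_nrm_sq 1
  have iw := (hU'2.sub hU).integrable_nrm_sq 1
  have iz := hZ2.integrable_nrm_sq 1
  have ig := ((hU.add hD).sub hH'2).integrable_nrm_sq 1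
  have im := (hU'2.sub (hU.add hD)).integrable_nrm_sq 1
  -- The sharp split is needed where the coefficient of `h` must stay below one; the compression
  -- error only needs the crude one, `hz2`.
  have hz : ∫ ω, nrm 1 (Z ω) ^ 2 ∂P ≤ (1 + t / 4) * ∫ ω, nrm 1 (U ω - H ω) ^ 2 ∂P
      + 5 / t * ∫ ω, nrm 1 (D ω) ^ 2 ∂P := by
    refine integral_le_two iz ih id fun ω => ?_
    have := nrm_sub_sq_le ht0 ht1 (U ω + D ω) (U ω) (H ω)
    rw [add_sub_cancel_left, ← hZ] at this
    exact this
  have hz2 : ∫ ω, nrm 1 (Z ω) ^ 2 ∂P ≤ 2 * ∫ ω, nrm 1 (U ω - H ω) ^ 2 ∂P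
      + 2 * ∫ ω, nrm 1 (D ω) ^ 2 ∂P := by
    refine integral_le_two iz ih id fun ω => ?_
    have := nrm_sub_sq_le_two (U ω + D ω) (U ω) (H ω)
    rw [add_sub_cancel_left, ← hZ] at this
    exact this
  have hm : ∫ ω, nrm 1 (U' ω - (U ω + D ω)) ^ 2 ∂P ≤ 27 * γ ^ 2 *
      ((∫ ω, nrm T (mix Pm (U ω)) ^ 2 ∂P) + δT ^ 2 * ∫ ω, nrm 1 (D ω) ^ 2 ∂P
        + δT ^ 2 * ∫ ω, nrm 1 (E ω) ^ 2 ∂P) := by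
    refine (integral_le_three im ia id ix (a := 27 * γ ^ 2) (b := 27 * γ ^ 2 * δT ^ 2)
      (c := 27 * γ ^ 2 * δT ^ 2) fun ω => ?_).trans (le_of_eq (by ring))
    have := hT.gossip_sub_pre hWP hγ (U ω) (D ω) (E ω)
    rw [← hU'] at this
    linarith
  refine ⟨?_, ?_, ?_, ?_⟩
  · refine (integral_le_three ia' ia id ix (a := 1 - θ * γ)
      (b := 2 / (θ * γ) * ((1 - θ * γ) ^ 2 * δT ^ 2))
      (c := 2 / (θ * γ) * (9 * γ ^ 2 * δT ^ 2)) fun ω => ?_).trans (le_of_eq (by ring))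
    have := hT.gossip_consensus hP hWP hγ (U ω) (D ω) (E ω)
    rw [← hU'] at this
    linarith
  · have h1 : ∫ ω, nrm 1 (U' ω - H' ω) ^ 2 ∂P
        ≤ (1 + t / 4) * ∫ ω, nrm 1 (U ω + D ω - H' ω) ^ 2 ∂P
          + 5 / t * ∫ ω, nrm 1 (U' ω - (U ω + D ω)) ^ 2 ∂P := by
      exact integral_le_two ih' ig im fun ω => nrm_sub_sq_le ht0 ht1 _ _ _
    have hh0 : 0 ≤ ∫ ω, nrm 1 (U ω - H ω) ^ 2 ∂P := integral_nonneg fun _ => sq_nonneg _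
    have hd0 : 0 ≤ 5 / t * ∫ ω, nrm 1 (D ω) ^ 2 ∂P :=
      mul_nonneg (by positivity) (integral_nonneg fun _ => sq_nonneg _)
    have hz0 : 0 ≤ ∫ ω, nrm 1 (Z ω) ^ 2 ∂P := integral_nonneg fun _ => sq_nonneg _
    set n₂ := (n : ℝ) * (α * r * (s ^ 2 * σr ^ 2)) with hn2
    have hn2 : 0 ≤ n₂ := by positivity
    have h2 : (1 + t / 4) * ∫ ω, nrm 1 (U ω + D ω - H' ω) ^ 2 ∂P
        ≤ (1 - t / 2) * (∫ ω, nrm 1 (U ω - H ω) ^ 2 ∂P) + 5 / t * (∫ ω, nrm 1 (D ω) ^ 2 ∂P)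
          + 2 * n₂ := by
      have e1 := mul_le_mul_of_nonneg_left hcon (show 0 ≤ 1 + t / 4 by linarith)
      -- Two Young factors meet the contraction: `(1 + t/4)² (1 - t) ≤ 1 - t/2`.
      have e2 : (1 + t / 4) * (1 - t) ≤ 1 - 3 * t / 4 := by nlinarith
      have e3 := mul_le_mul_of_nonneg_right e2 hz0
      have e4 := mul_le_mul_of_nonneg_left hz (show 0 ≤ 1 - 3 * t / 4 by linarith)
      have e5 : (1 - 3 * t / 4) * (1 + t / 4) ≤ 1 - t / 2 := by nlinarith
      have e6 := mul_le_mul_of_nonneg_right e5 hh0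
      nlinarith
    have h3 := mul_le_mul_of_nonneg_left hm (show 0 ≤ 5 / t by positivity)
    linarith
  · refine integral_le_three iw ia id ix fun ω => ?_
    have := hT.gossip_sub hWP hγ (U ω) (D ω) (E ω)
    rw [← hU'] at this
    exact this
  · have := mul_le_mul_of_nonneg_left hz2 hC.C_nonneg
    linarith

end Compression

end Probability

/-! ### The Lyapunov function -/

section Lyapunov

/-- The weighted sum of consensus and compression errors after a gossip step. -/
lemma GossipBounds.combine {a h d x a' h' w Cq θ γ δT t n₁ n₂ u y : ℝ}
    (hb : GossipBounds a h d x a' h' w Cq θ γ δT t n₁ n₂) (ha : 0 ≤ a) (hh : 0 ≤ h) (hd : 0 ≤ d)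
    (hθ : 0 < θ) (hγ : 0 < γ) (hγ1 : γ ≤ 1) (hθγ : θ * γ ≤ 1) (ht : 0 < t) (ht1 : t ≤ 1)
    (hu : 0 ≤ u) (hy : 0 ≤ y) (hyC : y * t ^ 2 = γ ^ 2 * δT ^ 2 * Cq)
    (hyθ : 373248 * y ≤ θ ^ 2) (hyδ : 1728 * y ≤ δT ^ 2) (hθ1 : θ ≤ 1) :
    u * (θ * γ) * a' + 160 * u * y * t * h'
      ≤ u * (θ * γ) * (1 - 0.942 * (θ * γ)) * a + 160 * u * y * t * (1 - 0.274 * t) * h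
        + 2.6 * u * δT ^ 2 * d + u * (18 + 21600 * y) * (γ ^ 2 * δT ^ 2) * n₁
        + 320 * u * y * t * n₂ := by
  -- The weight `160` balances `h`: its own decay yields `80 u y t²`, the compression error in the
  -- two estimates costs at most `36.16 u y t²`, and the rest is `160 · 0.274`.
  have e1 := mul_le_mul_of_nonneg_left hb.consensus (show 0 ≤ u * (θ * γ) by positivity)
  have e2 := mul_le_mul_of_nonneg_left hb.compression (show 0 ≤ 160 * u * y * t by positivity)
  -- The multiplier is the total coefficient of `x` in `e1` and `e2`: `18` from the consensus bound
  -- and `21600 y = 160 y · 5 · 27` from the compression bound.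
  have e3 := mul_le_mul_of_nonneg_left hb.error
    (show 0 ≤ u * (18 + 21600 * y) * (γ ^ 2 * δT ^ 2) by positivity)
  have i1 : u * (θ * γ) * ((1 - θ * γ) * a
      + 2 / (θ * γ) * ((1 - θ * γ) ^ 2 * δT ^ 2 * d + 9 * γ ^ 2 * δT ^ 2 * x))
      = u * (θ * γ) * (1 - θ * γ) * a + 2 * u * (1 - θ * γ) ^ 2 * δT ^ 2 * d
        + 18 * u * (γ ^ 2 * δT ^ 2) * x := by
    field_simp; ring
  have i2 : 160 * u * y * t * ((1 - t / 2) * h + 5 / t * d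
      + 5 / t * (27 * γ ^ 2 * (a + δT ^ 2 * d + δT ^ 2 * x)) + 2 * n₂)
      = 160 * u * y * t * (1 - t / 2) * h + 800 * u * y * d
        + 21600 * u * y * γ ^ 2 * a + 21600 * u * y * γ ^ 2 * δT ^ 2 * d
        + 21600 * u * y * (γ ^ 2 * δT ^ 2) * x + 320 * u * y * t * n₂ := by
    field_simp; ring
  have i3 : u * (18 + 21600 * y) * (γ ^ 2 * δT ^ 2) * (Cq * (2 * h + 2 * d) + n₁)
      = u * (18 + 21600 * y) * (y * t ^ 2) * (2 * h + 2 * d)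
        + u * (18 + 21600 * y) * (γ ^ 2 * δT ^ 2) * n₁ := by
    rw [hyC]; ring
  rw [i1] at e1
  rw [i2] at e2
  rw [i3] at e3
  have hθ2 : θ ^ 2 ≤ 1 := pow_le_one₀ hθ.le hθ1
  have hy1 : 43200 * y ≤ 0.12 := by linarith
  have ht2 : t ^ 2 ≤ 1 := pow_le_one₀ ht.le ht1
  have hγ2 : γ ^ 2 ≤ 1 := pow_le_one₀ hγ.le hγ1
  -- coefficient of `a`
  have c1 : 21600 * u * y * γ ^ 2 * a ≤ 0.058 * u * (θ * γ) ^ 2 * a := by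
    have : 21600 * y ≤ 0.058 * θ ^ 2 := by linarith
    have := mul_le_mul_of_nonneg_right this (show 0 ≤ u * γ ^ 2 * a by positivity)
    linarith
  -- coefficient of `h`
  have c2 : u * (18 + 21600 * y) * (y * t ^ 2) * (2 * h) ≤ 36.16 * u * y * t ^ 2 * h := by
    have := mul_le_mul_of_nonneg_right hy1 (show 0 ≤ u * (y * t ^ 2) * h by positivity)
    linarith [show 0 ≤ u * (y * t ^ 2) * h by positivity]
  -- coefficient of `d`
  have c3 : u * (18 + 21600 * y) * (y * t ^ 2) * (2 * d) ≤ 0.021 * u * δT ^ 2 * d := by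
    have q1 : (18 + 21600 * y) * (y * t ^ 2) * 2 ≤ 0.021 * δT ^ 2 := by
      have q2 : y * t ^ 2 ≤ y := mul_le_of_le_one_right hy ht2
      have q3 : (36 + 43200 * y) * (y * t ^ 2) ≤ (36 + 0.12) * y :=
        mul_le_mul (by linarith) q2 (by positivity) (by norm_num)
      linarith
    have := mul_le_mul_of_nonneg_right q1 (show 0 ≤ u * d by positivity)
    linarith
  have c4 : 800 * u * y * d ≤ 0.464 * u * δT ^ 2 * d := by
    have q1 : 800 * y ≤ 0.464 * δT ^ 2 := by linarith
    have := mul_le_mul_of_nonneg_right q1 (show 0 ≤ u * d by positivity)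
    linarith
  have c5 : 21600 * u * y * γ ^ 2 * δT ^ 2 * d ≤ 0.06 * u * δT ^ 2 * d := by
    have q1 : 21600 * y * γ ^ 2 ≤ 0.06 := by
      have : y * γ ^ 2 ≤ y := mul_le_of_le_one_right hy hγ2
      linarith
    have := mul_le_mul_of_nonneg_right q1 (show 0 ≤ u * δT ^ 2 * d by positivity)
    linarith
  have c6 : 2 * u * (1 - θ * γ) ^ 2 * δT ^ 2 * d ≤ 2 * u * δT ^ 2 * d := by
    have q1 : (1 - θ * γ) ^ 2 ≤ 1 :=
      pow_le_one₀ (by linarith) (by linarith [mul_pos hθ hγ])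
    have := mul_le_mul_of_nonneg_right q1 (show 0 ≤ 2 * u * δT ^ 2 * d by positivity)
    linarith
  linarith [show 0 ≤ u * δT ^ 2 * d by positivity]

/-- One step of the Lyapunov recursion: `o` is the optimization error, `a, h` are consensus and
compression error of the decision variables, `g, m` those of the gradient trackers. -/
lemma lyapunov_step {o o' G a h d x a' h' w g m d₂ x₂ g' m' w₂ : ℝ}
    {Cq θ γ δT t θ₂ γ₂ δ₂ t₂ n₁ n₂ n₃ ux uy y y₂ L l M κ U ρ N P Q : ℝ}
    (hx : GossipBounds a h d x a' h' w Cq θ γ δT t n₁ n₂)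
    (hy : GossipBounds g m d₂ x₂ g' m' w₂ Cq θ₂ γ₂ δ₂ t₂ n₁ n₃)
    (ho : o' ≤ κ * o - M * l / 4 * G + P * a + Q * g)
    (hd : d ≤ l ^ 2 * (2 * g + 4 * U * G + 4 * U * (L ^ 2 / N) * a))
    (hd₂ : d₂ ≤ L ^ 2 * w)
    (o0 : 0 ≤ o) (G0 : 0 ≤ G) (a0 : 0 ≤ a) (h0 : 0 ≤ h) (d0 : 0 ≤ d)
    (g0 : 0 ≤ g) (m0 : 0 ≤ m) (d₂0 : 0 ≤ d₂) (n₁0 : 0 ≤ n₁)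
    (hθ : 0 < θ) (hθ1 : θ ≤ 1) (hγ : 0 < γ) (hγ1 : γ ≤ 1) (hθγ : θ * γ ≤ 1)
    (ht : 0 < t) (ht1 : t ≤ 1)
    (hθ₂ : 0 < θ₂) (hθ₂1 : θ₂ ≤ 1) (hγ₂ : 0 < γ₂) (hγ₂1 : γ₂ ≤ 1) (hθγ₂ : θ₂ * γ₂ ≤ 1)
    (ht₂ : 0 < t₂) (ht₂1 : t₂ ≤ 1)
    (hux : 0 ≤ ux) (huy : 0 ≤ uy) (y0 : 0 ≤ y) (y₂0 : 0 ≤ y₂)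
    (hyC : y * t ^ 2 = γ ^ 2 * δT ^ 2 * Cq) (hyθ : 373248 * y ≤ θ ^ 2) (hyδ : 1728 * y ≤ δT ^ 2)
    (hy₂C : y₂ * t₂ ^ 2 = γ₂ ^ 2 * δ₂ ^ 2 * Cq) (hy₂θ : 373248 * y₂ ≤ θ₂ ^ 2)
    (hy₂δ : 1728 * y₂ ≤ δ₂ ^ 2)
    (hP : ux * (θ * γ) ^ 2 = 4 * P) (hQ : uy * (θ₂ * γ₂) ^ 2 = 2 * Q)
    (l0 : 0 ≤ l) (M0 : 0 ≤ M) (P0 : 0 ≤ P) (Q0 : 0 ≤ Q) (N0 : 0 < N)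
    (hF₁ : 2.6 * uy * δ₂ ^ 2 * L ^ 2 ≤ ux * θ ^ 2 / 160)
    (hF₂ : 81 * (ux * δT ^ 2 * l ^ 2 * U) ≤ l * M)
    (hF₃ : l * M * (L ^ 2 / N) ≤ P) (hF₄ : 81 * (ux * δT ^ 2 * l ^ 2) ≤ Q)
    (hρ : κ ≤ ρ) (hρa : 1 - θ * γ / 16 ≤ ρ) (hρg : 1 - θ₂ * γ₂ / 8 ≤ ρ) (hρh : 1 - t / 4 ≤ ρ)
    (hρm : 1 - t₂ / 16 ≤ ρ) :
    o' + (ux * (θ * γ) * a' + 160 * ux * y * t * h')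
        + (uy * (θ₂ * γ₂) * g' + 160 * uy * y₂ * t₂ * m')
      ≤ ρ * (o + (ux * (θ * γ) * a + 160 * ux * y * t * h)
        + (uy * (θ₂ * γ₂) * g + 160 * uy * y₂ * t₂ * m))
        + ((ux * (18 + 21600 * y) + ux) * (γ ^ 2 * δT ^ 2)
          + uy * (18 + 21600 * y₂) * (γ₂ ^ 2 * δ₂ ^ 2)) * n₁
        + 320 * ux * y * t * n₂ + 320 * uy * y₂ * t₂ * n₃ := by
  have eX := hx.combine a0 h0 d0 hθ hγ hγ1 hθγ ht ht1 hux y0 hyC hyθ hyδ hθ1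
  have eY := hy.combine g0 m0 d₂0 hθ₂ hγ₂ hγ₂1 hθγ₂ ht₂ ht₂1 huy y₂0 hy₂C hy₂θ hy₂δ hθ₂1
  have hθ2 : θ ^ 2 ≤ 1 := pow_le_one₀ hθ.le hθ1
  have ht2 : t ^ 2 ≤ 1 := pow_le_one₀ ht.le ht1
  -- the movement of the decision variables
  have w1 : γ ^ 2 * δT ^ 2 * x ≤ y * t ^ 2 * (2 * h + 2 * d) + γ ^ 2 * δT ^ 2 * n₁ := by
    have := mul_le_mul_of_nonneg_left hx.error (show 0 ≤ γ ^ 2 * δT ^ 2 by positivity)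
    rw [hyC]; linarith
  have w2 : w ≤ 27 * γ ^ 2 * a + 12 * δT ^ 2 * d + 54 * (y * t ^ 2) * h + 54 * (y * t ^ 2) * d
      + 27 * (γ ^ 2 * δT ^ 2) * n₁ := by
    linarith [hx.move]
  have w3 : 54 * (y * t ^ 2) * d ≤ 0.04 * δT ^ 2 * d := by
    have q2 : y * t ^ 2 ≤ y := mul_le_of_le_one_right y0 ht2
    exact mul_le_mul_of_nonneg_right (by linarith) d0
  have w4 : w ≤ 27 * γ ^ 2 * a + 12.04 * δT ^ 2 * d + 54 * (y * t ^ 2) * h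
      + 27 * (γ ^ 2 * δT ^ 2) * n₁ := by linarith
  have w5 : 2.6 * uy * δ₂ ^ 2 * d₂ ≤ ux * θ ^ 2 / 160 * (27 * γ ^ 2 * a + 12.04 * δT ^ 2 * d
      + 54 * (y * t ^ 2) * h + 27 * (γ ^ 2 * δT ^ 2) * n₁) := by
    have q1 := mul_le_mul_of_nonneg_left (hd₂.trans (mul_le_mul_of_nonneg_left w4 (sq_nonneg L)))
      (show 0 ≤ 2.6 * uy * δ₂ ^ 2 by positivity)
    have q2 := mul_le_mul_of_nonneg_right hF₁ (show 0 ≤ 27 * γ ^ 2 * a + 12.04 * δT ^ 2 * d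
      + 54 * (y * t ^ 2) * h + 27 * (γ ^ 2 * δT ^ 2) * n₁ by positivity)
    linarith
  -- The gossip part of the move costs the trackers `27/160 · 4 P = 0.675 P`, independently of `γ`,
  -- because both the move and the decay of `a` in the weighted sum are quadratic in `γ`.
  have w6 : ux * θ ^ 2 / 160 * (27 * γ ^ 2 * a) = 0.675 * P * a := by
    have : ux * θ ^ 2 / 160 * (27 * γ ^ 2 * a) = 27 / 160 * (ux * (θ * γ) ^ 2) * a := by ring
    rw [this, hP]; ring
  have w7 : ux * θ ^ 2 / 160 * (12.04 * δT ^ 2 * d) ≤ 0.1 * ux * δT ^ 2 * d := by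
    have := mul_le_mul_of_nonneg_right hθ2 (show 0 ≤ ux * δT ^ 2 * d by positivity)
    linarith [show 0 ≤ ux * δT ^ 2 * d by positivity]
  have w8 : ux * θ ^ 2 / 160 * (54 * (y * t ^ 2) * h) ≤ ux * y * t ^ 2 * h := by
    have := mul_le_mul_of_nonneg_right hθ2 (show 0 ≤ ux * y * t ^ 2 * h by positivity)
    linarith [show 0 ≤ ux * y * t ^ 2 * h by positivity]
  have w9 : ux * θ ^ 2 / 160 * (27 * (γ ^ 2 * δT ^ 2) * n₁) ≤ ux * (γ ^ 2 * δT ^ 2) * n₁ := by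
    have := mul_le_mul_of_nonneg_right hθ2 (show 0 ≤ ux * (γ ^ 2 * δT ^ 2) * n₁ by positivity)
    linarith [show 0 ≤ ux * (γ ^ 2 * δT ^ 2) * n₁ by positivity]
  -- the local updates
  have d1 : 2.7 * ux * δT ^ 2 * d ≤ 2 / 30 * Q * g + 2 / 15 * (l * M) * G + 2 / 15 * P * a := by
    have q1 := mul_le_mul_of_nonneg_left hd (show 0 ≤ 2.7 * ux * δT ^ 2 by positivity)
    have q2 := mul_le_mul_of_nonneg_right hF₄ g0
    have q3 := mul_le_mul_of_nonneg_right hF₂ G0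
    have q4 := mul_le_mul_of_nonneg_right
      ((mul_le_mul_of_nonneg_right hF₂ (show 0 ≤ L ^ 2 / N by positivity)).trans hF₃) a0
    linarith
  -- collecting
  have r1 := mul_le_mul_of_nonneg_right hρ o0
  have r2 := mul_le_mul_of_nonneg_right hρa (show 0 ≤ ux * (θ * γ) * a by positivity)
  have r3 := mul_le_mul_of_nonneg_right hρg (show 0 ≤ uy * (θ₂ * γ₂) * g by positivity)
  have r4 := mul_le_mul_of_nonneg_right hρh (show 0 ≤ 160 * ux * y * t * h by positivity)
  have r5 := mul_le_mul_of_nonneg_right hρm (show 0 ≤ 160 * uy * y₂ * t₂ * m by positivity)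
  have s1 : ux * (θ * γ) * (1 - 0.942 * (θ * γ)) * a = ux * (θ * γ) * a - 3.768 * P * a := by
    have : ux * (θ * γ) * (1 - 0.942 * (θ * γ)) * a
        = ux * (θ * γ) * a - 0.942 * (ux * (θ * γ) ^ 2) * a := by ring
    rw [this, hP]; ring
  have s2 : (1 - θ * γ / 16) * (ux * (θ * γ) * a) = ux * (θ * γ) * a - 0.25 * P * a := by
    have : (1 - θ * γ / 16) * (ux * (θ * γ) * a)
        = ux * (θ * γ) * a - 1 / 16 * (ux * (θ * γ) ^ 2) * a := by ring
    rw [this, hP]; ring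
  have s3 : uy * (θ₂ * γ₂) * (1 - 0.942 * (θ₂ * γ₂)) * g
      = uy * (θ₂ * γ₂) * g - 1.884 * Q * g := by
    have : uy * (θ₂ * γ₂) * (1 - 0.942 * (θ₂ * γ₂)) * g
        = uy * (θ₂ * γ₂) * g - 0.942 * (uy * (θ₂ * γ₂) ^ 2) * g := by ring
    rw [this, hQ]; ring
  have s4 : (1 - θ₂ * γ₂ / 8) * (uy * (θ₂ * γ₂) * g) = uy * (θ₂ * γ₂) * g - 0.25 * Q * g := by
    have : (1 - θ₂ * γ₂ / 8) * (uy * (θ₂ * γ₂) * g)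
        = uy * (θ₂ * γ₂) * g - 1 / 8 * (uy * (θ₂ * γ₂) ^ 2) * g := by ring
    rw [this, hQ]; ring
  rw [s1] at eX
  rw [s2] at r2
  rw [s3] at eY
  rw [s4] at r3
  have p1 : 0 ≤ P * a := mul_nonneg P0 a0
  have p2 : 0 ≤ Q * g := mul_nonneg Q0 g0
  have p3 : 0 ≤ l * M * G := mul_nonneg (mul_nonneg l0 M0) G0
  have p4 : 0 ≤ ux * y * t ^ 2 * h := by positivity
  have p5 : 0 ≤ uy * y₂ * t₂ ^ 2 * m := by positivity
  -- Budget. `P a`: gain `3.768`; cost `1` (objective), `0.675` (trackers), `2/15` (local updates),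
  -- `0.25` (rate). `Q g`: gain `1.884`; cost `1 + 1/15 + 0.25`. `l M G`: gain `1/4`; cost `2/15`.
  -- `ux y t² h`: gain `43.84`; cost `1 + 40`. `uy y₂ t₂² m`: gain `43.84`; cost `10`.
  linarith

/-- A linear recursion with a geometric perturbation of a larger rate. -/
lemma exists_le_geometric {V : ℕ → ℝ} {ρ c K : ℝ} (hρc : ρ < c) (hρ : 0 ≤ ρ)
    (h : ∀ k, V (k + 1) ≤ ρ * V k + K * c ^ k) : ∃ B, ∀ k, V k ≤ B * c ^ k := by
  have hc : 0 < c := hρ.trans_lt hρc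
  -- The second entry of the maximum is the threshold for `ρ B + K ≤ c B`, which propagates the
  -- bound.
  refine ⟨max (V 0) (K / (c - ρ)), fun k => ?_⟩
  induction k with
  | zero => simp
  | succ k ih =>
    set B := max (V 0) (K / (c - ρ))
    have h1 : K / (c - ρ) ≤ B := le_max_right _ _
    rw [div_le_iff₀ (sub_pos.2 hρc)] at h1
    have h2 := mul_le_mul_of_nonneg_left ih hρ
    have h3 := mul_le_mul_of_nonneg_right h1 (pow_pos hc k).le
    rw [pow_succ]
    linarith [h k]

end Lyapunov

/-! ### Consequences of the step-size conditions -/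

section StepSize

/-- The coefficient inequalities of the Lyapunov argument. -/
lemma coefficient_bounds {N r c δR δC θR θC M l L γx γy E P Q ux uy : ℝ} (hN : 0 < N) (hr : 0 < r)
    (hc : 0 < c) (hδR : 1 ≤ δR) (hθR : 0 < θR) (hθR1 : θR ≤ 1) (hθC : 0 < θC) (hM : 0 < M)
    (hl : 0 < l) (hγx : 0 < γx) (hγy : 0 < γy) (hMN : M * N ≤ r * c) (hrδ : r ^ 2 ≤ N * δR ^ 2)
    (hγ : 216 * γx ^ 2 ≤ 1) (hγγ : 216 * r * δC ^ 2 * γx ^ 2 ≤ M * c * (θC * γy) ^ 2)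
    (hE : E = r * c / (N ^ 2 * M))
    (hL : 384 * (l * L) ^ 2 * E * c ^ 2 * δR ^ 2 * (1 - θR * γx) ^ 2 ≤ (θR * γx) ^ 2)
    (hP : P = l * L ^ 2 * M * E) (hQ : Q = l * E * (r / c)) (hux : ux = 4 * P / (θR * γx) ^ 2)
    (huy : uy = 2 * Q / (θC * γy) ^ 2) :
    2.6 * uy * δC ^ 2 * L ^ 2 ≤ ux * θR ^ 2 / 160 ∧ 81 * (ux * δR ^ 2 * l ^ 2 * c ^ 2) ≤ l * M ∧
      l * M * (L ^ 2 / N) ≤ P ∧ 81 * (ux * δR ^ 2 * l ^ 2) ≤ Q ∧ (l * (r * c / N) * L) ^ 2 ≤ 1 := by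
  have hEpos : 0 < E := by rw [hE]; positivity
  -- `216 · 0.08² > 1`. Then `(1 - θR γx)² ≥ 0.92² = 0.8464`, and `384 · 0.8464 ≥ 325` removes this
  -- factor from `hL`.
  have hx1 : θR * γx ≤ 0.08 := by
    have : γx ≤ 0.08 := by
      by_contra! h
      nlinarith
    nlinarith
  have hq : 0.8464 ≤ (1 - θR * γx) ^ 2 := by
    nlinarith [mul_pos hθR hγx]
  have hNE : 1 ≤ N * E := by
    rw [hE, mul_div_assoc', le_div_iff₀ (by positivity)]
    nlinarith
  have hL2 : 325 * ((l * L) ^ 2 * E * c ^ 2 * δR ^ 2) ≤ (θR * γx) ^ 2 := by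
    have := mul_le_mul_of_nonneg_left hq (show 0 ≤ 384 * (l * L) ^ 2 * E * c ^ 2 * δR ^ 2 by
      positivity)
    linarith [show 0 ≤ (l * L) ^ 2 * E * c ^ 2 * δR ^ 2 by positivity]
  have hF₂ : 81 * (ux * δR ^ 2 * l ^ 2 * c ^ 2) ≤ l * M := by
    have e : 81 * (ux * δR ^ 2 * l ^ 2 * c ^ 2)
        = l * M * (324 * ((l * L) ^ 2 * E * c ^ 2 * δR ^ 2) / (θR * γx) ^ 2) := by
      rw [hux, hP]; ring
    rw [e]
    refine mul_le_of_le_one_right (by positivity) ?_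
    rw [div_le_one (by positivity)]
    linarith [show 0 ≤ (l * L) ^ 2 * E * c ^ 2 * δR ^ 2 by positivity]
  refine ⟨?_, hF₂, ?_, ?_, ?_⟩
  · have e1 : 2.6 * uy * δC ^ 2 * L ^ 2
        = 5.2 * l * E * L ^ 2 * (r * δC ^ 2 / (c * (θC * γy) ^ 2)) := by
      rw [huy, hQ]; field_simp; ring
    have e2 : ux * θR ^ 2 / 160 = 0.025 * l * E * L ^ 2 * (M / γx ^ 2) := by
      rw [hux, hP]; field_simp; ring
    -- The bound of `γx` by `γy`: consensus must be slow compared with tracking, so that the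
    -- trackers can follow the moving gradients. The margin is `5.2 / 216 < 0.025`.
    have e3 : 216 * (r * δC ^ 2 / (c * (θC * γy) ^ 2)) ≤ M / γx ^ 2 := by
      rw [mul_div_assoc', div_le_div_iff₀ (by positivity) (by positivity)]
      linarith
    rw [e1, e2]
    have := mul_le_mul_of_nonneg_left e3 (show 0 ≤ l * E * L ^ 2 by positivity)
    linarith [show 0 ≤ l * E * L ^ 2 * (M / γx ^ 2) by positivity]
  · have : l * M * (L ^ 2 / N) * (N * E) = P := by rw [hP]; field_simp
    rw [← this]
    exact le_mul_of_one_le_right (by positivity) hNE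
  · have h1 : 81 * (ux * δR ^ 2 * l ^ 2) ≤ l * M / c ^ 2 := by
      rw [le_div_iff₀ (by positivity)]
      linarith
    refine h1.trans ?_
    have e : Q = l * M / c ^ 2 * ((r * c / (M * N)) ^ 2) := by
      rw [hQ, hE]; field_simp
    rw [e]
    refine le_mul_of_one_le_right (by positivity) ?_
    have : 1 ≤ r * c / (M * N) := by
      rw [le_div_iff₀ (by positivity)]; linarith
    exact one_le_pow₀ this
  · have h1 : (l * (r * c / N) * L) ^ 2 ≤ (l * L) ^ 2 * E * c ^ 2 * δR ^ 2 := by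
      have e : (l * L) ^ 2 * E * c ^ 2 * δR ^ 2
          = (l * (r * c / N) * L) ^ 2 * ((c * r / (M * N)) * (N * δR ^ 2 / r ^ 2)) := by
        rw [hE]; field_simp
      rw [e]
      refine le_mul_of_one_le_right (sq_nonneg _) (one_le_mul_of_one_le_of_one_le ?_ ?_)
      · rw [le_div_iff₀ (by positivity)]; linarith
      · rw [le_div_iff₀ (by positivity)]; linarith
    have h2 : (θR * γx) ^ 2 ≤ 1 := pow_le_one₀ (by positivity) (by linarith)
    linarith [show 0 ≤ (l * L) ^ 2 * E * c ^ 2 * δR ^ 2 by positivity]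

variable {n : ℕ}

lemma norm_perron_pos [NeZero n] {u : EuclideanSpace ℝ (Fin n)} (hu : ∑ i, u i = n) : 0 < ‖u‖ := by
  rw [norm_pos_iff]
  rintro rfl
  have hn : (n : ℝ) ≠ 0 := by exact_mod_cast NeZero.ne n
  exact hn (by simpa using hu.symm)

/-- Passing to the weighted norm and back costs `δ`, so `δ` bounds the Euclidean operator norm of
the projection. With suitable test vectors this bounds the Perron vectors by `δ`. -/
lemma IsAdaptedNorm.norm_proj_le {W Pm T : Matrix (Fin n) (Fin n) ℝ} {δ θ γ : ℝ}
    (hT : IsAdaptedNorm W Pm T δ θ γ) (v : Fin n → ℝ) :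
    ∑ i, (Pm.mulVec v i) ^ 2 ≤ δ ^ 2 * ∑ i, v i ^ 2 := by
  have h1 := (hT.lower (Pm.mulVec v)).trans ((hT.norm_proj v).trans
    ((one_mul _).le.trans (hT.upper v)))
  have h2 := pow_le_pow_left₀ (norm_nonneg _) h1 2
  rw [mul_pow, EuclideanSpace.norm_sq_eq, EuclideanSpace.norm_sq_eq] at h2
  simpa using h2

/-- The operator norm of the projection `Π_R` is `‖u_R‖ / √n`. -/
lemma IsAdaptedNorm.norm_sq_le_projR [NeZero n] {u : EuclideanSpace ℝ (Fin n)}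
    {W T : Matrix (Fin n) (Fin n) ℝ} {δ θ γ : ℝ} (hT : IsAdaptedNorm W (projR u) T δ θ γ)
    (hu : ∑ i, u i = n) : ‖u‖ ^ 2 ≤ n * δ ^ 2 := by
  have hn : (0 : ℝ) < n := by exact_mod_cast Nat.pos_of_neZero n
  set s := ‖u‖ ^ 2 / n with hs
  have hsq : ∑ i, u i ^ 2 = n * s := by
    rw [hs, mul_div_cancel₀ _ hn.ne', EuclideanSpace.norm_sq_eq]; simp
  have hexp : ∀ a : ℝ, ∑ i, (u i - a) ^ 2 = n * s - 2 * a * n + n * a ^ 2 := by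
    intro a
    have : ∀ i, (u i - a) ^ 2 = u i ^ 2 - 2 * a * u i + a ^ 2 := fun i => by ring
    simp only [this, Finset.sum_add_distrib, Finset.sum_sub_distrib, ← Finset.mul_sum, hsq, hu]
    simp
  -- With `s = ‖u‖² / n`, the test vector `u - 1` has squared norm `n (s - 1)` and its image `u - s`
  -- has squared norm `n s (s - 1)`; the quotient is `s`.
  have h := hT.norm_proj_le (fun i => u i - 1)
  have e : ∀ i, (projR u).mulVec (fun i => u i - 1) i = u i - s := by
    intro i
    rw [projR, Matrix.sub_mulVec, Matrix.one_mulVec]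
    have : ∑ j, u j / n * (u j - 1) = s - 1 := by
      have e2 : ∀ j, u j / n * (u j - 1) = (u j ^ 2 - u j) / n := fun j => by ring
      simp only [e2, ← Finset.sum_div, Finset.sum_sub_distrib, hsq, hu]
      field_simp
    simp only [Pi.sub_apply, Matrix.mulVec, dotProduct, Matrix.of_apply, this]
    ring
  simp only [e] at h
  rw [hexp, hexp] at h
  have hδ := hT.one_le_upper
  have hgoal : s ≤ δ ^ 2 := by
    by_contra! hlt
    have hs1 : 1 < s := by nlinarith
    nlinarith [mul_pos (mul_pos hn (sub_pos.2 hs1)) (sub_pos.2 hlt)]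
  have : ‖u‖ ^ 2 = n * s := by rw [hs, mul_div_cancel₀ _ hn.ne']
  rw [this]
  exact mul_le_mul_of_nonneg_left hgoal hn.le

/-- The operator norm of the projection `Π_C` is `‖u_C‖ / √n`. -/
lemma IsAdaptedNorm.norm_sq_le_projC [NeZero n] {u : EuclideanSpace ℝ (Fin n)}
    {W T : Matrix (Fin n) (Fin n) ℝ} {δ θ γ : ℝ} (hT : IsAdaptedNorm W (projC u) T δ θ γ)
    (hu : ∑ i, u i = n) : ‖u‖ ^ 2 ≤ n * δ ^ 2 := by
  have hn : (0 : ℝ) < n := by exact_mod_cast Nat.pos_of_neZero n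
  set s := ‖u‖ ^ 2 / n with hs
  have hsq : ∑ i, u i ^ 2 = n * s := by
    rw [hs, mul_div_cancel₀ _ hn.ne', EuclideanSpace.norm_sq_eq]; simp
  have hexp : ∀ a : ℝ, ∑ i, (u i - a) ^ 2 = n * s - 2 * a * n + n * a ^ 2 := by
    intro a
    have : ∀ i, (u i - a) ^ 2 = u i ^ 2 - 2 * a * u i + a ^ 2 := fun i => by ring
    simp only [this, Finset.sum_add_distrib, Finset.sum_sub_distrib, ← Finset.mul_sum, hsq, hu]
    simp
  -- Now the roles are exchanged: `u - s`, of squared norm `n s (s - 1)`, is mapped to `s (u - 1)`,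
  -- of squared norm `n s² (s - 1)`.
  have h := hT.norm_proj_le (fun i => u i - s)
  have e : ∀ i, (projC u).mulVec (fun i => u i - s) i = s * (u i - 1) := by
    intro i
    rw [projC, Matrix.sub_mulVec, Matrix.one_mulVec]
    have : ∑ j, u i / n * (u j - s) = u i * (1 - s) := by
      rw [← Finset.mul_sum, Finset.sum_sub_distrib, hu]
      simp
      field_simp
    simp only [Pi.sub_apply, Matrix.mulVec, dotProduct, Matrix.of_apply, this]
    ring
  simp only [e, mul_pow, ← Finset.mul_sum] at h
  rw [hexp, hexp] at h
  have hδ := hT.one_le_upper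
  have hgoal : s ≤ δ ^ 2 := by
    by_contra! hlt
    have hs1 : 1 < s := by nlinarith
    have hs0 : 0 < s := by linarith
    have := mul_pos (mul_pos (mul_pos hn hs0) (sub_pos.2 hs1)) (sub_pos.2 hlt)
    nlinarith
  have : ‖u‖ ^ 2 = n * s := by rw [hs, mul_div_cancel₀ _ hn.ne']
  rw [this]
  exact mul_le_mul_of_nonneg_left hgoal hn.le

lemma avgStep_le [NeZero n] {uR uC : EuclideanSpace ℝ (Fin n)} (hR : ∀ i, 0 ≤ uR i)
    (hC : ∀ i, 0 ≤ uC i) {lam : Fin n → ℝ} {l : ℝ} (hl : ∀ i, lam i ≤ l) (hl0 : 0 ≤ l) :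
    avgStep uR uC lam ≤ l * (‖uR‖ * ‖uC‖ / n) := by
  have hn : (0 : ℝ) < n := by exact_mod_cast Nat.pos_of_neZero n
  have h1 : ∑ i, uR i * lam i * uC i ≤ l * ∑ i, uR i * uC i := by
    rw [Finset.mul_sum]
    refine Finset.sum_le_sum fun i _ => ?_
    have := mul_le_mul_of_nonneg_right (hl i) (mul_nonneg (hR i) (hC i))
    linarith
  have h2 : ∑ i, uR i * uC i ≤ ‖uR‖ * ‖uC‖ := by
    have := real_inner_le_norm uC uR
    rw [PiLp.inner_apply] at this
    simpa [mul_comm] using this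
  rw [avgStep]
  calc 1 / (n : ℝ) * _ ≤ 1 / (n : ℝ) * (l * (‖uR‖ * ‖uC‖)) := by
        gcongr; exact h1.trans (mul_le_mul_of_nonneg_left h2 hl0)
    _ = _ := by ring

variable {uR uC : EuclideanSpace ℝ (Fin n)}
  {δR δC θR θC L Cq r δ M l αx αy γx γy : ℝ}

/-- The square of `γx₃`, with `e₁ ≥ 2 δC²` turning `108` into `216`. -/
lemma StepSizeConditions.sq_gamma_x_le
    (h : StepSizeConditions uR uC δR δC θR θC L Cq r δ M l αx αy γx γy) (hM : 0 ≤ M)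
    (hCq : 0 ≤ Cq) (hδC : 1 ≤ δC) (huR : 0 < ‖uR‖) :
    216 * ‖uR‖ * δC ^ 2 * γx ^ 2 ≤ M * ‖uC‖ * (θC * γy) ^ 2 := by
  have he : 2 * δC ^ 2 ≤ e₁ δC Cq := by
    rw [e₁]
    exact le_mul_of_one_le_right (by positivity) (by linarith)
  have he0 : 0 < e₁ δC Cq := by nlinarith
  have h1 := pow_le_pow_left₀ h.γx_pos.le h.γx₃ 2
  rw [mul_assoc, mul_pow, div_pow, Real.sq_sqrt (by positivity), Real.sq_sqrt (by positivity),
    div_mul_eq_mul_div, le_div_iff₀ (by positivity)] at h1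
  have h2 := mul_le_mul_of_nonneg_left he (show 0 ≤ 108 * ‖uR‖ * γx ^ 2 by positivity)
  linarith

lemma StepSizeConditions.compression_x
    (h : StepSizeConditions uR uC δR δC θR θC L Cq r δ M l αx αy γx γy) (hCq : 0 ≤ Cq)
    (hδR : 1 ≤ δR) (ht : 0 ≤ αx * r * δ) :
    373248 * (γx ^ 2 * δR ^ 2 * Cq) ≤ θR ^ 2 * (αx * r * δ) ^ 2 := by
  have h1 : √Cq * γx ≤ θR / (432 * √2 * δR) * (αx * r * δ) := by
    refine h.γx₂.trans ?_
    rw [mul_assoc, mul_assoc, ← mul_assoc αx]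
    exact mul_le_mul_of_nonneg_right (min_le_left _ _) ht
  have h2 := pow_le_pow_left₀ (mul_nonneg (Real.sqrt_nonneg _) h.γx_pos.le) h1 2
  rw [mul_pow, Real.sq_sqrt hCq, mul_pow, div_pow, div_mul_eq_mul_div,
    le_div_iff₀ (by positivity), mul_pow, mul_pow, Real.sq_sqrt two_pos.le] at h2
  linarith

/-- Multiplying `γy₂` by `γy₃` cancels `e₂`; then `e₁ ≥ 2 δC²` and `373248 = 2 · 432²`. -/
lemma StepSizeConditions.compression_y
    (h : StepSizeConditions uR uC δR δC θR θC L Cq r δ M l αx αy γx γy) (hCq : 0 ≤ Cq)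
    (hδC : 1 ≤ δC) (hθC : 0 < θC) :
    373248 * (γy ^ 2 * δC ^ 2 * Cq) ≤ θC ^ 2 * (αy * r * δ) ^ 2 := by
  have he : 2 * δC ^ 2 ≤ e₁ δC Cq := by
    rw [e₁]
    exact le_mul_of_one_le_right (by positivity) (by linarith)
  have he0 : 0 < e₁ δC Cq := by nlinarith
  have he2 : 0 < e₂ Cq := by rw [e₂]; linarith
  have hγ := h.γy_pos
  have h1 := h.γy₂
  rw [le_div_iff₀ (by positivity)] at h1
  have h2 := mul_le_mul h1 h.γy₃ (by positivity) (by positivity)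
  have h3 : (γy ^ 2 * (432 ^ 2 * e₁ δC Cq * Cq)) * e₂ Cq
      ≤ (θC ^ 2 * (αy * r * δ) ^ 2) * e₂ Cq := by linarith
  have h4 := le_of_mul_le_mul_right h3 he2
  have h5 := mul_le_mul_of_nonneg_left he (show 0 ≤ γy ^ 2 * Cq * 432 ^ 2 by positivity)
  linarith

end StepSize

/-! ### The trajectories of the algorithm -/

section Run

variable {n p : ℕ}

/-- The local update `-Λ Y`. -/
def localUpdate (lam : Fin n → ℝ) (Y : Stack n p) : Stack n p := fun i => -(lam i • Y i)

variable (A : Params n) (f : Fin n → Vec p → ℝ) (X0 : Stack n p)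
  (q : ℕ → Bool → Fin n → Vec p → Vec p)

/-- Both references start at zero and follow the same linear recursion up to the factor `R`. Hence
the mixed copy never has to be sent uncompressed, and `X̂ - X̂_R = (1 - R) X̂`. -/
lemma run_HR (k : ℕ) : (run A f X0 q k).HR = mix A.R (run A f X0 q k).Hx := by
  induction k with
  | zero => funext i; simp [run, mix]
  | succ k ih =>
    simp only [run, step, ih, mix_add, mix_smul]

lemma run_HC (k : ℕ) : (run A f X0 q k).HC = mix A.C (run A f X0 q k).Hy := by
  induction k with
  | zero => funext i; simp [run, mix]
  | succ k ih =>
    simp only [run, step, ih, mix_add, mix_smul]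

lemma run_X_succ (k : ℕ) : (run A f X0 q (k + 1)).X
    = gossip A.R A.γx ((run A f X0 q k).X + localUpdate A.lam (run A f X0 q k).Y)
      (scaledCompress (A.s k) (q k false) ((run A f X0 q k).X
          + localUpdate A.lam (run A f X0 q k).Y - (run A f X0 q k).Hx)
        - ((run A f X0 q k).X + localUpdate A.lam (run A f X0 q k).Y - (run A f X0 q k).Hx)) := by
  have hXt : (fun i => (run A f X0 q k).X i - A.lam i • (run A f X0 q k).Y i)
      = (run A f X0 q k).X + localUpdate A.lam (run A f X0 q k).Y := by
    funext i; simp [localUpdate, sub_eq_add_neg]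
  rw [run]
  simp only [step, hXt, run_HR, gossip, sub_mix, mix_one, mix_add, mix_sub]
  module

lemma run_Hx_succ (k : ℕ) : (run A f X0 q (k + 1)).Hx = (run A f X0 q k).Hx
    + A.αx • scaledCompress (A.s k) (q k false) ((run A f X0 q k).X
          + localUpdate A.lam (run A f X0 q k).Y - (run A f X0 q k).Hx) := by
  have hXt : (fun i => (run A f X0 q k).X i - A.lam i • (run A f X0 q k).Y i)
      = (run A f X0 q k).X + localUpdate A.lam (run A f X0 q k).Y := by
    funext i; simp [localUpdate, sub_eq_add_neg]
  rw [run]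
  simp only [step, hXt]
  module

/-- The change of the local gradients in iteration `k`. -/
noncomputable def gradChange (k : ℕ) : Stack n p :=
  gradF f (run A f X0 q (k + 1)).X - gradF f (run A f X0 q k).X

lemma run_Y_succ (k : ℕ) : (run A f X0 q (k + 1)).Y
    = gossip A.C A.γy ((run A f X0 q k).Y + gradChange A f X0 q k)
      (scaledCompress (A.s k) (q k true) ((run A f X0 q k).Y
          + gradChange A f X0 q k - (run A f X0 q k).Hy)
        - ((run A f X0 q k).Y + gradChange A f X0 q k - (run A f X0 q k).Hy)) := by
  have h : (run A f X0 q k).Y + gradChange A f X0 q k = (run A f X0 q k).Y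
      + gradF f (step A f k (q k false) (q k true) (run A f X0 q k)).X
      - gradF f (run A f X0 q k).X := by rw [gradChange, run]; module
  rw [h, run]
  simp only [step, run_HC, gossip, sub_mix, mix_one, mix_add, mix_sub]
  module

lemma run_Hy_succ (k : ℕ) : (run A f X0 q (k + 1)).Hy = (run A f X0 q k).Hy
    + A.αy • scaledCompress (A.s k) (q k true) ((run A f X0 q k).Y
          + gradChange A f X0 q k - (run A f X0 q k).Hy) := by
  have h : (run A f X0 q k).Y + gradChange A f X0 q k = (run A f X0 q k).Y
      + gradF f (step A f k (q k false) (q k true) (run A f X0 q k)).X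
      - gradF f (run A f X0 q k).X := by rw [gradChange, run]; module
  rw [h, run]
  simp only [step]
  module

lemma sum_gossip_of_colStochastic {C : Matrix (Fin n) (Fin n) ℝ}
    (hC : C ∈ Matrix.colStochastic ℝ (Fin n)) (γ : ℝ) (U E : Stack n p) :
    ∑ i, gossip C γ U E i = ∑ i, U i := by
  have h : ∀ Z : Stack n p, ∑ i, mix (1 - C) Z i = 0 := by
    intro Z
    simp only [mix]
    rw [Finset.sum_comm]
    simp only [← Finset.sum_smul]
    refine Finset.sum_eq_zero fun j _ => ?_
    have : ∑ i, (1 - C) i j = 0 := by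
      simp [Matrix.sub_apply, Finset.sum_sub_distrib, Matrix.sum_col_of_mem_colStochastic hC,
        Matrix.one_apply]
    rw [this, zero_smul]
  simp only [gossip, Pi.sub_apply, Pi.smul_apply, Finset.sum_sub_distrib, ← Finset.smul_sum, h,
    smul_zero, sub_zero]

/-- The gradient trackers sum to the sum of the local gradients. -/
lemma sum_run_Y (hC : A.C ∈ Matrix.colStochastic ℝ (Fin n)) (k : ℕ) :
    ∑ i, (run A f X0 q k).Y i = ∑ i, gradF f (run A f X0 q k).X i := by
  induction k with
  | zero => rfl
  | succ k ih =>
    rw [run_Y_succ, sum_gossip_of_colStochastic hC]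
    simp only [Pi.add_apply, Finset.sum_add_distrib, gradChange, Pi.sub_apply,
      Finset.sum_sub_distrib, ih]
    exact add_sub_cancel _ _

/-- The weighted average is not affected by the compression. -/
lemma wavg_run_X_succ {uR : EuclideanSpace ℝ (Fin n)} (hu : IsLeftPerron A.R uR) (k : ℕ) :
    wavg uR (run A f X0 q (k + 1)).X = wavg uR (run A f X0 q k).X
      - (1 / (n : ℝ)) • ∑ i, (uR i * A.lam i) • (run A f X0 q k).Y i := by
  have h : ∀ Z : Stack n p, ∑ i, uR i • mix (1 - A.R) Z i = 0 := by
    intro Z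
    simp only [mix, Finset.smul_sum, smul_smul]
    rw [Finset.sum_comm]
    simp only [← Finset.sum_smul]
    refine Finset.sum_eq_zero fun j _ => ?_
    have : ∑ i, uR i * (1 - A.R) i j = 0 := by
      simp only [Matrix.sub_apply, mul_sub, Finset.sum_sub_distrib, hu.eigen]
      simp [Matrix.one_apply]
    rw [this, zero_smul]
  rw [run_X_succ, wavg, wavg, ← smul_sub]
  congr 1
  simp only [gossip, Pi.sub_apply, Pi.smul_apply, Pi.add_apply, smul_sub, smul_add,
    Finset.sum_sub_distrib, Finset.sum_add_distrib]
  have h2 : ∀ Z : Stack n p, ∑ i, uR i • A.γx • mix (1 - A.R) Z i = 0 := by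
    intro Z
    have : ∀ i, uR i • A.γx • mix (1 - A.R) Z i = A.γx • (uR i • mix (1 - A.R) Z i) :=
      fun i => smul_comm _ _ _
    simp only [this, ← Finset.smul_sum, h, smul_zero]
  rw [h2, sub_zero, sub_eq_add_neg, ← Finset.sum_neg_distrib]
  congr 1
  exact Finset.sum_congr rfl fun i _ => by simp [localUpdate, smul_smul]

end Run

/-! ### Measurability of the iterates in the seeds -/

section RunMeasurable

variable {n p : ℕ} {Ξ Ω : Type*}
  (A : Params n) (f : Fin n → Vec p → ℝ) (X0 : Stack n p) (comp : Ξ → Vec p → Vec p)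

lemma measurable_localUpdate {m : MeasurableSpace Ω} (lam : Fin n → ℝ) {Y : Ω → Stack n p}
    (hY : Measurable Y) : Measurable fun ω => localUpdate lam (Y ω) := by
  rw [measurable_pi_iff] at hY ⊢
  exact fun i => ((hY i).const_smul (lam i)).neg

lemma measurable_gradF {m : MeasurableSpace Ω} (hf : ∀ i, Continuous (gradient (f i)))
    {X : Ω → Stack n p} (hX : Measurable X) : Measurable fun ω => gradF f (X ω) := by
  rw [measurable_pi_iff] at hX ⊢
  exact fun i => (hf i).measurable.comp (hX i)

/-- Measurability of the variables kept by the algorithm. -/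
structure MeasurableState [m : MeasurableSpace Ω] (S : Ω → State n p) : Prop where
  X : Measurable fun ω => (S ω).X
  Y : Measurable fun ω => (S ω).Y
  Hx : Measurable fun ω => (S ω).Hx
  Hy : Measurable fun ω => (S ω).Hy

variable {A f X0 comp}

variable {m : MeasurableSpace Ω} {seed : ℕ → Bool → Fin n → Ω → Ξ} {k : ℕ}

lemma MeasurableState.pre_x
    (h : MeasurableState fun ω => run A f X0 (fun j b i => comp (seed j b i ω)) k) :
    Measurable fun ω => (run A f X0 (fun j b i => comp (seed j b i ω)) k).X
      + localUpdate A.lam (run A f X0 (fun j b i => comp (seed j b i ω)) k).Y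
      - (run A f X0 (fun j b i => comp (seed j b i ω)) k).Hx :=
  (h.X.add (measurable_localUpdate A.lam h.Y)).sub h.Hx

variable [MeasurableSpace Ξ]

lemma MeasurableState.X_succ (hcomp : Measurable (Function.uncurry comp))
    (h : MeasurableState fun ω => run A f X0 (fun j b i => comp (seed j b i ω)) k)
    (hs : ∀ i, Measurable (seed k false i)) :
    Measurable fun ω => (run A f X0 (fun j b i => comp (seed j b i ω)) (k + 1)).X := by
  simp only [run_X_succ]
  exact measurable_gossip _ _ (h.X.add (measurable_localUpdate A.lam h.Y))
    ((measurable_scaledCompress hcomp _ hs h.pre_x).sub h.pre_x)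

lemma MeasurableState.pre_y (hf : ∀ i, Continuous (gradient (f i)))
    (hcomp : Measurable (Function.uncurry comp))
    (h : MeasurableState fun ω => run A f X0 (fun j b i => comp (seed j b i ω)) k)
    (hs : ∀ i, Measurable (seed k false i)) :
    Measurable fun ω => (run A f X0 (fun j b i => comp (seed j b i ω)) k).Y
      + gradChange A f X0 (fun j b i => comp (seed j b i ω)) k
      - (run A f X0 (fun j b i => comp (seed j b i ω)) k).Hy :=
  (h.Y.add ((measurable_gradF f hf (h.X_succ hcomp hs)).sub (measurable_gradF f hf h.X))).sub h.Hy

lemma measurableState_run (hf : ∀ i, Continuous (gradient (f i)))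
    (hcomp : Measurable (Function.uncurry comp))
    (hs : ∀ j < k, ∀ b i, Measurable (seed j b i)) :
    MeasurableState fun ω => run A f X0 (fun j b i => comp (seed j b i ω)) k := by
  induction k with
  | zero => exact ⟨measurable_const, measurable_const, measurable_const, measurable_const⟩
  | succ k ih =>
    have h := ih fun j hj => hs j (hj.trans k.lt_succ_self)
    have hs0 := hs k k.lt_succ_self false
    have hs1 := hs k k.lt_succ_self true
    have hX := h.X_succ hcomp hs0
    have hpy := h.pre_y hf hcomp hs0
    refine ⟨hX, ?_, ?_, ?_⟩
    · simp only [run_Y_succ]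
      exact measurable_gossip _ _
        (h.Y.add ((measurable_gradF f hf hX).sub (measurable_gradF f hf h.X)))
        ((measurable_scaledCompress hcomp _ hs1 hpy).sub hpy)
    · simp only [run_Hx_succ]
      exact h.Hx.add ((measurable_scaledCompress hcomp _ hs0 h.pre_x).const_smul A.αx)
    · simp only [run_Hy_succ]
      exact h.Hy.add ((measurable_scaledCompress hcomp _ hs1 hpy).const_smul A.αy)

end RunMeasurable

/-! ### Independence of each compression round from its input -/

section RunIndep

variable {n p : ℕ} {Ξ Ω : Type*} [MeasurableSpace Ξ]
  {A : Params n} {f : Fin n → Vec p → ℝ} {X0 : Stack n p} {comp : Ξ → Vec p → Vec p}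
  {ν : Measure Ξ} {seed : ℕ → Bool → Fin n → Ω → Ξ}

/-- The σ-algebra generated by the seeds of the rounds in `S`. -/
abbrev seedAlgebra (seed : ℕ → Bool → Fin n → Ω → Ξ) (S : Set (ℕ × Bool)) : MeasurableSpace Ω :=
  ⨆ kb ∈ S, MeasurableSpace.comap (fun ω i => seed kb.1 kb.2 i ω) inferInstance

lemma measurable_seedAlgebra {S : Set (ℕ × Bool)} {k : ℕ} {b : Bool} (h : (k, b) ∈ S) (i : Fin n) :
    Measurable[seedAlgebra seed S] (seed k b i) := by
  have h1 : Measurable[seedAlgebra seed S] fun ω i => seed k b i ω :=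
    (comap_measurable (fun ω i => seed k b i ω)).mono
      (le_iSup₂_of_le (f := fun (kb : ℕ × Bool) (_ : kb ∈ S) =>
        MeasurableSpace.comap (fun ω i => seed kb.1 kb.2 i ω) inferInstance) (k, b) h le_rfl) le_rfl
  exact (measurable_pi_apply i).comp h1

variable [MeasurableSpace Ω] {P : Measure Ω}

/-- Disjoint families of independent rounds generate independent σ-algebras, so anything computed
from the rounds in `S` is independent of a round outside `S`. -/
lemma FreshSeeds.indepFun (h : FreshSeeds ν P seed) {S : Set (ℕ × Bool)} {k : ℕ} {b : Bool}
    (hS : (k, b) ∉ S) {Z : Ω → Stack n p} (hZ : Measurable[seedAlgebra seed S] Z) :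
    IndepFun Z (fun ω i => seed k b i ω) P := by
  have hle : ∀ kb : ℕ × Bool, MeasurableSpace.comap (fun ω i => seed kb.1 kb.2 i ω)
      (inferInstance : MeasurableSpace (Fin n → Ξ)) ≤ (inferInstance : MeasurableSpace Ω) :=
    fun kb => (measurable_pi_iff.2 fun i => h.measurable kb.1 kb.2 i).comap_le
  have h1 := indep_iSup_of_disjoint hle h.indep
    (Set.disjoint_singleton_right.2 hS : Disjoint S {(k, b)})
  rw [iSup_singleton] at h1
  rw [IndepFun_iff_Indep]
  exact indep_of_indep_of_le_left h1 hZ.comap_le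

lemma FreshSeeds.indep_pre_x (h : FreshSeeds ν P seed) (hf : ∀ i, Continuous (gradient (f i)))
    (hcomp : Measurable (Function.uncurry comp)) (k : ℕ) :
    IndepFun (fun ω => (run A f X0 (fun j b i => comp (seed j b i ω)) k).X
      + localUpdate A.lam (run A f X0 (fun j b i => comp (seed j b i ω)) k).Y
      - (run A f X0 (fun j b i => comp (seed j b i ω)) k).Hx) (fun ω i => seed k false i ω) P := by
  refine h.indepFun (S := {kb | kb.1 < k}) (by simp) ?_
  refine MeasurableState.pre_x (m := seedAlgebra seed {kb | kb.1 < k}) ?_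
  exact measurableState_run (m := seedAlgebra seed {kb | kb.1 < k}) hf hcomp
    fun j hj b i => measurable_seedAlgebra (by simpa using hj) i

/-- The tracker compresses after the decision variables of the same iteration have moved, so its
past includes the round `(k, false)` besides all earlier iterations. -/
lemma FreshSeeds.indep_pre_y (h : FreshSeeds ν P seed) (hf : ∀ i, Continuous (gradient (f i)))
    (hcomp : Measurable (Function.uncurry comp)) (k : ℕ) :
    IndepFun (fun ω => (run A f X0 (fun j b i => comp (seed j b i ω)) k).Y
      + gradChange A f X0 (fun j b i => comp (seed j b i ω)) k
      - (run A f X0 (fun j b i => comp (seed j b i ω)) k).Hy) (fun ω i => seed k true i ω) P := by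
  refine h.indepFun (S := {kb | kb.1 < k ∨ kb = (k, false)}) (by simp) ?_
  refine MeasurableState.pre_y (m := seedAlgebra seed {kb | kb.1 < k ∨ kb = (k, false)}) hf hcomp
    ?_ fun i => measurable_seedAlgebra (by simp) i
  exact measurableState_run (m := seedAlgebra seed {kb | kb.1 < k ∨ kb = (k, false)}) hf hcomp
    fun j hj b i => measurable_seedAlgebra (Or.inl hj) i

end RunIndep

/-! ### Moments of the trajectories -/

section Moments

variable {n p : ℕ} {Ξ Ω : Type*} [MeasurableSpace Ω] {P : Measure Ω}

lemma integral_le_four {f f₁ f₂ f₃ f₄ : Ω → ℝ} (h : Integrable f P) (h₁ : Integrable f₁ P)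
    (h₂ : Integrable f₂ P) (h₃ : Integrable f₃ P) (h₄ : Integrable f₄ P) {a b c d : ℝ}
    (hle : ∀ ω, f ω ≤ a * f₁ ω + b * f₂ ω + c * f₃ ω + d * f₄ ω) :
    ∫ ω, f ω ∂P
      ≤ a * ∫ ω, f₁ ω ∂P + b * ∫ ω, f₂ ω ∂P + c * ∫ ω, f₃ ω ∂P + d * ∫ ω, f₄ ω ∂P := by
  have h12 := (h₁.const_mul a).add (h₂.const_mul b)
  have := integral_le_three h h12 h₃ h₄ (a := 1) (b := c) (c := d) fun ω => by
    simpa only [one_mul, Pi.add_apply] using hle ω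
  rw [one_mul] at this
  refine this.trans (le_of_eq ?_)
  rw [← integral_const_mul a, ← integral_const_mul b, ← integral_add (h₁.const_mul a)
    (h₂.const_mul b)]
  rfl

/-- Square integrability of the variables kept by the algorithm. -/
structure SqIntState (P : Measure Ω) (S : Ω → State n p) : Prop where
  X : SqInt P fun ω => (S ω).X
  Y : SqInt P fun ω => (S ω).Y
  Hx : SqInt P fun ω => (S ω).Hx
  Hy : SqInt P fun ω => (S ω).Hy

lemma SqInt.localUpdate {Y : Ω → Stack n p} (hY : SqInt P Y) (lam : Fin n → ℝ) :
    SqInt P fun ω => localUpdate lam (Y ω) := fun i => ((hY i).const_smul (lam i)).neg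

variable [IsProbabilityMeasure P] {A : Params n} {f : Fin n → Vec p → ℝ} {X0 : Stack n p}
  {comp : Ξ → Vec p → Vec p} {seed : ℕ → Bool → Fin n → Ω → Ξ}

lemma sqIntState_zero :
    SqIntState P fun ω => run A f X0 (fun j b i => comp (seed j b i ω)) 0 :=
  ⟨fun _ => memLp_const _, fun _ => memLp_const _, fun _ => memLp_const _, fun _ => memLp_const _⟩

variable [MeasurableSpace Ξ] {ν : Measure Ξ} [IsProbabilityMeasure ν] {Cq σ r δ σr L : ℝ}

/-- The estimates on one iteration. -/
theorem run_bounds [NeZero n] (hC : CompressionAssumption ν comp Cq σ r δ σr)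
    (hseed : FreshSeeds ν P seed)
    (hL : ∀ i x y, ‖gradient (f i) x - gradient (f i) y‖ ≤ L * ‖x - y‖)
    (hf : ∀ i, Continuous (gradient (f i)))
    {PR TR PC TC : Matrix (Fin n) (Fin n) ℝ} {δR θR δC θC : ℝ}
    (hTR : IsAdaptedNorm A.R PR TR δR θR A.γx) (hTC : IsAdaptedNorm A.C PC TC δC θC A.γy)
    (hPR : PR * PR = PR) (hRP : (1 - A.R) * PR = 1 - A.R)
    (hPC : PC * PC = PC) (hCP : (1 - A.C) * PC = 1 - A.C)
    (hγx : 0 < A.γx) (hγy : 0 < A.γy) (hαx : 0 < A.αx) (hαxr : A.αx ≤ 1 / r)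
    (hαy : 0 < A.αy) (hαyr : A.αy ≤ 1 / r) (hs : ∀ k, A.s k ≠ 0) (k : ℕ) :
    let S : ℕ → Ω → State n p := fun k ω => run A f X0 (fun j b i => comp (seed j b i ω)) k
    let D : Ω → Stack n p := fun ω => gradChange A f X0 (fun j b i => comp (seed j b i ω)) k
    SqIntState P (S k) → SqIntState P (S (k + 1)) ∧
    (∃ x, GossipBounds (∫ ω, nrm TR (mix PR (S k ω).X) ^ 2 ∂P)
      (∫ ω, nrm 1 ((S k ω).X - (S k ω).Hx) ^ 2 ∂P)
      (∫ ω, nrm 1 (localUpdate A.lam (S k ω).Y) ^ 2 ∂P) x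
      (∫ ω, nrm TR (mix PR (S (k + 1) ω).X) ^ 2 ∂P)
      (∫ ω, nrm 1 ((S (k + 1) ω).X - (S (k + 1) ω).Hx) ^ 2 ∂P)
      (∫ ω, nrm 1 ((S (k + 1) ω).X - (S k ω).X) ^ 2 ∂P) Cq θR A.γx δR (A.αx * r * δ)
      (n * (A.s k ^ 2 * σ ^ 2)) (n * (A.αx * r * (A.s k ^ 2 * σr ^ 2)))) ∧
    (∃ x w, GossipBounds (∫ ω, nrm TC (mix PC (S k ω).Y) ^ 2 ∂P)
      (∫ ω, nrm 1 ((S k ω).Y - (S k ω).Hy) ^ 2 ∂P)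
      (∫ ω, nrm 1 (D ω) ^ 2 ∂P) x
      (∫ ω, nrm TC (mix PC (S (k + 1) ω).Y) ^ 2 ∂P)
      (∫ ω, nrm 1 ((S (k + 1) ω).Y - (S (k + 1) ω).Hy) ^ 2 ∂P) w Cq θC A.γy δC (A.αy * r * δ)
      (n * (A.s k ^ 2 * σ ^ 2)) (n * (A.αy * r * (A.s k ^ 2 * σr ^ 2)))) ∧
    ∫ ω, nrm 1 (D ω) ^ 2 ∂P ≤ L ^ 2 * ∫ ω, nrm 1 ((S (k + 1) ω).X - (S k ω).X) ^ 2 ∂P := by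
  intro S D hS
  have hmeas : MeasurableState (S k) :=
    measurableState_run hf hC.measurable fun j _ b i => hseed.measurable j b i
  obtain ⟨⟨hX', hHx'⟩, hx⟩ := gossip_bounds hC hTR hPR hRP hγx (hs k)
    (fun i => hseed.measurable k false i) (fun i => hseed.law k false i) hαx hαxr
    hS.X (hS.Y.localUpdate A.lam) hS.Hx hmeas.pre_x (fun _ => rfl)
    (hseed.indep_pre_x hf hC.measurable k) (fun _ => rfl)
    (U' := fun ω => (S (k + 1) ω).X) (H' := fun ω => (S (k + 1) ω).Hx)
    (fun ω => run_X_succ A f X0 _ k) (fun ω => run_Hx_succ A f X0 _ k)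
  have hD : SqInt P D := (hX'.gradF hL).sub (hS.X.gradF hL)
  obtain ⟨⟨hY', hHy'⟩, hy⟩ := gossip_bounds hC hTC hPC hCP hγy (hs k)
    (fun i => hseed.measurable k true i) (fun i => hseed.law k true i) hαy hαyr
    hS.Y hD hS.Hy (hmeas.pre_y hf hC.measurable fun i => hseed.measurable k false i)
    (fun _ => rfl) (hseed.indep_pre_y hf hC.measurable k) (fun _ => rfl)
    (U' := fun ω => (S (k + 1) ω).Y) (H' := fun ω => (S (k + 1) ω).Hy)
    (fun ω => run_Y_succ A f X0 _ k) (fun ω => run_Hy_succ A f X0 _ k)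
  refine ⟨⟨hX', hY', hHx', hHy'⟩, ⟨_, hx⟩, ⟨_, _, hy⟩, ?_⟩
  rw [← integral_const_mul]
  exact integral_mono (hD.integrable_nrm_sq 1) (((hX'.sub hS.X).integrable_nrm_sq 1).const_mul _)
    fun ω => nrm_gradF_sub_sq_le hL _ _

/-- The error is nonnegative and, by smoothness at the minimizer, at most quadratic in the distance
to it. -/
lemma integrable_optErr [NeZero n] (hf : ∀ i, Differentiable ℝ (f i))
    (hL : ∀ i x y, ‖gradient (f i) x - gradient (f i) y‖ ≤ L * ‖x - y‖) {xs : Vec p}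
    (hmin : ∀ x, avgObj f xs ≤ avgObj f x) {X : Ω → Vec p} (hX : MemLp X 2 P) :
    Integrable (fun ω => avgObj f (X ω) - avgObj f xs) P := by
  have h1 : Integrable (fun ω => L / 2 * ‖X ω - xs‖ ^ 2) P :=
    ((hX.sub (memLp_const xs)).integrable_norm_pow two_ne_zero).const_mul _
  refine h1.mono' (((differentiable_avgObj hf).continuous.comp_aestronglyMeasurable hX.1).sub
    aestronglyMeasurable_const) (Eventually.of_forall fun ω => ?_)
  rw [Real.norm_of_nonneg (sub_nonneg.2 (hmin _))]
  exact avgObj_sub_min_le hf hL hmin _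

end Moments

/-! ### Choice of the Lyapunov weights and the geometric bound -/

section Main

variable {n p : ℕ}

lemma exists_eigenvectors_and_norms [NeZero n] {R C : Matrix (Fin n) (Fin n) ℝ}
    (hnet : NetworkAssumption R C) :
    ∃ (uR uC : EuclideanSpace ℝ (Fin n)) (Rt Ct : Matrix (Fin n) (Fin n) ℝ) (δR δC θR θC : ℝ),
      IsLeftPerron R uR ∧ IsRightPerron C uC ∧
      ∀ γ : ℝ, 0 < γ → γ ≤ 1 / 2 →
        IsAdaptedNorm R (projR uR) Rt δR θR γ ∧ IsAdaptedNorm C (projC uC) Ct δC θC γ := by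
  have hn := Nat.pos_of_neZero n
  obtain ⟨i, hiR, hiC⟩ := hnet.common_root
  obtain ⟨uR, huR⟩ := exists_isLeftPerron hn hnet.row_stochastic
  obtain ⟨uC, huC⟩ := exists_isRightPerron hn hnet.col_stochastic
  obtain ⟨Rt, δR, θR, hR⟩ := exists_adaptedNorm_projR hn hnet.row_stochastic hiR huR
  obtain ⟨Ct, δC, θC, hC⟩ := exists_adaptedNorm_projC hn hnet.col_stochastic hiC huC
  exact ⟨uR, uC, Rt, Ct, δR, δC, θR, θC, huR, huC, fun γ h0 h1 => ⟨hR γ h0 h1, hC γ h0 h1⟩⟩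

lemma one_sub_mul_projR {A : Matrix (Fin n) (Fin n) ℝ} (hA : A ∈ Matrix.rowStochastic ℝ (Fin n))
    (u : EuclideanSpace ℝ (Fin n)) : (1 - A) * projR u = 1 - A := by
  have h := mul_one_sub_projR hA u
  have : (1 - A) * (1 - projR u) = 0 := by rw [Matrix.sub_mul, one_mul, h, sub_self]
  rw [Matrix.mul_sub, mul_one, sub_eq_zero] at this
  exact this.symm

lemma one_sub_mul_projC {A : Matrix (Fin n) (Fin n) ℝ} {u : EuclideanSpace ℝ (Fin n)}
    (hu : IsRightPerron A u) : (1 - A) * projC u = 1 - A := by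
  have h : A * (1 - projC u) = 1 - projC u := by
    ext i j
    simp only [projC, sub_sub_cancel, Matrix.mul_apply, Matrix.of_apply]
    rw [← hu.eigen i, Finset.sum_div]
    exact Finset.sum_congr rfl fun k _ => by ring
  have : (1 - A) * (1 - projC u) = 0 := by rw [Matrix.sub_mul, one_mul, h, sub_self]
  rw [Matrix.mul_sub, mul_one, sub_eq_zero] at this
  exact this.symm

lemma projC_mul_self (hn : 0 < n) {u : EuclideanSpace ℝ (Fin n)} (hu : ∑ i, u i = n) :
    projC u * projC u = projC u := by
  rw [← transpose_projR, ← Matrix.transpose_mul, projR_mul_self hn hu]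

variable {Ξ Ω : Type*} [MeasurableSpace Ξ] [MeasurableSpace Ω]

lemma nrm_localUpdate_sq (lam : Fin n → ℝ) (Y : Stack n p) :
    nrm 1 (localUpdate lam Y) ^ 2 = nrm 1 (fun i => lam i • Y i) ^ 2 := by
  rw [nrm_one_sq, nrm_one_sq]
  exact Finset.sum_congr rfl fun i _ => by simp [localUpdate]

set_option maxHeartbeats 1600000 in
/-- Geometric decay of the optimization and consensus errors. -/
theorem exists_geometric_bound [NeZero n] {A : Params n} (hRs : A.R ∈ Matrix.rowStochastic ℝ (Fin n))
    (hCs : A.C ∈ Matrix.colStochastic ℝ (Fin n))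
    {uR uC : EuclideanSpace ℝ (Fin n)} {Rt Ct : Matrix (Fin n) (Fin n) ℝ} {δR δC θR θC : ℝ}
    {f : Fin n → Vec p → ℝ} {Lip : Fin n → ℝ≥0} {xs : Vec p} {μ : ℝ}
    {ν : Measure Ξ} [IsProbabilityMeasure ν] {comp : Ξ → Vec p → Vec p} {Cq σ r δ σr : ℝ}
    {P : Measure Ω} [IsProbabilityMeasure P] {seed : ℕ → Bool → Fin n → Ω → Ξ}
    (X0 : Stack n p) {M c c₀ : ℝ}
    (huR : IsLeftPerron A.R uR) (huC : IsRightPerron A.C uC)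
    (hTR : IsAdaptedNorm A.R (projR uR) Rt δR θR A.γx)
    (hTC : IsAdaptedNorm A.C (projC uC) Ct δC θC A.γy)
    (hsm : SmoothAssumption f Lip) (hmin : ∀ x, avgObj f xs ≤ avgObj f x)
    (hPL : PLCondition (avgObj f) xs μ) (hC : CompressionAssumption ν comp Cq σ r δ σr)
    (hseed : FreshSeeds ν P seed)
    (hαx : 0 < A.αx) (hαxr : A.αx ≤ 1 / r) (hαy : 0 < A.αy) (hαyr : A.αy ≤ 1 / r)
    (hlam : ∀ i, 0 ≤ A.lam i) (hM : 0 < M) (hMl : M * maxStep A.lam ≤ avgStep uR uC A.lam)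
    (hss : StepSizeConditions uR uC δR δC θR θC (maxLip Lip) Cq r δ M
      (maxStep A.lam) A.αx A.αy A.γx A.γy)
    (hρc : rhoTilde M (maxStep A.lam) μ θR θC r δ A.αx A.αy A.γx A.γy < c) (hc1 : c < 1)
    (hc₀ : 0 < c₀) (hs : ∀ k, A.s k ^ 2 = c₀ * c ^ k) :
    let X : ℕ → Ω → Stack n p := iterX A f X0 comp seed
    (∀ k, Integrable (fun ω => avgObj f (wavg uR (X k ω)) - avgObj f xs) P) ∧
    (∀ k, Integrable (fun ω => wsq Rt (mix (projR uR) (X k ω))) P) ∧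
    ∃ B, 0 < c ∧ (∀ k, ∫ ω, (avgObj f (wavg uR (X k ω)) - avgObj f xs) ∂P ≤ B * c ^ k) ∧
      ∀ k, ∫ ω, wsq Rt (mix (projR uR) (X k ω)) ∂P ≤ B * c ^ k := by
  intro X
  have hn : (0 : ℝ) < n := by exact_mod_cast Nat.pos_of_neZero n
  set l := maxStep A.lam with hl
  set ρ := rhoTilde M l μ θR θC r δ A.αx A.αy A.γx A.γy with hρ
  have hγx := hss.γx_pos
  have hγy := hss.γy_pos
  have hθR := hTR.theta_pos
  have hθC := hTC.theta_pos
  have hδR := hTR.one_le_upper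
  have hδC := hTC.one_le_upper
  have hCq := hC.C_nonneg
  have hr := hC.r_pos
  have hδ := hC.delta_pos
  -- the contraction factors
  have ρ₁ : 1 - 1 / 2 * M * l * μ ≤ ρ := le_max_left _ _
  have ρ₂ : 1 - θR * A.γx / 16 ≤ ρ := (le_max_left _ _).trans (le_max_right _ _)
  have ρ₃ : 1 - θC * A.γy / 8 ≤ ρ :=
    (le_max_left _ _).trans ((le_max_right _ _).trans (le_max_right _ _))
  have ρ₄ : 1 - A.αx * r * δ / 4 ≤ ρ := (le_max_left _ _).trans
    ((le_max_right _ _).trans ((le_max_right _ _).trans (le_max_right _ _)))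
  have ρ₅ : 1 - A.αy * r * δ / 16 ≤ ρ := (le_max_right _ _).trans
    ((le_max_right _ _).trans ((le_max_right _ _).trans (le_max_right _ _)))
  have hθγC : θC * A.γy ≤ 1 := hTC.theta_mul_le_one
  have hθγR : θR * A.γx ≤ 1 := hTR.theta_mul_le_one
  have hρ0 : 0 ≤ ρ := by linarith
  have hc : 0 < c := hρ0.trans_lt hρc
  -- If `λ̂` were not positive, the first entry of `ρ̃` would be at least `1`, against `ρ̃ < c < 1`.
  have hlpos : 0 < l := by
    by_contra! h
    have : M * l * μ ≤ 0 :=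
      mul_nonpos_of_nonpos_of_nonneg (mul_nonpos_of_nonneg_of_nonpos hM.le h) hPL.1.le
    linarith
  have hlaml : ∀ i, A.lam i ≤ l := fun i => le_ciSup (Finite.bddAbove_range A.lam) i
  have hrate : ∀ α, 0 < α → α ≤ 1 / r → 0 < α * r * δ ∧ α * r * δ ≤ 1 := by
    intro α h0 h1
    rw [le_div_iff₀ hr] at h1
    exact ⟨by positivity, mul_le_one₀ h1 hδ.le hC.delta_le_one⟩
  obtain ⟨ht, ht1⟩ := hrate A.αx hαx hαxr
  obtain ⟨ht₂, ht₂1⟩ := hrate A.αy hαy hαyr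
  -- the weights
  have hRpos := norm_perron_pos huR.sum_eq
  have hCpos := norm_perron_pos huC.sum_eq
  have hrδ := hTR.norm_sq_le_projR huR.sum_eq
  have hcδ := hTC.norm_sq_le_projC huC.sum_eq
  -- Follows from `M λ̂ ≤ λ̄ ≤ λ̂ ‖u_R‖ ‖u_C‖ / n`, the second step by Cauchy–Schwarz.
  have hMN : M * n ≤ ‖uR‖ * ‖uC‖ := by
    have h1 := hMl.trans (avgStep_le huR.nonneg huC.nonneg hlaml hlpos.le)
    have h2 : M ≤ ‖uR‖ * ‖uC‖ / n := by
      rw [mul_comm] at h1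
      exact le_of_mul_le_mul_left h1 hlpos
    rwa [le_div_iff₀ hn] at h2
  have hγγ := hss.sq_gamma_x_le hM.le hCq hδC hRpos
  -- From `hγγ`, `M n ≤ ‖u_R‖ ‖u_C‖` and `‖u_C‖² ≤ n δC²`. It bounds `1 - θR γx` away from zero, so
  -- the divisions in `e₃` are genuine.
  have hγ216 : 216 * A.γx ^ 2 ≤ 1 := by
    have h1 : (θC * A.γy) ^ 2 ≤ 1 := pow_le_one₀ (by positivity) hθγC
    have h2 : M * ‖uC‖ * n ≤ ‖uR‖ * δC ^ 2 * n := by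
      calc M * ‖uC‖ * n = M * n * ‖uC‖ := by ring
        _ ≤ ‖uR‖ * ‖uC‖ * ‖uC‖ := by gcongr
        _ = ‖uR‖ * ‖uC‖ ^ 2 := by ring
        _ ≤ ‖uR‖ * (n * δC ^ 2) := by gcongr
        _ = _ := by ring
    have h3 := le_of_mul_le_mul_right h2 hn
    have h4 : 216 * A.γx ^ 2 * (‖uR‖ * δC ^ 2) ≤ 1 * (‖uR‖ * δC ^ 2) := by
      have := mul_le_mul_of_nonneg_left h1 (show 0 ≤ M * ‖uC‖ by positivity)
      linarith
    exact le_of_mul_le_mul_right h4 (by positivity)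
  have hq : θR * A.γx ≤ 0.08 := by
    have h1 : A.γx ≤ 0.08 := by
      by_contra! h
      nlinarith
    nlinarith [hTR.theta_le_one]
  set E := cE uR uC M with hE
  have hE' : E = ‖uR‖ * ‖uC‖ / ((n : ℝ) ^ 2 * M) := rfl
  have hEpos : 0 < E := by rw [hE']; positivity
  -- a positive Lipschitz constant
  have hq0 : 0 < 1 - θR * A.γx := by linarith
  have he₃ : 0 < e₃ δR θR A.γx := by
    rw [e₃]; exact lt_min (by positivity) one_pos
  set ℓ := e₃ δR θR A.γx * A.γx / (√(96 * E) * ‖uC‖) with hℓ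
  -- Every constant above `maxLip` is a Lipschitz constant too. The one that turns `lam₅` into an
  -- equality is positive even if the gradients are constant, which keeps all Lyapunov weights
  -- positive.
  set L := ℓ / l with hLdef
  have hℓpos : 0 < ℓ := by rw [hℓ]; positivity
  have hLpos : 0 < L := by rw [hLdef]; positivity
  have hlL : l * L = ℓ := by rw [hLdef]; field_simp
  have hLip : maxLip Lip ≤ L := by
    rw [hLdef, le_div_iff₀ hlpos, mul_comm]
    exact hss.lam₅
  have hLgrad : ∀ i x y, ‖gradient (f i) x - gradient (f i) y‖ ≤ L * ‖x - y‖ := by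
    intro i x y
    have h1 := (hsm i).2.dist_le_mul x y
    rw [dist_eq_norm, dist_eq_norm] at h1
    refine h1.trans (mul_le_mul_of_nonneg_right (le_trans ?_ hLip) (norm_nonneg _))
    exact le_ciSup (Finite.bddAbove_range fun i => (Lip i : ℝ)) i
  have hdiff : ∀ i, Differentiable ℝ (f i) := fun i => (hsm i).1
  have hcont : ∀ i, Continuous (gradient (f i)) := fun i => (hsm i).2.continuous
  have hLsq : 384 * (l * L) ^ 2 * E * ‖uC‖ ^ 2 * δR ^ 2 * (1 - θR * A.γx) ^ 2
      ≤ (θR * A.γx) ^ 2 := by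
    have h1 : e₃ δR θR A.γx ≤ 1 / (2 * δR) * (θR / (1 - θR * A.γx)) := min_le_left _ _
    have h2 : 2 * δR * (1 - θR * A.γx) * e₃ δR θR A.γx ≤ θR := by
      refine (mul_le_mul_of_nonneg_left h1 (by positivity)).trans (le_of_eq ?_)
      field_simp
    have h3 := pow_le_pow_left₀ (by positivity) h2 2
    have h4 : ℓ ^ 2 * (96 * E * ‖uC‖ ^ 2) = (e₃ δR θR A.γx * A.γx) ^ 2 := by
      rw [hℓ, div_pow, mul_pow (√(96 * E)), Real.sq_sqrt (by positivity)]
      field_simp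
    have h5 := mul_le_mul_of_nonneg_right h3 (sq_nonneg A.γx)
    rw [hlL]
    calc _ = 4 * δR ^ 2 * (1 - θR * A.γx) ^ 2 * (ℓ ^ 2 * (96 * E * ‖uC‖ ^ 2)) := by ring
      _ = (2 * δR * (1 - θR * A.γx) * e₃ δR θR A.γx) ^ 2 * A.γx ^ 2 := by rw [h4]; ring
      _ ≤ _ := by rw [mul_pow θR]; exact h5
  -- `wP` and `wQ` dominate the coefficients of the consensus and tracking errors in
  -- `objective_descent`. The weights `ux` and `uy` then make the decay of these errors about `4 wP`
  -- and `2 wQ`.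
  set wP := l * L ^ 2 * M * E with hwP
  set wQ := l * E * (‖uR‖ / ‖uC‖) with hwQ
  set ux := 4 * wP / (θR * A.γx) ^ 2 with hux
  set uy := 2 * wQ / (θC * A.γy) ^ 2 with huy
  have hwPpos : 0 < wP := by rw [hwP]; positivity
  have hwQpos : 0 < wQ := by rw [hwQ]; positivity
  have huxpos : 0 < ux := by rw [hux]; positivity
  have huypos : 0 < uy := by rw [huy]; positivity
  obtain ⟨hF₁, hF₂, hF₃, hF₄, hF₅⟩ := coefficient_bounds hn hRpos hCpos hδR hθR hTR.theta_le_one hθC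
    hM hlpos hγx hγy hMN hrδ hγ216 hγγ hE' hLsq hwP hwQ hux huy
  have hstep : avgStep uR uC A.lam * L ≤ 1 := by
    have h1 := mul_le_mul_of_nonneg_right
      (avgStep_le huR.nonneg huC.nonneg hlaml hlpos.le) hLpos.le
    exact h1.trans ((sq_le_one_iff₀ (by positivity)).1 hF₅)
  -- The relative compression noise let in by gossip, measured against the squared compression rate;
  -- it scales the weight of the compression error and vanishes with `Cq`.
  set y := A.γx ^ 2 * δR ^ 2 * Cq / (A.αx * r * δ) ^ 2 with hy
  set y₂ := A.γy ^ 2 * δC ^ 2 * Cq / (A.αy * r * δ) ^ 2 with hy₂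
  have hyC : y * (A.αx * r * δ) ^ 2 = A.γx ^ 2 * δR ^ 2 * Cq :=
    div_mul_cancel₀ _ (by positivity)
  have hy₂C : y₂ * (A.αy * r * δ) ^ 2 = A.γy ^ 2 * δC ^ 2 * Cq :=
    div_mul_cancel₀ _ (by positivity)
  have hyθ : 373248 * y ≤ θR ^ 2 := by
    rw [hy, mul_div_assoc', div_le_iff₀ (by positivity)]
    exact hss.compression_x hCq hδR ht.le
  have hy₂θ : 373248 * y₂ ≤ θC ^ 2 := by
    rw [hy₂, mul_div_assoc', div_le_iff₀ (by positivity)]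
    exact hss.compression_y hCq hδC hθC
  have hy0 : 0 ≤ y := by positivity
  have hy₂0 : 0 ≤ y₂ := by positivity
  have hyδ : 1728 * y ≤ δR ^ 2 := by
    have h1 : θR ^ 2 ≤ 1 := pow_le_one₀ hθR.le hTR.theta_le_one
    have h2 : 1 ≤ δR ^ 2 := one_le_pow₀ hδR
    linarith
  have hy₂δ : 1728 * y₂ ≤ δC ^ 2 := by
    have h1 : θC ^ 2 ≤ 1 := pow_le_one₀ hθC.le hTC.theta_le_one
    have h2 : 1 ≤ δC ^ 2 := one_le_pow₀ hδC
    linarith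
  -- the trajectories
  have hs0 : ∀ k, A.s k ≠ 0 := fun k h => by
    have h1 := hs k
    rw [h] at h1
    have : 0 < c₀ * c ^ k := by positivity
    simp at h1
    rcases h1 with h1 | h1
    · exact hc₀.ne' h1
    · exact hc.ne' h1.1
  set S : ℕ → Ω → State n p := fun k ω => run A f X0 (fun j b i => comp (seed j b i ω)) k with hS
  have hrun := fun k => run_bounds (X0 := X0) hC hseed hLgrad hcont hTR hTC
    (projR_mul_self (Nat.pos_of_neZero n) huR.sum_eq) (one_sub_mul_projR hRs uR)
    (projC_mul_self (Nat.pos_of_neZero n) huC.sum_eq) (one_sub_mul_projC huC) hγx hγy hαx hαxr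
    hαy hαyr hs0 k
  have hsq : ∀ k, SqIntState P (S k) := by
    intro k
    induction k with
    | zero => exact sqIntState_zero
    | succ k ih => exact (hrun k ih).1
  have hoint : ∀ k, Integrable (fun ω => avgObj f (wavg uR (S k ω).X) - avgObj f xs) P :=
    fun k => integrable_optErr hdiff hLgrad hmin ((hsq k).X.wavg uR)
  have haint : ∀ k, Integrable (fun ω => nrm Rt (mix (projR uR) (S k ω).X) ^ 2) P :=
    fun k => ((hsq k).X.mix _).integrable_nrm_sq Rt
  have hgint : ∀ k, Integrable (fun ω => nrm Ct (mix (projC uC) (S k ω).Y) ^ 2) P :=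
    fun k => ((hsq k).Y.mix _).integrable_nrm_sq Ct
  have hGint : ∀ k, Integrable (fun ω => ‖gradient (avgObj f) (wavg uR (S k ω).X)‖ ^ 2) P :=
    fun k => (memLp_gradient (norm_gradient_avgObj_sub_le hdiff hLgrad)
      ((hsq k).X.wavg uR)).integrable_norm_pow two_ne_zero
  have hdint : ∀ k, Integrable (fun ω => nrm 1 (localUpdate A.lam (S k ω).Y) ^ 2) P :=
    fun k => ((hsq k).Y.localUpdate A.lam).integrable_nrm_sq 1
  have hsumY : ∀ k ω, ∑ i, (S k ω).Y i = ∑ i, gradF f (S k ω).X i :=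
    fun k ω => sum_run_Y A f X0 _ hCs k
  have hna : ∀ k ω, nrm 1 (mix (projR uR) (S k ω).X) ^ 2 ≤ nrm Rt (mix (projR uR) (S k ω).X) ^ 2 :=
    fun k ω => pow_le_pow_left₀ (nrm_nonneg _ _) (hTR.nrm_one_le _) 2
  have hng : ∀ k ω, nrm 1 (mix (projC uC) (S k ω).Y) ^ 2 ≤ nrm Ct (mix (projC uC) (S k ω).Y) ^ 2 :=
    fun k ω => pow_le_pow_left₀ (nrm_nonneg _ _) (hTC.nrm_one_le _) 2
  -- descent of the objective
  have ho : ∀ k, ∫ ω, (avgObj f (wavg uR (S (k + 1) ω).X) - avgObj f xs) ∂P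
      ≤ (1 - 1 / 2 * M * l * μ) * ∫ ω, (avgObj f (wavg uR (S k ω).X) - avgObj f xs) ∂P
        - M * l / 4 * ∫ ω, ‖gradient (avgObj f) (wavg uR (S k ω).X)‖ ^ 2 ∂P
        + wP * ∫ ω, nrm Rt (mix (projR uR) (S k ω).X) ^ 2 ∂P
        + wQ * ∫ ω, nrm Ct (mix (projC uC) (S k ω).Y) ^ 2 ∂P := by
    intro k
    have := integral_le_four (hoint (k + 1)) (hoint k) (hGint k) (haint k) (hgint k)
      (a := 1 - 1 / 2 * M * l * μ) (b := -(M * l / 4)) (c := wP) (d := wQ) fun ω => ?_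
    · linarith
    have h1 := objective_descent hdiff hLgrad hPL hmin uR uC hlam hlaml hlpos hM hMl hstep
      (hsumY k ω)
    rw [← wavg_run_X_succ A f X0 _ huR k] at h1
    have h2 : avgStep uR uC A.lam * (L ^ 2 / n) * nrm 1 (mix (projR uR) (S k ω).X) ^ 2
        ≤ wP * nrm Rt (mix (projR uR) (S k ω).X) ^ 2 := by
      refine mul_le_mul ?_ (hna k ω) (sq_nonneg _) hwPpos.le
      have h3 := mul_le_mul_of_nonneg_right (avgStep_le huR.nonneg huC.nonneg hlaml hlpos.le)
        (show 0 ≤ L ^ 2 / n by positivity)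
      refine h3.trans (le_of_eq ?_)
      rw [hwP, hE']; field_simp
    have h4 : l * (‖uR‖ ^ 2 / (n ^ 2 * M)) * nrm 1 (mix (projC uC) (S k ω).Y) ^ 2
        ≤ wQ * nrm Ct (mix (projC uC) (S k ω).Y) ^ 2 := by
      refine mul_le_mul (le_of_eq ?_) (hng k ω) (sq_nonneg _) hwQpos.le
      rw [hwQ, hE']; field_simp
    linarith
  -- the local updates
  have hd : ∀ k, ∫ ω, nrm 1 (localUpdate A.lam (S k ω).Y) ^ 2 ∂P
      ≤ l ^ 2 * (2 * ∫ ω, nrm Ct (mix (projC uC) (S k ω).Y) ^ 2 ∂P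
        + 4 * ‖uC‖ ^ 2 * ∫ ω, ‖gradient (avgObj f) (wavg uR (S k ω).X)‖ ^ 2 ∂P
        + 4 * ‖uC‖ ^ 2 * (L ^ 2 / n) * ∫ ω, nrm Rt (mix (projR uR) (S k ω).X) ^ 2 ∂P) := by
    intro k
    have := integral_le_three (hdint k) (hgint k) (hGint k) (haint k) (a := l ^ 2 * 2)
      (b := l ^ 2 * (4 * ‖uC‖ ^ 2)) (c := l ^ 2 * (4 * ‖uC‖ ^ 2 * (L ^ 2 / n))) fun ω => ?_
    · linarith
    have h1 := nrm_update_sq_le hdiff hLgrad uR uC hlam hlaml (hsumY k ω)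
    rw [nrm_localUpdate_sq]
    have h3 := mul_le_mul_of_nonneg_left (hna k ω)
      (show 0 ≤ l ^ 2 * (4 * ‖uC‖ ^ 2 * (L ^ 2 / n)) by positivity)
    have h4 := mul_le_mul_of_nonneg_left (hng k ω) (show 0 ≤ l ^ 2 * 2 by positivity)
    linarith
  -- the Lyapunov function
  set V : ℕ → ℝ := fun k => ∫ ω, (avgObj f (wavg uR (S k ω).X) - avgObj f xs) ∂P
    + (ux * (θR * A.γx) * ∫ ω, nrm Rt (mix (projR uR) (S k ω).X) ^ 2 ∂P
      + 160 * ux * y * (A.αx * r * δ) * ∫ ω, nrm 1 ((S k ω).X - (S k ω).Hx) ^ 2 ∂P)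
    + (uy * (θC * A.γy) * ∫ ω, nrm Ct (mix (projC uC) (S k ω).Y) ^ 2 ∂P
      + 160 * uy * y₂ * (A.αy * r * δ) * ∫ ω, nrm 1 ((S k ω).Y - (S k ω).Hy) ^ 2 ∂P) with hV
  have o0 : ∀ k, 0 ≤ ∫ ω, (avgObj f (wavg uR (S k ω).X) - avgObj f xs) ∂P :=
    fun k => integral_nonneg fun ω => sub_nonneg.2 (hmin _)
  have hi0 : ∀ F : Ω → ℝ, 0 ≤ ∫ ω, F ω ^ 2 ∂P := fun F => integral_nonneg fun _ => sq_nonneg _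
  have hVrec : ∀ k, V (k + 1) ≤ ρ * V k
      + (((ux * (18 + 21600 * y) + ux) * (A.γx ^ 2 * δR ^ 2)
          + uy * (18 + 21600 * y₂) * (A.γy ^ 2 * δC ^ 2)) * (n * (c₀ * σ ^ 2))
        + 320 * ux * y * (A.αx * r * δ) * (n * (A.αx * r * (c₀ * σr ^ 2)))
        + 320 * uy * y₂ * (A.αy * r * δ) * (n * (A.αy * r * (c₀ * σr ^ 2)))) * c ^ k := by
    intro k
    obtain ⟨-, ⟨x, hx⟩, ⟨x₂, w₂, hy'⟩, hd₂⟩ := hrun k (hsq k)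
    have := lyapunov_step hx hy' (ho k) (hd k) hd₂ (o0 k) (hi0 _) (hi0 _) (hi0 _) (hi0 _)
      (hi0 _) (hi0 _) (hi0 _) (by positivity) hθR hTR.theta_le_one hγx hss.γx₁ hθγR ht ht1
      hθC hTC.theta_le_one hγy hss.γy₁ hθγC ht₂ ht₂1 huxpos.le huypos.le hy0 hy₂0 hyC hyθ hyδ
      hy₂C hy₂θ hy₂δ (div_mul_cancel₀ _ (by positivity)) (div_mul_cancel₀ _ (by positivity))
      hlpos.le hM.le hwPpos.le hwQpos.le hn hF₁ hF₂ hF₃ hF₄ ρ₁ ρ₂ ρ₃ ρ₄ ρ₅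
    refine this.trans (le_of_eq ?_)
    rw [hs k]
    ring
  obtain ⟨B, hB⟩ := exists_le_geometric hρc hρ0 hVrec
  have hX : ∀ k ω, X k ω = (S k ω).X := fun _ _ => rfl
  have hwsq : ∀ k ω, wsq Rt (mix (projR uR) (X k ω)) = nrm Rt (mix (projR uR) (S k ω).X) ^ 2 :=
    fun k ω => (nrm_sq _ _).symm
  simp only [hwsq]
  have hB0 : 0 ≤ B := by
    have h1 := hB 0
    have h2 : 0 ≤ V 0 := add_nonneg (add_nonneg (o0 0) (add_nonneg
      (mul_nonneg (by positivity) (hi0 _)) (mul_nonneg (by positivity) (hi0 _))))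
      (add_nonneg (mul_nonneg (by positivity) (hi0 _)) (mul_nonneg (by positivity) (hi0 _)))
    rw [pow_zero, mul_one] at h1
    exact h2.trans h1
  -- One constant for both errors: `V` contains the optimization error with weight `1` and the
  -- consensus error with weight `ux θR γx`.
  refine ⟨hoint, haint, B + B / (ux * (θR * A.γx)), hc, fun k => ?_, fun k => ?_⟩
  · have h1 : ∫ ω, (avgObj f (wavg uR (S k ω).X) - avgObj f xs) ∂P ≤ V k := by
      rw [hV]
      refine le_trans (le_add_of_nonneg_right (add_nonneg (mul_nonneg (by positivity) (hi0 _))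
        (mul_nonneg (by positivity) (hi0 _)))) (le_add_of_nonneg_right
          (add_nonneg (mul_nonneg (by positivity) (hi0 _)) (mul_nonneg (by positivity) (hi0 _))))
    refine (h1.trans (hB k)).trans (mul_le_mul_of_nonneg_right ?_ (pow_pos hc k).le)
    exact le_add_of_nonneg_right (by positivity)
  · have h1 : ux * (θR * A.γx) * ∫ ω, nrm Rt (mix (projR uR) (S k ω).X) ^ 2 ∂P ≤ V k := by
      rw [hV]
      exact le_trans (le_add_of_nonneg_of_le (o0 k) (le_add_of_nonneg_right
        (mul_nonneg (by positivity) (hi0 _)))) (le_add_of_nonneg_right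
          (add_nonneg (mul_nonneg (by positivity) (hi0 _)) (mul_nonneg (by positivity) (hi0 _))))
    have h2 := h1.trans (hB k)
    have h3 : ∫ ω, nrm Rt (mix (projR uR) (S k ω).X) ^ 2 ∂P
        ≤ B / (ux * (θR * A.γx)) * c ^ k := by
      rw [div_mul_eq_mul_div, le_div_iff₀ (by positivity)]
      linarith
    refine h3.trans (mul_le_mul_of_nonneg_right ?_ (pow_pos hc k).le)
    exact le_add_of_nonneg_left hB0

end Main

end RCPP

theorem theorem2 {n p : ℕ} (R C : Matrix (Fin n) (Fin n) ℝ)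
    (hnet : RCPP.NetworkAssumption R C) :
    -- the eigenvectors and the adapted norms exist
    (∃ (uR uC : EuclideanSpace ℝ (Fin n)) (Rt Ct : Matrix (Fin n) (Fin n) ℝ) (δR δC θR θC : ℝ),
      RCPP.IsLeftPerron R uR ∧ RCPP.IsRightPerron C uC ∧
      ∀ γ : ℝ, 0 < γ → γ ≤ 1 / 2 →
        RCPP.IsAdaptedNorm R (RCPP.projR uR) Rt δR θR γ ∧
        RCPP.IsAdaptedNorm C (RCPP.projC uC) Ct δC θC γ) ∧
    -- linear convergence, for all choices of them
    ∀ (uR uC : EuclideanSpace ℝ (Fin n)) (Rt Ct : Matrix (Fin n) (Fin n) ℝ) (δR δC θR θC : ℝ)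
      (f : Fin n → RCPP.Vec p → ℝ) (Lip : Fin n → ℝ≥0) (xs : RCPP.Vec p) (μ : ℝ)
      (Ξ : Type*) [MeasurableSpace Ξ] (ν : Measure Ξ) [IsProbabilityMeasure ν]
      (comp : Ξ → RCPP.Vec p → RCPP.Vec p) (Cq σ r δ σr : ℝ)
      (Ω : Type*) [MeasurableSpace Ω] (P : Measure Ω) [IsProbabilityMeasure P]
      (seed : ℕ → Bool → Fin n → Ω → Ξ)
      (X0 : RCPP.Stack n p) (lam : Fin n → ℝ) (αx αy γx γy M c c₀ : ℝ) (s : ℕ → ℝ),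
      RCPP.IsLeftPerron R uR →
      RCPP.IsRightPerron C uC →
      RCPP.IsAdaptedNorm R (RCPP.projR uR) Rt δR θR γx →
      RCPP.IsAdaptedNorm C (RCPP.projC uC) Ct δC θC γy →
      RCPP.SmoothAssumption f Lip →
      (∀ x, RCPP.avgObj f xs ≤ RCPP.avgObj f x) →
      RCPP.PLCondition (RCPP.avgObj f) xs μ →
      RCPP.CompressionAssumption ν comp Cq σ r δ σr →
      RCPP.FreshSeeds ν P seed →
      0 < αx → αx ≤ 1 / r → 0 < αy → αy ≤ 1 / r →
      (∀ i, 0 ≤ lam i) →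
      0 < M → M * RCPP.maxStep lam ≤ RCPP.avgStep uR uC lam →
      RCPP.StepSizeConditions uR uC δR δC θR θC (RCPP.maxLip Lip) Cq r δ M
        (RCPP.maxStep lam) αx αy γx γy →
      RCPP.rhoTilde M (RCPP.maxStep lam) μ θR θC r δ αx αy γx γy < c → c < 1 →
      0 < c₀ → (∀ k, s k ^ 2 = c₀ * c ^ k) →
      let A : RCPP.Params n :=
        { R := R, C := C, lam := lam, αx := αx, αy := αy, γx := γx, γy := γy, s := s }
      let X : ℕ → Ω → RCPP.Stack n p := RCPP.iterX A f X0 comp seed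
      let optErr : ℕ → Ω → ℝ := fun k ω =>
        RCPP.avgObj f (RCPP.wavg uR (X k ω)) - RCPP.avgObj f xs
      let consErr : ℕ → Ω → ℝ := fun k ω => RCPP.wsq Rt (RCPP.mix (RCPP.projR uR) (X k ω))
      (∀ k, Integrable (optErr k) P) ∧ (∀ k, Integrable (consErr k) P) ∧
      Tendsto (fun k => ∫ ω, optErr k ω ∂P) atTop (𝓝 0) ∧
      Tendsto (fun k => ∫ ω, consErr k ω ∂P) atTop (𝓝 0) ∧
      (fun k => ∫ ω, optErr k ω ∂P) =O[atTop] (fun k => c ^ k) ∧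
      (fun k => ∫ ω, consErr k ω ∂P) =O[atTop] (fun k => c ^ k) := by
  obtain ⟨i₀, -⟩ := hnet.common_root
  -- The common root is an element of `Fin n`, so there is at least one agent.
  have : NeZero n := ⟨fun h => by subst h; exact i₀.elim0⟩
  refine ⟨RCPP.exists_eigenvectors_and_norms hnet, ?_⟩
  intro uR uC Rt Ct δR δC θR θC f Lip xs μ Ξ _ ν _ comp Cq σ r δ σr Ω _ P _ seed X0 lam αx αy γx γy
    M c c₀ s huR huC hTR hTC hsm hmin hPL hC hseed hαx hαxr hαy hαyr hlam hM hMl hss hρc hc1 hc₀ hs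
    A X optErr consErr
  obtain ⟨ho, ha, B, hc, hoB, haB⟩ := RCPP.exists_geometric_bound (A := A)
    hnet.row_stochastic hnet.col_stochastic X0 huR huC hTR hTC hsm hmin hPL hC hseed
    hαx hαxr hαy hαyr hlam hM hMl hss hρc hc1 hc₀ hs
  have hO : ∀ e : ℕ → Ω → ℝ, (∀ k ω, 0 ≤ e k ω) → (∀ k, ∫ ω, e k ω ∂P ≤ B * c ^ k) →
      (fun k => ∫ ω, e k ω ∂P) =O[atTop] (fun k => c ^ k) := by
    intro e h0 hB
    refine IsBigO.of_bound B (Eventually.of_forall fun k => ?_)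
    rw [Real.norm_of_nonneg (integral_nonneg (h0 k)), Real.norm_of_nonneg (pow_pos hc k).le]
    exact hB k
  have hO₁ := hO optErr (fun k ω => sub_nonneg.2 (hmin _)) hoB
  have hO₂ := hO consErr (fun k ω => Finset.sum_nonneg fun _ _ => sq_nonneg _) haB
  have hlim := tendsto_pow_atTop_nhds_zero_of_lt_one hc.le hc1
  exact ⟨ho, ha, hO₁.trans_tendsto hlim, hO₂.trans_tendsto hlim, hO₁, hO₂⟩
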